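/- For positive integers $m,s,n$ with $n\ge 3$ and a unit $r\in\mathbb{Z}_n^*$ with $r^{ms}=\pm1$, let $\overline{\mathrm{CPM}}(m,s,n;r)$ be the simple graph whose vertices are the pairs $\langle i;\mathbf v\rangle$ with $i\in\mathbb{Z}_{ms}$ and $\mathbf v\in\mathbb{Z}_n^s$, and whose edges are given by $$\langle i;\mathbf v\rangle\sim\langle i+1;\mathbf v\pm r^i\mathbf e_\ell\rangle,\qquad \ell = i \bmod s,$$ where $\mathbf e_0,\dots,\mathbf e_{s-1}$ are the standard vectors of $\mathbb{Z}_n^s$. Let $\mathrm{CPM}(m,s,n;r)$ be the connected component of $\overline{\mathrm{CPM}}(m,s,n;r)$ containing $\langle 0;\mathbf 0\rangle$. A graph is $2$-arc-transitive if its automorphism group acts transitively on its $2$-arcs, that is, on the ordered triples $(a,b,c)$ of vertices with $a\sim b\sim c$ and $a\neq c$. Let $m,s,n$ be positive integers with $n\ge 3$, $n\ne 4$, $s\ge 2$ and $ms\ge 3$, and let $r\in\mathbb{Z}_n^*$ satisfy $r^{ms}=\pm 1$; let $m',s',n'$ and $r'\in\mathbb{Z}_{n'}^*$ satisfy the same conditions.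 Suppose that the graphs $\Gamma=\mathrm{CPM}(m,s,n;r)$ and $\Gamma'=\mathrm{CPM}(m',s',n';r')$ are both $2$-arc-transitive. Then $\Gamma'\cong\Gamma$ if and only if $m'=m$, $s'=s=2$, $n'=n$ and $(r'r^{-1})^2=\pm1$ in $\mathbb{Z}_n$. (Here $x=\pm1$ means that $x=1$ or $x=-1$.) -/

import Mathlib

/-- The graph `CPMbar(m, s, n; r)`: the vertices are the pairs `⟨i; v⟩` with `i ∈ ℤ_{ms}` and
`v ∈ ℤ_n^s`, and `⟨i; v⟩ ∼ ⟨i + 1; v ± r ^ i • e_ℓ⟩` with `ℓ = i mod s`.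
(The exponent `i` is taken as the representative in `{0, …, ms - 1}`; when `r ^ (m * s) = ±1`, any
other representative gives the same pair of neighbours.) -/
def CPMbar (m s n : ℕ) (r : (ZMod n)ˣ) : SimpleGraph (ZMod (m * s) × (Fin s → ZMod n)) :=
  SimpleGraph.fromRel fun x y =>
    y.1 = x.1 + 1 ∧
      (y.2 = x.2 + (fun j : Fin s => if j.val = x.1.val % s then (r : ZMod n) ^ x.1.val else 0) ∨
       y.2 = x.2 - (fun j : Fin s => if j.val = x.1.val % s then (r : ZMod n) ^ x.1.val else 0))

/-- The graph `CPM(m, s, n; r)`: the connected component of `CPMbar(m, s, n; r)` that contains the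
vertex `⟨0; 0⟩`. -/
def CPM (m s n : ℕ) (r : (ZMod n)ˣ) :
    SimpleGraph ((CPMbar m s n r).connectedComponentMk (0, 0)) :=
  ((CPMbar m s n r).connectedComponentMk (0, 0)).toSimpleGraph

/-- `(a, b, c)` is a 2-arc of `G`: consecutive vertices are adjacent and `a ≠ c`. -/
def IsTwoArc {V : Type*} (G : SimpleGraph V) (a b c : V) : Prop :=
  G.Adj a b ∧ G.Adj b c ∧ a ≠ c

/-- `G` is 2-arc-transitive: its automorphism group acts transitively on the set of its 2-arcs. -/
def IsTwoArcTransitive {V : Type*} (G : SimpleGraph V) : Prop :=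
  ∀ a b c a' b' c' : V, IsTwoArc G a b c → IsTwoArc G a' b' c' →
    ∃ φ : G ≃g G, φ a = a' ∧ φ b = b' ∧ φ c = c'

/-- The standing assumption on the parameters: `m, s, n` are positive integers with `n ≥ 3`,
`n ≠ 4`, `s ≥ 2`, `ms ≥ 3`, and `r ∈ ℤ_n^*` satisfies `r ^ (ms) = ±1`. -/
def CPMAssumption (m s n : ℕ) (r : (ZMod n)ˣ) : Prop :=
  0 < m ∧ 3 ≤ n ∧ n ≠ 4 ∧ 2 ≤ s ∧ 3 ≤ m * s ∧ (r ^ (m * s) = 1 ∨ r ^ (m * s) = -1)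

/-!
The vertices are arranged in `m * s` levels, and the edges between the levels `k` and `k + 1` move the
vector by `± r ^ k e_ℓ`. A walk without backtracking is thus a word in the letters `u` (up) and
`d` (down), together with signs; at a turn, `ud` or `du`, the two signs agree. A word closes up if its
coefficients with respect to each `e_ℓ` cancel and its change of level is a multiple of `m * s`.
Integer levels are used throughout, so that words can be treated without reference to `ℤ_{ms}`
(`adj_iff`, `exists_eq_path`, `exists_closedNB_of_word`).

Necessary conditions for 2-arc-transitivity. The graph has valency `4`, and one in three 2-arcs is a
turn. In a 2-arc-transitive graph all 2-arcs lie on equally many closed walks of length `L`, so the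
average number of turns of these walks is `L / 3` (`three_mul_turnCount_eq`). For `L = 8` there is
always a closed walk with four turns, hence also one with at most two, that is, a word
`u ^ t d ^ (8 - t)`. The closing equations of such words leave the parameters with `2 r ^ s = ± 2`
and `s ∈ {2, 3}`, and some with `m * s ∣ 8` (`cases_of_twoArcTransitive`). All cases but those with
`s = 2` and `2 r ^ 2 = ± 2` are excluded (`two_mul_sq_of_twoArcTransitive`), in two ways. Around a peak
`ud`, the last vertex of a 4-arc on an octagon determines its first vertex, whereas straight 3-arcs
may have two predecessors (`false_of_two_predecessors`). Or alternating 3-arcs lie on no octagon,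
whereas 3-arcs `uud` always do; then an automorphism that maps a peak to `uu` maps the zigzag `udud…`
to a straight line, whose signs are forced, and a comparison of periods yields a vanishing geometric
sum in `± r ^ 2` (`geom_sum_eq_zero_of_twoArcTransitive`).

Comparison of two graphs. Suppose that `s = 2` and `2 r ^ 2 = 2 κ` with `κ = ± 1`. Then all 3-arcs `uud`,
`udd`, `duu` lie on hexagons, and alternating ones do not, unless `n ∣ 6`; by averaging, `n = 6` is
impossible, and for `n = 3` all 3-arcs lie on hexagons. The comparison of periods, now with
hexagons, shows that either `n` is odd and `r ^ 2 = κ`, or `4 ∣ n`, `m` is even and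
`r ^ 2 = κ (1 + n / 2)` (`params_of_twoArcTransitive`). Therefore `n` determines `r ^ 2` up to sign. An
isomorphism can be chosen to map the zigzag to the zigzag, whose period is the least common multiple
of `2` and `n`; this recovers `n` (`n_eq_of_iso`). The component of the origin has `2 m c` vertices,
where `c` is the number of multiples of `2` in `ℤ_n ^ 2`, and this recovers `m` (`m_eq_of_iso`).
Conversely, if `(r' / r) ^ 2 = ± 1`, rescaling the second coordinate by `r' / r` is an isomorphism
(`nonempty_iso_of_sq`).
-/

/-! ### Displacement vectors -/

/-- `c` is one of the scalars `1`, `-1` of `ZMod n`. -/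
def IsSign {n : ℕ} (c : ZMod n) : Prop := c = 1 ∨ c = -1

theorem IsSign.one {n : ℕ} : IsSign (1 : ZMod n) := Or.inl rfl

theorem IsSign.neg_one {n : ℕ} : IsSign (-1 : ZMod n) := Or.inr rfl

theorem IsSign.neg {n : ℕ} {c : ZMod n} (h : IsSign c) : IsSign (-c) := by
  rcases h with rfl | rfl
  · exact Or.inr rfl
  · exact Or.inl (neg_neg 1)

theorem IsSign.mul {n : ℕ} {c d : ZMod n} (hc : IsSign c) (hd : IsSign d) : IsSign (c * d) := by
  rcases hc with rfl | rfl
  · rwa [one_mul]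
  · rw [neg_one_mul]; exact hd.neg

theorem IsSign.mul_self {n : ℕ} {c : ZMod n} (hc : IsSign c) : c * c = 1 := by
  rcases hc with rfl | rfl <;> ring

theorem isUnit_of_isSign {n : ℕ} {c : ZMod n} (hc : IsSign c) : IsUnit c :=
  IsUnit.of_mul_eq_one c hc.mul_self

/-- The displacement vector `r ^ k • e_ℓ`, `ℓ = k mod s`, of the edges between the levels `k` and
`k + 1`. Levels are lifted from `ℤ_{ms}` to `ℤ`; the two signed vectors `± stepVec r k` only depend
on the class of `k` modulo `m * s`. -/
def stepVec {s n : ℕ} (r : (ZMod n)ˣ) (k : ℤ) : Fin s → ZMod n :=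
  fun j => if (j.val : ℤ) = k % s then ((r ^ k : (ZMod n)ˣ) : ZMod n) else 0

theorem stepVec_add_eq {s n : ℕ} (r : (ZMod n)ˣ) (k j : ℤ) (hj : (s : ℤ) ∣ j) :
    (stepVec r (k + j) : Fin s → ZMod n) = ((r ^ j : (ZMod n)ˣ) : ZMod n) • stepVec r k := by
  obtain ⟨t, rfl⟩ := hj
  funext i
  simp only [stepVec, Pi.smul_apply, smul_eq_mul, Int.add_mul_emod_self_left, zpow_add,
    Units.val_mul]
  split_ifs <;> ring

/-- The linear functional that takes the value `1` at `stepVec r k` and vanishes at `stepVec r j` for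
`j` in another residue class modulo `s`. -/
def coordAt {s n : ℕ} [NeZero s] (r : (ZMod n)ˣ) (k : ℤ) : (Fin s → ZMod n) →ₗ[ZMod n] ZMod n :=
  ((r ^ (-k) : (ZMod n)ˣ) : ZMod n) • LinearMap.proj (Fin.ofNat s (k % s).toNat)

theorem coordAt_stepVec {s n : ℕ} [NeZero s] (r : (ZMod n)ˣ) (k j : ℤ) :
    coordAt (s := s) r k (stepVec r (k + j)) =
      if (s : ℤ) ∣ j then ((r ^ j : (ZMod n)ˣ) : ZMod n) else 0 := by
  have hs : (0 : ℤ) < s := by exact_mod_cast Nat.pos_of_ne_zero (NeZero.ne s)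
  have h0 := Int.emod_nonneg k hs.ne'
  have h1 := Int.emod_lt_of_pos k hs
  have h2 : (((Fin.ofNat s (k % s).toNat).val : ℕ) : ℤ) = k % s := by
    simp only [Fin.ofNat]
    push_cast
    rw [Int.toNat_of_nonneg h0, Int.emod_emod_of_dvd _ (dvd_refl _)]
  have h3 : (k % s = (k + j) % s) ↔ (s : ℤ) ∣ j := by
    rw [show (k % s = (k + j) % s) ↔ k ≡ k + j [ZMOD s] from Iff.rfl, Int.modEq_iff_dvd]
    simp
  simp only [coordAt, LinearMap.smul_apply, LinearMap.proj_apply, stepVec, smul_eq_mul, h2, h3]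
  split_ifs
  · rw [← Units.val_mul, ← zpow_add]; congr 2; ring
  · simp

theorem coordAt_stepVec_self {s n : ℕ} [NeZero s] (r : (ZMod n)ˣ) (k : ℤ) :
    coordAt (s := s) r k (stepVec r k) = 1 := by
  have := coordAt_stepVec (s := s) r k 0
  simpa using this

theorem two_ne_zero_of {n : ℕ} (h : 3 ≤ n) : (2 : ZMod n) ≠ 0 := by
  intro h2
  have : ((2 : ℕ) : ZMod n) = 0 := by exact_mod_cast h2
  rw [ZMod.natCast_eq_zero_iff] at this
  have := Nat.le_of_dvd (by norm_num) this
  omega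

theorem four_ne_zero_of {n : ℕ} (h : 3 ≤ n) (h4 : n ≠ 4) : (4 : ZMod n) ≠ 0 := by
  intro h2
  have : ((4 : ℕ) : ZMod n) = 0 := by exact_mod_cast h2
  rw [ZMod.natCast_eq_zero_iff] at this
  have h5 := Nat.le_of_dvd (by norm_num) this
  interval_cases n <;> omega

/-- `r ^ t = ± 1` for every multiple `t` of `m * s`. -/
theorem isSign_zpow_of_dvd {m s n : ℕ} {r : (ZMod n)ˣ} (h : CPMAssumption m s n r) {t : ℤ}
    (ht : ((m * s : ℕ) : ℤ) ∣ t) : IsSign ((r ^ t : (ZMod n)ˣ) : ZMod n) := by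
  obtain ⟨j, rfl⟩ := ht
  rw [zpow_mul, zpow_natCast]
  rcases h.2.2.2.2.2 with h1 | h1
  · rw [h1, one_zpow]; exact Or.inl rfl
  · rw [h1]
    rcases Int.even_or_odd j with hj | hj
    · rw [hj.neg_one_zpow]; exact Or.inl rfl
    · rw [hj.neg_one_zpow]; exact Or.inr (by simp)

theorem stepVec_congr {m s n : ℕ} {r : (ZMod n)ˣ} (h : CPMAssumption m s n r) {k k' : ℤ}
    (hk : (k : ZMod (m * s)) = k') :
    ∃ τ : ZMod n, IsSign τ ∧ (stepVec r k' : Fin s → ZMod n) = τ • stepVec r k := by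
  have hd : ((m * s : ℕ) : ℤ) ∣ k' - k := by
    rwa [ZMod.intCast_eq_intCast_iff_dvd_sub] at hk
  refine ⟨_, isSign_zpow_of_dvd h hd, ?_⟩
  have := stepVec_add_eq (s := s) r k (k' - k) (dvd_trans ⟨m, by push_cast; ring⟩ hd)
  rwa [show k + (k' - k) = k' by ring] at this

theorem stepVec_smul_injective {m s n : ℕ} {r : (ZMod n)ˣ} (h : CPMAssumption m s n r) (k : ℤ)
    {a b : ZMod n} (hab : a • (stepVec r k : Fin s → ZMod n) = b • stepVec r k) : a = b := by
  have : NeZero s := ⟨by have := h.2.2.2.1; omega⟩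
  have := congrArg (coordAt (s := s) r k) hab
  simpa [coordAt_stepVec_self] using this

/-! ### Adjacency along integer levels -/

/-- The vertex `⟨k; v⟩`, where the level is given by an integer representative. -/
def pt (m : ℕ) {s n : ℕ} (k : ℤ) (v : Fin s → ZMod n) : ZMod (m * s) × (Fin s → ZMod n) :=
  ((k : ZMod (m * s)), v)

theorem pt_val_cast {m s n : ℕ} {r : (ZMod n)ˣ} (h : CPMAssumption m s n r)
    (x : ZMod (m * s) × (Fin s → ZMod n)) : pt m (x.1.val : ℤ) x.2 = x := by
  have : NeZero (m * s) := ⟨by have := h.2.2.2.2.1; omega⟩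
  ext1 <;> simp [pt]

/-- As `m * s ≥ 3`, two consecutive steps in the same direction do not lead back to the same level. -/
theorem small_cast_ne_zero {m s n : ℕ} {r : (ZMod n)ˣ} (h : CPMAssumption m s n r) {j : ℤ}
    (h1 : 0 < j) (h2 : j < 3) : (j : ZMod (m * s)) ≠ 0 := by
  intro hj
  rw [ZMod.intCast_zmod_eq_zero_iff_dvd] at hj
  have := Int.le_of_dvd h1 hj
  have := h.2.2.2.2.1
  omega

/-- Adjacency, with the level given by any integer in the class instead of the representative in
`{0, …, ms - 1}`. This is where `r ^ (m * s) = ± 1` enters: a change of the representative multiplies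
the displacement vector by a sign. -/
theorem adj_iff {m s n : ℕ} {r : (ZMod n)ˣ} (h : CPMAssumption m s n r)
    (x y : ZMod (m * s) × (Fin s → ZMod n)) :
    (CPMbar m s n r).Adj x y ↔
      (∃ (k : ℤ) (v : Fin s → ZMod n) (c : ZMod n), IsSign c ∧ x = pt m k v ∧
        y = pt m (k + 1) (v + c • stepVec r k)) ∨
      (∃ (k : ℤ) (v : Fin s → ZMod n) (c : ZMod n), IsSign c ∧ y = pt m k v ∧
        x = pt m (k + 1) (v + c • stepVec r k)) := by
  have : NeZero (m * s) := ⟨by have := h.2.2.2.2.1; omega⟩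
  have key : ∀ x y : ZMod (m * s) × (Fin s → ZMod n),
      (y.1 = x.1 + 1 ∧
      (y.2 = x.2 + (fun j : Fin s => if j.val = x.1.val % s then (r : ZMod n) ^ x.1.val else 0) ∨
       y.2 = x.2 - (fun j : Fin s => if j.val = x.1.val % s then (r : ZMod n) ^ x.1.val else 0))) ↔
      (∃ (k : ℤ) (v : Fin s → ZMod n) (c : ZMod n), IsSign c ∧ x = pt m k v ∧
        y = pt m (k + 1) (v + c • stepVec r k)) := by
    intro x y
    have hE : (fun j : Fin s => if j.val = x.1.val % s then (r : ZMod n) ^ x.1.val else 0) =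
        (stepVec r (x.1.val : ℤ) : Fin s → ZMod n) := by
      funext j
      have e : ((j.val : ℤ) = (x.1.val : ℤ) % s) ↔ j.val = x.1.val % s := by
        rw [← Int.natCast_mod]; exact Int.natCast_inj
      simp only [stepVec, e, zpow_natCast, Units.val_pow_eq_pow_val]
    rw [hE]
    constructor
    · rintro ⟨h1, h2⟩
      rcases h2 with h2 | h2
      · refine ⟨x.1.val, x.2, 1, Or.inl rfl, (pt_val_cast h x).symm, ?_⟩
        ext1
        · rw [h1]; simp [pt]
        · rw [h2]; simp [pt]
      · refine ⟨x.1.val, x.2, -1, Or.inr rfl, (pt_val_cast h x).symm, ?_⟩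
        ext1
        · rw [h1]; simp [pt]
        · rw [h2]; simp [pt, sub_eq_add_neg]
    · rintro ⟨k, v, c, hc, hx, hy⟩
      have hx1 : x.1 = (k : ZMod (m * s)) := by rw [hx]; rfl
      have hx2 : x.2 = v := by rw [hx]; rfl
      obtain ⟨τ, hτ, hE'⟩ := stepVec_congr h (k := ((x.1.val : ℕ) : ℤ)) (k' := k) (by simp [hx1])
      refine ⟨?_, ?_⟩
      · rw [hy, hx1]; simp [pt]
      · rw [hy, hx2, hE']
        simp only [pt, smul_smul]
        rcases hc.mul hτ with h1 | h1 <;> rw [h1]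
        · left; simp
        · right; simp [sub_eq_add_neg]
  have hne : ∀ x y : ZMod (m * s) × (Fin s → ZMod n), y.1 = x.1 + 1 → x ≠ y := by
    rintro x y h1 rfl
    have := small_cast_ne_zero h (j := 1) (by norm_num) (by norm_num)
    apply this
    simpa using h1
  rw [CPMbar, SimpleGraph.fromRel_adj, key x y, key y x]
  constructor
  · exact fun h => h.2
  · intro h'
    refine ⟨?_, h'⟩
    rcases h' with h' | h'
    · exact hne x y ((key x y).2 h').1
    · exact (hne y x ((key y x).2 h').1).symm

theorem adj_up {m s n : ℕ} {r : (ZMod n)ˣ} (h : CPMAssumption m s n r) (k : ℤ)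
    (v : Fin s → ZMod n) {c : ZMod n} (hc : IsSign c) :
    (CPMbar m s n r).Adj (pt m k v) (pt m (k + 1) (v + c • stepVec r k)) :=
  (adj_iff h _ _).2 (Or.inl ⟨k, v, c, hc, rfl, rfl⟩)

theorem adj_down {m s n : ℕ} {r : (ZMod n)ˣ} (h : CPMAssumption m s n r) (k : ℤ)
    (v : Fin s → ZMod n) {c : ZMod n} (hc : IsSign c) :
    (CPMbar m s n r).Adj (pt m k v) (pt m (k - 1) (v + c • stepVec r (k - 1))) := by
  refine (adj_iff h _ _).2 (Or.inr ⟨k - 1, v + c • stepVec r (k - 1), -c, hc.neg, rfl, ?_⟩)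
  simp [pt]

theorem adj_pt_cases {m s n : ℕ} {r : (ZMod n)ˣ} (h : CPMAssumption m s n r) {k : ℤ}
    {v : Fin s → ZMod n} {y : ZMod (m * s) × (Fin s → ZMod n)}
    (hy : (CPMbar m s n r).Adj (pt m k v) y) :
    (∃ c : ZMod n, IsSign c ∧ y = pt m (k + 1) (v + c • stepVec r k)) ∨
      (∃ c : ZMod n, IsSign c ∧ y = pt m (k - 1) (v + c • stepVec r (k - 1))) := by
  rcases (adj_iff h _ _).1 hy with ⟨k', v', c, hc, h1, h2⟩ | ⟨k', v', c, hc, h1, h2⟩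
  · left
    have e1 : (k : ZMod (m * s)) = k' := congrArg Prod.fst h1
    have e2 : v = v' := congrArg Prod.snd h1
    obtain ⟨τ, hτ, hE⟩ := stepVec_congr h e1
    refine ⟨c * τ, hc.mul hτ, ?_⟩
    rw [h2, hE, smul_smul, e2]
    simp [pt, e1]
  · right
    have e1 : (k : ZMod (m * s)) = ((k' + 1 : ℤ) : ZMod (m * s)) := congrArg Prod.fst h2
    have e2 : v = v' + c • stepVec r k' := congrArg Prod.snd h2
    have e3 : ((k - 1 : ℤ) : ZMod (m * s)) = k' := by push_cast at e1 ⊢; rw [e1]; ring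
    obtain ⟨τ, hτ, hE⟩ := stepVec_congr h e3
    refine ⟨-(c * τ), (hc.mul hτ).neg, ?_⟩
    rw [h1, e2, hE, neg_smul, smul_smul, add_neg_cancel_right]
    simp only [pt, e3]

/-- Whether the step from `x` to `y` raises the level. -/
def goesUp {m s n : ℕ} (x y : ZMod (m * s) × (Fin s → ZMod n)) : Bool := decide (y.1 = x.1 + 1)

theorem goesUp_up {m s n : ℕ} (k : ℤ) (v w : Fin s → ZMod n) :
    goesUp (pt m k v) (pt m (k + 1) w) = true := by
  simp [goesUp, pt]

/-- Steps down are not steps up: this needs `2 ≠ 0` in `ℤ_{ms}`. -/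
theorem goesUp_down {m s n : ℕ} {r : (ZMod n)ˣ} (h : CPMAssumption m s n r) (k : ℤ)
    (v w : Fin s → ZMod n) : goesUp (pt m k v) (pt m (k - 1) w) = false := by
  have := small_cast_ne_zero h (j := 2) (by norm_num) (by norm_num)
  refine decide_eq_false fun h1 => ?_
  simp only [pt] at h1
  apply this
  push_cast at h1 ⊢
  linear_combination -h1

theorem pt_level_ne {m s n : ℕ} {r : (ZMod n)ˣ} (h : CPMAssumption m s n r) (k : ℤ)
    (v w : Fin s → ZMod n) : pt m (k + 1) v ≠ pt m (k - 1) w := by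
  intro h1
  have := small_cast_ne_zero h (j := 2) (by norm_num) (by norm_num)
  have h2 : ((k + 1 : ℤ) : ZMod (m * s)) = ((k - 1 : ℤ) : ZMod (m * s)) := congrArg Prod.fst h1
  apply this
  push_cast at h2 ⊢
  linear_combination h2

/-! ### Walks without backtracking, lifted to integer levels -/

/-- The integer level after `i` steps, for a walk that starts at level `k` and goes up at step `i`
iff `u i`. -/
def lev (u : ℕ → Bool) (k : ℤ) : ℕ → ℤ
  | 0 => k
  | i + 1 => lev u k i + if u i then 1 else -1

/-- The lower one of the two levels joined by step `i`. -/
def bot (u : ℕ → Bool) (k : ℤ) (i : ℕ) : ℤ := if u i then lev u k i else lev u k i - 1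

/-- The vector after `i` steps of the walk that starts at `⟨k; v⟩` and moves by `c i • stepVec` at
step `i`. -/
def pos {s n : ℕ} (r : (ZMod n)ˣ) (u : ℕ → Bool) (c : ℕ → ZMod n) (k : ℤ) (v : Fin s → ZMod n)
    (i : ℕ) : Fin s → ZMod n :=
  v + ∑ j ∈ Finset.range i, c j • stepVec r (bot u k j)

/-- The walk with directions `u` and signs `c` that starts at `⟨k; v⟩`. -/
def path (m : ℕ) {s n : ℕ} (r : (ZMod n)ˣ) (u : ℕ → Bool) (c : ℕ → ZMod n) (k : ℤ)
    (v : Fin s → ZMod n) (i : ℕ) : ZMod (m * s) × (Fin s → ZMod n) :=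
  pt m (lev u k i) (pos r u c k v i)

theorem path_zero {m s n : ℕ} (r : (ZMod n)ˣ) (u : ℕ → Bool) (c : ℕ → ZMod n) (k : ℤ)
    (v : Fin s → ZMod n) : path m r u c k v 0 = pt m k v := by
  simp [path, lev, pos]

theorem path_succ_of_up {m s n : ℕ} (r : (ZMod n)ˣ) {u : ℕ → Bool} (c : ℕ → ZMod n) (k : ℤ)
    (v : Fin s → ZMod n) {i : ℕ} (hi : u i = true) : path m r u c k v (i + 1) =
      pt m (lev u k i + 1) (pos r u c k v i + c i • stepVec r (lev u k i)) := by
  simp [path, lev, pos, Finset.sum_range_succ, bot, hi, add_assoc]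

theorem path_succ_of_down {m s n : ℕ} (r : (ZMod n)ˣ) {u : ℕ → Bool} (c : ℕ → ZMod n) (k : ℤ)
    (v : Fin s → ZMod n) {i : ℕ} (hi : u i = false) : path m r u c k v (i + 1) =
      pt m (lev u k i - 1) (pos r u c k v i + c i • stepVec r (lev u k i - 1)) := by
  simp [path, lev, pos, Finset.sum_range_succ, bot, hi, add_assoc, sub_eq_add_neg]

theorem path_adj {m s n : ℕ} {r : (ZMod n)ˣ} (h : CPMAssumption m s n r) (u : ℕ → Bool)
    {c : ℕ → ZMod n} (k : ℤ) (v : Fin s → ZMod n) {i : ℕ} (hc : IsSign (c i)) :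
    (CPMbar m s n r).Adj (path m r u c k v i) (path m r u c k v (i + 1)) := by
  cases hi : u i
  · rw [path_succ_of_down r c k v hi]; exact adj_down h _ _ hc
  · rw [path_succ_of_up r c k v hi]; exact adj_up h _ _ hc

/-- The two edges of a turn lie between the same two levels. -/
theorem bot_succ_of_turn {u : ℕ → Bool} {k : ℤ} {i : ℕ} (hi : u i ≠ u (i + 1)) :
    bot u k (i + 1) = bot u k i := by
  cases h0 : u i <;> cases h1 : u (i + 1) <;> simp_all [bot, lev, sub_eq_add_neg]

/-- Two consecutive steps return to the starting point iff they form a turn with opposite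
displacements. -/
theorem path_add_two_ne_iff {m s n : ℕ} {r : (ZMod n)ˣ} (h : CPMAssumption m s n r) (u : ℕ → Bool)
    {c : ℕ → ZMod n} (k : ℤ) (v : Fin s → ZMod n) {i : ℕ} (hc : IsSign (c i))
    (hc' : IsSign (c (i + 1))) :
    path m r u c k v i ≠ path m r u c k v (i + 2) ↔ (u i ≠ u (i + 1) → c i = c (i + 1)) := by
  have hpos : pos r u c k v (i + 2) = pos r u c k v i +
      (c i • stepVec r (bot u k i) + c (i + 1) • stepVec r (bot u k (i + 1))) := by
    simp [pos, Finset.sum_range_succ, add_assoc]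
  by_cases ht : u i = u (i + 1)
  · simp only [ht, ne_eq, not_true_eq_false, IsEmpty.forall_iff, iff_true]
    cases h1 : u (i + 1)
    · have e : path m r u c k v (i + 2) = pt m (lev u k i - 1 - 1) (pos r u c k v (i + 2)) := by
        simp [path, lev, ht, h1, sub_eq_add_neg]
      rw [e]
      have := pt_level_ne h (lev u k i - 1) (pos r u c k v i) (pos r u c k v (i + 2))
      rwa [sub_add_cancel] at this
    · have e : path m r u c k v (i + 2) = pt m (lev u k i + 1 + 1) (pos r u c k v (i + 2)) := by
        simp [path, lev, ht, h1]
      rw [e]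
      have := pt_level_ne h (lev u k i + 1) (pos r u c k v (i + 2)) (pos r u c k v i)
      rw [add_sub_cancel_right] at this
      exact fun h => this h.symm
  · have hl : lev u k (i + 2) = lev u k i := by
      cases h0 : u i <;> cases h1 : u (i + 1) <;> simp_all [lev]
    simp only [ne_eq, ht, not_false_eq_true, forall_const]
    rw [bot_succ_of_turn ht, ← add_smul] at hpos
    have : path m r u c k v i = path m r u c k v (i + 2) ↔ c i + c (i + 1) = 0 := by
      simp only [path, hl, hpos]
      constructor
      · intro h1
        have h2 : pos r u c k v i = pos r u c k v i + (c i + c (i + 1)) • stepVec r (bot u k i) :=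
          congrArg Prod.snd h1
        refine stepVec_smul_injective h (bot u k i) ?_
        rw [zero_smul]
        exact (left_eq_add.1 h2)
      · intro h1; rw [h1, zero_smul, add_zero]
    rw [this]
    have h2 := two_ne_zero_of h.2.1
    rcases hc with h3 | h3 <;> rcases hc' with h4 | h4 <;> rw [h3, h4]
    · simp; norm_num; exact h2
    · simp only [add_neg_cancel, not_true_eq_false, false_iff]
      intro h5; apply h2; linear_combination h5
    · simp only [neg_add_cancel, not_true_eq_false, false_iff]
      intro h5; apply h2; linear_combination -h5
    · simp only [iff_true]; intro h5; apply h2; linear_combination -h5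

/-- Every walk without backtracking is `path` for suitable directions and signs. -/
theorem exists_eq_path {m s n : ℕ} {r : (ZMod n)ˣ} (h : CPMAssumption m s n r)
    {f : ℕ → ZMod (m * s) × (Fin s → ZMod n)} (hadj : ∀ i, (CPMbar m s n r).Adj (f i) (f (i + 1)))
    (hnb : ∀ i, f i ≠ f (i + 2)) {k : ℤ} {v : Fin s → ZMod n} (h0 : f 0 = pt m k v) :
    ∃ (u : ℕ → Bool) (c : ℕ → ZMod n), (∀ i, IsSign (c i)) ∧
      (∀ i, u i ≠ u (i + 1) → c i = c (i + 1)) ∧ (∀ i, f i = path m r u c k v i) ∧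
      ∀ i, u i = goesUp (f i) (f (i + 1)) := by
  classical
  let u : ℕ → Bool := fun i => goesUp (f i) (f (i + 1))
  have key : ∀ i, f i = pt m (lev u k i) (f i).2 → ∃ c : ZMod n, IsSign c ∧
      f (i + 1) = pt m (lev u k (i + 1)) ((f i).2 + c • stepVec r (bot u k i)) := by
    intro i hi
    have ha := hadj i
    rw [hi] at ha
    rcases adj_pt_cases h ha with ⟨c, hc, h1⟩ | ⟨c, hc, h1⟩
    · have hu : u i = true := by
        simp only [u]; rw [hi, h1]; exact goesUp_up _ _ _
      exact ⟨c, hc, by simpa [lev, bot, hu] using h1⟩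
    · have hu : u i = false := by
        simp only [u]; rw [hi, h1]; exact goesUp_down h _ _ _
      exact ⟨c, hc, by simpa [lev, bot, hu, sub_eq_add_neg] using h1⟩
  have hl : ∀ i, f i = pt m (lev u k i) (f i).2 := by
    intro i
    induction i with
    | zero => simp [lev, h0, pt]
    | succ i ih =>
      obtain ⟨c, -, h1⟩ := key i ih
      rw [h1]; rfl
  choose c hc hf using fun i => key i (hl i)
  have hpath : ∀ i, f i = path m r u c k v i := by
    intro i
    induction i with
    | zero => rw [h0, path_zero]
    | succ i ih =>
      rw [hf i, ih]
      simp [path, pt, pos, Finset.sum_range_succ, add_assoc]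
  refine ⟨u, c, hc, ?_, hpath, fun i => rfl⟩
  intro i
  refine (path_add_two_ne_iff h u k v (hc i) (hc (i + 1))).1 ?_
  rw [← hpath, ← hpath]
  exact hnb i

/-! ### Closed walks without backtracking -/

/-- `x`, indexed cyclically by `ℤ_L`, is a closed walk of length `L` without backtracking. Vertices
may repeat. -/
def IsClosedNB {V : Type*} (G : SimpleGraph V) (L : ℕ) (x : ZMod L → V) : Prop :=
  ∀ i, G.Adj (x i) (x (i + 1)) ∧ x i ≠ x (i + 2)

theorem IsClosedNB.rotate {V : Type*} {G : SimpleGraph V} {L : ℕ} {x : ZMod L → V}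
    (hx : IsClosedNB G L x) (a : ZMod L) : IsClosedNB G L fun i => x (i + a) := by
  intro i
  have := hx (i + a)
  rw [add_right_comm, add_right_comm i a 2] at this
  exact this

theorem IsClosedNB.reverse {V : Type*} {G : SimpleGraph V} {L : ℕ} {x : ZMod L → V}
    (hx : IsClosedNB G L x) : IsClosedNB G L fun i => x (-i) := by
  intro i
  refine ⟨?_, ?_⟩
  · have := (hx (-(i + 1))).1.symm
    rwa [show -(i + 1) + 1 = -i by ring] at this
  · have := (hx (-(i + 2))).2.symm
    rwa [show -(i + 2) + 2 = -i by ring] at this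

theorem IsClosedNB.map {V W : Type*} {G : SimpleGraph V} {H : SimpleGraph W} {L : ℕ}
    {x : ZMod L → V} (hx : IsClosedNB G L x) (φ : G ≃g H) : IsClosedNB H L fun i => φ (x i) :=
  fun i => ⟨φ.map_adj_iff.2 (hx i).1, fun e => (hx i).2 (φ.injective e)⟩

/-- The 3-arc `(a, b, c, d)` lies on a closed walk of length `L` without backtracking. -/
def OnClosed {V : Type*} (G : SimpleGraph V) (L : ℕ) (a b c d : V) : Prop :=
  ∃ x : ZMod L → V, IsClosedNB G L x ∧ x 0 = a ∧ x 1 = b ∧ x 2 = c ∧ x 3 = d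

theorem OnClosed.map {V W : Type*} {G : SimpleGraph V} {H : SimpleGraph W} {L : ℕ} {a b c d : V}
    (hx : OnClosed G L a b c d) (φ : G ≃g H) : OnClosed H L (φ a) (φ b) (φ c) (φ d) := by
  obtain ⟨x, hx, rfl, rfl, rfl, rfl⟩ := hx
  exact ⟨_, hx.map φ, rfl, rfl, rfl, rfl⟩

theorem onClosed_map_iff {V W : Type*} {G : SimpleGraph V} {H : SimpleGraph W} {L : ℕ}
    {a b c d : V} (φ : G ≃g H) :
    OnClosed H L (φ a) (φ b) (φ c) (φ d) ↔ OnClosed G L a b c d :=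
  ⟨fun hx => by simpa using hx.map φ.symm, fun hx => hx.map φ⟩

/-! ### The component `CPM` inside `CPMbar` -/

theorem CPM_adj {m s n : ℕ} {r : (ZMod n)ˣ}
    {x y : (CPMbar m s n r).connectedComponentMk (0, 0)} :
    (CPM m s n r).Adj x y ↔ (CPMbar m s n r).Adj x.1 y.1 := Iff.rfl

theorem mem_component_of_adj {m s n : ℕ} {r : (ZMod n)ˣ}
    {x y : ZMod (m * s) × (Fin s → ZMod n)}
    (hx : x ∈ ((CPMbar m s n r).connectedComponentMk (0, 0)).supp)
    (hxy : (CPMbar m s n r).Adj x y) :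
    y ∈ ((CPMbar m s n r).connectedComponentMk (0, 0)).supp := by
  rw [SimpleGraph.ConnectedComponent.mem_supp_iff] at hx ⊢
  rw [← hx]
  exact (SimpleGraph.ConnectedComponent.connectedComponentMk_eq_of_adj hxy).symm

theorem IsClosedNB.val {m s n : ℕ} {r : (ZMod n)ˣ} {L : ℕ}
    {x : ZMod L → (CPMbar m s n r).connectedComponentMk (0, 0)}
    (hx : IsClosedNB (CPM m s n r) L x) : IsClosedNB (CPMbar m s n r) L fun i => (x i).1 :=
  fun i => ⟨CPM_adj.1 (hx i).1, fun e => (hx i).2 (Subtype.ext e)⟩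

/-- A closed walk that starts in the component of the origin is a closed walk of the component. -/
theorem IsClosedNB.exists_lift {m s n : ℕ} {r : (ZMod n)ˣ} {L : ℕ} [NeZero L]
    {x : ZMod L → ZMod (m * s) × (Fin s → ZMod n)}
    (hx : IsClosedNB (CPMbar m s n r) L x)
    (h0 : x 0 ∈ ((CPMbar m s n r).connectedComponentMk (0, 0)).supp) :
    ∃ y : ZMod L → (CPMbar m s n r).connectedComponentMk (0, 0),
      IsClosedNB (CPM m s n r) L y ∧ ∀ i, (y i).1 = x i := by
  have hmem : ∀ i : ℕ, x (i : ZMod L) ∈ ((CPMbar m s n r).connectedComponentMk (0, 0)).supp := by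
    intro i
    induction i with
    | zero => simpa using h0
    | succ i ih => exact mem_component_of_adj ih (by push_cast; exact (hx i).1)
  have hmem' : ∀ i, x i ∈ ((CPMbar m s n r).connectedComponentMk (0, 0)).supp := by
    intro i
    have := hmem i.val
    rwa [ZMod.natCast_zmod_val] at this
  exact ⟨fun i => ⟨x i, hmem' i⟩,
    fun i => ⟨CPM_adj.2 (hx i).1, fun e => (hx i).2 (congrArg Subtype.val e)⟩, fun i => rfl⟩

/-- The data of a closed walk without backtracking: directions `u`, signs `c`, and the closing
conditions. The letter with index `L` repeats the first step; its sign can differ from `c 0`, since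
the level has changed by a multiple of `m * s`. -/
theorem IsClosedNB.exists_data {m s n : ℕ} {r : (ZMod n)ˣ} (h : CPMAssumption m s n r) {L : ℕ}
    {x : ZMod L → ZMod (m * s) × (Fin s → ZMod n)}
    (hx : IsClosedNB (CPMbar m s n r) L x) {k : ℤ} {v : Fin s → ZMod n} (h0 : x 0 = pt m k v) :
    ∃ (u : ℕ → Bool) (c : ℕ → ZMod n), (∀ i, IsSign (c i)) ∧
      (∀ i, u i ≠ u (i + 1) → c i = c (i + 1)) ∧
      (∀ i : ℕ, u i = goesUp (x i) (x (i + 1))) ∧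
      (∀ i : ℕ, x i = path m r u c k v i) ∧
      ∑ j ∈ Finset.range L, c j • (stepVec r (bot u k j) : Fin s → ZMod n) = 0 ∧
      ((m * s : ℕ) : ℤ) ∣ lev u k L - k ∧
      c L • (stepVec r (bot u k L) : Fin s → ZMod n) = c 0 • stepVec r (bot u k 0) := by
  obtain ⟨u, c, hc, ht, hp, hu⟩ := exists_eq_path h (f := fun i : ℕ => x (i : ZMod L))
    (fun i => by push_cast; exact (hx i).1) (fun i => by push_cast; exact (hx i).2)
    (k := k) (v := v) (by simpa using h0)
  have hL := hp L
  have hL1 := hp (L + 1)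
  have h1 := hp 1
  simp only [CharP.cast_eq_zero, Nat.cast_add, Nat.cast_one, zero_add] at hL hL1 h1
  rw [h0] at hL
  have hs : ∑ j ∈ Finset.range L, c j • (stepVec r (bot u k j) : Fin s → ZMod n) = 0 := by
    have e : v = pos r u c k v L := congrArg Prod.snd hL
    rw [pos] at e
    exact left_eq_add.1 e
  refine ⟨u, c, hc, ht, fun i => by simpa using hu i, hp, hs, ?_, ?_⟩
  · have e : ((k : ℤ) : ZMod (m * s)) = ((lev u k L : ℤ) : ZMod (m * s)) := congrArg Prod.fst hL
    rwa [ZMod.intCast_eq_intCast_iff_dvd_sub] at e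
  · have e : pos r u c k v (L + 1) = pos r u c k v 1 :=
      congrArg Prod.snd (hL1.symm.trans h1)
    simp only [pos, Finset.sum_range_succ, hs, Finset.sum_range_zero, zero_add] at e
    exact add_left_cancel e

/-- Directions and signs that satisfy the closing conditions define a closed walk without
backtracking. The letter with index `L` stands for the first letter after one round. -/
theorem exists_closedNB_of_word {m s n : ℕ} {r : (ZMod n)ˣ} (h : CPMAssumption m s n r) {L : ℕ}
    (hL : 3 ≤ L) (u : ℕ → Bool) (c : ℕ → ZMod n) (k : ℤ) (v : Fin s → ZMod n)
    (hmem : pt m k v ∈ ((CPMbar m s n r).connectedComponentMk (0, 0)).supp)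
    (hc : ∀ i ≤ L, IsSign (c i)) (ht : ∀ i < L, u i ≠ u (i + 1) → c i = c (i + 1))
    (hs : ∑ j ∈ Finset.range L, c j • (stepVec r (bot u k j) : Fin s → ZMod n) = 0)
    (hl : ((m * s : ℕ) : ℤ) ∣ lev u k L - k) (hu : u L = u 0)
    (hw : c L • (stepVec r (bot u k L) : Fin s → ZMod n) = c 0 • stepVec r (bot u k 0)) :
    ∃ x : ZMod L → (CPMbar m s n r).connectedComponentMk (0, 0), IsClosedNB (CPM m s n r) L x ∧
      ∀ j : ℕ, j < L → (x (j : ZMod L)).1 = path m r u c k v j := by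
  have : NeZero L := ⟨by omega⟩
  have hL0 : path m r u c k v L = path m r u c k v 0 := by
    rw [path_zero, path, pos, hs, add_zero]
    have : ((k : ℤ) : ZMod (m * s)) = ((lev u k L : ℤ) : ZMod (m * s)) := by
      rwa [ZMod.intCast_eq_intCast_iff_dvd_sub]
    simp only [pt, this]
  have hL1 : path m r u c k v (L + 1) = path m r u c k v 1 := by
    have e : ((lev u k L : ℤ) : ZMod (m * s)) = ((k : ℤ) : ZMod (m * s)) :=
      congrArg Prod.fst hL0
    have e1 : ((lev u k (L + 1) : ℤ) : ZMod (m * s)) = ((lev u k 1 : ℤ) : ZMod (m * s)) := by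
      simp only [lev, hu]
      push_cast
      rw [e]
    simp only [path, pt, e1, pos, Finset.sum_range_succ, hs, hw, Finset.sum_range_zero]
  let x : ZMod L → ZMod (m * s) × (Fin s → ZMod n) := fun i => path m r u c k v i.val
  have hxj : ∀ j : ℕ, j ≤ L + 1 → x (j : ZMod L) = path m r u c k v j := by
    intro j hj
    simp only [x, ZMod.val_natCast]
    rcases Nat.lt_or_ge j L with h1 | h1
    · rw [Nat.mod_eq_of_lt h1]
    · have : j = L ∨ j = L + 1 := by omega
      rcases this with rfl | rfl
      · rw [Nat.mod_self, hL0]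
      · rw [Nat.add_mod_left, Nat.mod_eq_of_lt (by omega), hL1]
  have hx : IsClosedNB (CPMbar m s n r) L x := by
    intro i
    have hi := ZMod.val_lt i
    have e0 := hxj i.val (by omega)
    have e1 := hxj (i.val + 1) (by omega)
    have e2 := hxj (i.val + 2) (by omega)
    push_cast at e0 e1 e2
    rw [ZMod.natCast_zmod_val] at e0 e1 e2
    rw [e0, e1, e2]
    exact ⟨path_adj h u k v (hc _ hi.le),
      (path_add_two_ne_iff h u k v (hc _ hi.le) (hc _ hi)).2 (ht _ hi)⟩
  have hx0 : x 0 = pt m k v := by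
    have := hxj 0 (by omega)
    rwa [Nat.cast_zero, path_zero] at this
  obtain ⟨y, hy, hyx⟩ := hx.exists_lift (by rw [hx0]; exact hmem)
  exact ⟨y, hy, fun j hj => by rw [hyx, hxj j (by omega)]⟩

/-! ### The averaging argument -/

/-- A 2-arc `(a, b, c)` is a turn if its two edges lie between the same two levels. -/
def IsTurn {m s n : ℕ} (a b c : ZMod (m * s) × (Fin s → ZMod n)) : Prop :=
  goesUp a b ≠ goesUp b c

/-- Every directed edge `(a, b)` extends to exactly three 2-arcs, one of which is a turn. -/
theorem exists_extensions {m s n : ℕ} {r : (ZMod n)ˣ} (h : CPMAssumption m s n r)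
    {a b : ZMod (m * s) × (Fin s → ZMod n)} (hab : (CPMbar m s n r).Adj a b) :
    ∃ t c₁ c₂ : ZMod (m * s) × (Fin s → ZMod n), t ≠ c₁ ∧ t ≠ c₂ ∧ c₁ ≠ c₂ ∧
      (∀ c, (CPMbar m s n r).Adj b c ∧ a ≠ c ↔ c = t ∨ c = c₁ ∨ c = c₂) ∧
      IsTurn a b t ∧ ¬ IsTurn a b c₁ ∧ ¬ IsTurn a b c₂ := by
  obtain ⟨k, w, rfl⟩ : ∃ k w, b = pt m k w := ⟨_, _, (pt_val_cast h b).symm⟩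
  have h2 := two_ne_zero_of h.2.1
  have hsub : k - 1 + 1 = k := by ring
  have hneg : ∀ c : ZMod n, IsSign c → c ≠ -c := by
    intro c hc e
    rcases hc with rfl | rfl
    · exact h2 (by linear_combination e)
    · exact h2 (by linear_combination -e)
  have hcd : ∀ c d : ZMod n, IsSign c → IsSign d → d = c ∨ d = -c := by
    intro c d hc hd
    rcases hc with rfl | rfl <;> rcases hd with rfl | rfl <;> simp
  have hinj : ∀ (k j : ℤ) (c d : ZMod n), pt m k (w + c • stepVec r j : Fin s → ZMod n) =
      pt m k (w + d • stepVec r j) → c = d := fun k j c d e =>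
    stepVec_smul_injective h j (add_left_cancel (congrArg Prod.snd e))
  rcases adj_pt_cases h hab.symm with ⟨c, hc, rfl⟩ | ⟨c, hc, rfl⟩
  · have hdir : goesUp (pt m (k + 1) (w + c • stepVec r k)) (pt m k w) = false := by
      have := goesUp_down h (k + 1) (w + c • stepVec r k) w
      rwa [add_sub_cancel_right] at this
    refine ⟨pt m (k + 1) (w + (-c) • stepVec r k),
      pt m (k - 1) (w + (1 : ZMod n) • stepVec r (k - 1)),
      pt m (k - 1) (w + (-1 : ZMod n) • stepVec r (k - 1)), pt_level_ne h _ _ _,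
      pt_level_ne h _ _ _, ?_, ?_, ?_, ?_, ?_⟩
    · exact fun e => hneg 1 IsSign.one (hinj _ _ _ _ e)
    · intro y
      constructor
      · rintro ⟨h3, h4⟩
        rcases adj_pt_cases h h3 with ⟨d, hd, rfl⟩ | ⟨d, hd, rfl⟩
        · rcases hcd c d hc hd with rfl | rfl
          · exact absurd rfl h4
          · exact Or.inl rfl
        · rcases hd with rfl | rfl
          · exact Or.inr (Or.inl rfl)
          · exact Or.inr (Or.inr rfl)
      · rintro (rfl | rfl | rfl)
        · exact ⟨adj_up h _ _ hc.neg, fun e => hneg c hc (hinj _ _ _ _ e)⟩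
        · exact ⟨adj_down h _ _ IsSign.one, pt_level_ne h _ _ _⟩
        · exact ⟨adj_down h _ _ IsSign.neg_one, pt_level_ne h _ _ _⟩
    · rw [IsTurn, hdir, goesUp_up]; decide
    · rw [IsTurn, hdir, goesUp_down h]; decide
    · rw [IsTurn, hdir, goesUp_down h]; decide
  · have hdir : goesUp (pt m (k - 1) (w + c • stepVec r (k - 1))) (pt m k w) = true := by
      have := goesUp_up (m := m) (k - 1) (w + c • stepVec r (k - 1)) w
      rwa [hsub] at this
    refine ⟨pt m (k - 1) (w + (-c) • stepVec r (k - 1)),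
      pt m (k + 1) (w + (1 : ZMod n) • stepVec r k),
      pt m (k + 1) (w + (-1 : ZMod n) • stepVec r k), (pt_level_ne h _ _ _).symm,
      (pt_level_ne h _ _ _).symm, ?_, ?_, ?_, ?_, ?_⟩
    · exact fun e => hneg 1 IsSign.one (hinj _ _ _ _ e)
    · intro y
      constructor
      · rintro ⟨h3, h4⟩
        rcases adj_pt_cases h h3 with ⟨d, hd, rfl⟩ | ⟨d, hd, rfl⟩
        · rcases hd with rfl | rfl
          · exact Or.inr (Or.inl rfl)
          · exact Or.inr (Or.inr rfl)
        · rcases hcd c d hc hd with rfl | rfl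
          · exact absurd rfl h4
          · exact Or.inl rfl
      · rintro (rfl | rfl | rfl)
        · exact ⟨adj_down h _ _ hc.neg, fun e => hneg c hc (hinj _ _ _ _ e)⟩
        · exact ⟨adj_up h _ _ IsSign.one, (pt_level_ne h _ _ _).symm⟩
        · exact ⟨adj_up h _ _ IsSign.neg_one, (pt_level_ne h _ _ _).symm⟩
    · rw [IsTurn, hdir, goesUp_down h]; decide
    · rw [IsTurn, hdir, goesUp_up]; decide
    · rw [IsTurn, hdir, goesUp_up]; decide

open Classical in
/-- The number of turns of a closed walk. -/
noncomputable def turnCount {m s n : ℕ} {L : ℕ} [NeZero L]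
    (x : ZMod L → ZMod (m * s) × (Fin s → ZMod n)) : ℕ :=
  (Finset.univ.filter fun i : ZMod L => IsTurn (x i) (x (i + 1)) (x (i + 2))).card

/-- In a 2-arc-transitive graph all 2-arcs lie on equally many closed walks of length `L` without
backtracking. As one in three 2-arcs is a turn, such a walk has `L / 3` turns on average. -/
theorem three_mul_turnCount_eq {m s n : ℕ} {r : (ZMod n)ˣ} (h : CPMAssumption m s n r)
    (hT : IsTwoArcTransitive (CPM m s n r)) {L : ℕ} [NeZero L]
    (hle : ∀ x : ZMod L → (CPMbar m s n r).connectedComponentMk (0, 0),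
      IsClosedNB (CPM m s n r) L x → L ≤ 3 * turnCount fun i => (x i).1)
    (x : ZMod L → (CPMbar m s n r).connectedComponentMk (0, 0))
    (hx : IsClosedNB (CPM m s n r) L x) : 3 * turnCount (fun i => (x i).1) = L := by
  classical
  have : NeZero (m * s) := ⟨by have := h.2.2.2.2.1; omega⟩
  have : NeZero n := ⟨by have := h.2.1; omega⟩
  let W := (CPMbar m s n r).connectedComponentMk (0, 0)
  have : Fintype W := Fintype.ofFinite _
  let X : Finset (ZMod L → W) := Finset.univ.filter fun x => IsClosedNB (CPM m s n r) L x
  -- the number of closed walks that start with a given 2-arc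
  let κ : W → W → W → ℕ := fun a b c =>
    (X.filter fun x => x 0 = a ∧ x 1 = b ∧ x 2 = c).card
  have hκ_le : ∀ a b c a' b' c', IsTwoArc (CPM m s n r) a b c → IsTwoArc (CPM m s n r) a' b' c' →
      κ a b c ≤ κ a' b' c' := by
    intro a b c a' b' c' h1 h2
    obtain ⟨φ, rfl, rfl, rfl⟩ := hT a b c a' b' c' h1 h2
    refine Finset.card_le_card_of_injOn (fun x i => φ (x i)) ?_ ?_
    · intro x hx
      simp only [Finset.mem_coe, X, Finset.mem_filter, Finset.mem_univ,
        true_and] at hx ⊢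
      obtain ⟨hx, rfl, rfl, rfl⟩ := hx
      exact ⟨hx.map φ, rfl, rfl, rfl⟩
    · intro x _ y _ hxy
      funext i
      exact φ.injective (congrFun hxy i)
  have hκ : ∀ a b c a' b' c', IsTwoArc (CPM m s n r) a b c → IsTwoArc (CPM m s n r) a' b' c' →
      κ a b c = κ a' b' c' := fun a b c a' b' c' h1 h2 =>
    le_antisymm (hκ_le _ _ _ _ _ _ h1 h2) (hκ_le _ _ _ _ _ _ h2 h1)
  let T : ZMod L → Finset (ZMod L → W) := fun i =>
    X.filter fun x => IsTurn (x i).1 (x (i + 1)).1 (x (i + 2)).1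
  -- one of the three 2-arcs that extend a directed edge is a turn, and `κ` is constant
  have hfib : 3 * (T 0).card = X.card := by
    rw [Finset.card_eq_sum_card_fiberwise (s := X) (t := Finset.univ)
        (f := fun x => (x 0, x 1)) (by simp),
      Finset.card_eq_sum_card_fiberwise (s := T 0) (t := Finset.univ)
        (f := fun x => (x 0, x 1)) (by simp), Finset.mul_sum]
    refine Finset.sum_congr rfl ?_
    rintro ⟨a, b⟩ -
    by_cases hab : (CPM m s n r).Adj a b
    · obtain ⟨t, c₁, c₂, e1, e2, e3, hext, ht, ht1, ht2⟩ := exists_extensions h (CPM_adj.1 hab)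
      have hmem : ∀ c, (CPMbar m s n r).Adj b.1 c →
          c ∈ ((CPMbar m s n r).connectedComponentMk (0, 0)).supp :=
        fun c hc => mem_component_of_adj b.2 hc
      have htA := (hext t).2 (Or.inl rfl)
      have h1A := (hext c₁).2 (Or.inr (Or.inl rfl))
      have h2A := (hext c₂).2 (Or.inr (Or.inr rfl))
      let t' : W := ⟨t, hmem t htA.1⟩
      let d₁ : W := ⟨c₁, hmem c₁ h1A.1⟩
      let d₂ : W := ⟨c₂, hmem c₂ h2A.1⟩
      have harc : ∀ (c) (hc : (CPMbar m s n r).Adj b.1 c ∧ a.1 ≠ c),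
          IsTwoArc (CPM m s n r) a b ⟨c, hmem c hc.1⟩ := fun c hc =>
        ⟨hab, hc.1, fun e => hc.2 (congrArg Subtype.val e)⟩
      have hx2 : ∀ x ∈ X, x 0 = a → x 1 = b → x 2 = t' ∨ x 2 = d₁ ∨ x 2 = d₂ := by
        intro x hx h0 h1
        have hx := (Finset.mem_filter.1 hx).2
        have a1 := (hx 1).1
        have a2 := (hx 0).2
        rw [show (1 : ZMod L) + 1 = 2 by ring, h1] at a1
        rw [zero_add, h0] at a2
        rcases (hext (x 2).1).1 ⟨a1, fun e => a2 (Subtype.ext e)⟩ with e | e | e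
        · exact Or.inl (Subtype.ext e)
        · exact Or.inr (Or.inl (Subtype.ext e))
        · exact Or.inr (Or.inr (Subtype.ext e))
      have hT0 : ((T 0).filter fun x => (x 0, x 1) = (a, b)).card = κ a b t' := by
        congr 1
        ext x
        simp only [T, Finset.mem_filter, zero_add, Prod.mk.injEq]
        constructor
        · rintro ⟨⟨hx, htu⟩, h0, h1⟩
          refine ⟨hx, h0, h1, ?_⟩
          rw [h0, h1] at htu
          rcases hx2 x hx h0 h1 with e | e | e
          · exact e
          · rw [e] at htu; exact absurd htu ht1
          · rw [e] at htu; exact absurd htu ht2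
        · rintro ⟨hx, h0, h1, h2⟩
          refine ⟨⟨hx, ?_⟩, h0, h1⟩
          rw [h0, h1, h2]; exact ht
      have hX0 : (X.filter fun x => (x 0, x 1) = (a, b)).card =
          κ a b t' + (κ a b d₁ + κ a b d₂) := by
        simp only [κ]
        rw [← Finset.card_union_of_disjoint, ← Finset.card_union_of_disjoint]
        · congr 1
          ext x
          simp only [Finset.mem_filter, Finset.mem_union, Prod.mk.injEq]
          constructor
          · rintro ⟨hx, h0, h1⟩
            rcases hx2 x hx h0 h1 with e | e | e
            · exact Or.inl ⟨hx, h0, h1, e⟩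
            · exact Or.inr (Or.inl ⟨hx, h0, h1, e⟩)
            · exact Or.inr (Or.inr ⟨hx, h0, h1, e⟩)
          · rintro (⟨hx, h0, h1, -⟩ | ⟨hx, h0, h1, -⟩ | ⟨hx, h0, h1, -⟩) <;> exact ⟨hx, h0, h1⟩
        · rw [Finset.disjoint_union_right]
          constructor
          · rw [Finset.disjoint_left]
            intro x hx hx'
            have := (Finset.mem_filter.1 hx).2.2.2.symm.trans (Finset.mem_filter.1 hx').2.2.2
            exact e1 (congrArg Subtype.val this)
          · rw [Finset.disjoint_left]
            intro x hx hx'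
            have := (Finset.mem_filter.1 hx).2.2.2.symm.trans (Finset.mem_filter.1 hx').2.2.2
            exact e2 (congrArg Subtype.val this)
        · rw [Finset.disjoint_left]
          intro x hx hx'
          have := (Finset.mem_filter.1 hx).2.2.2.symm.trans (Finset.mem_filter.1 hx').2.2.2
          exact e3 (congrArg Subtype.val this)
      rw [hT0, hX0, hκ _ _ _ _ _ _ (harc _ h1A) (harc _ htA),
        hκ _ _ _ _ _ _ (harc _ h2A) (harc _ htA)]
      ring
    · have hX0 : (X.filter fun x => (x 0, x 1) = (a, b)) = ∅ := by
        rw [Finset.filter_eq_empty_iff]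
        intro x hx e
        have hx := ((Finset.mem_filter.1 hx).2 0).1
        simp only [Prod.mk.injEq] at e
        rw [zero_add, e.1, e.2] at hx
        exact hab hx
      have hT0 : ((T 0).filter fun x => (x 0, x 1) = (a, b)) = ∅ :=
        Finset.subset_empty.1 (hX0 ▸ Finset.filter_subset_filter _ (Finset.filter_subset _ _))
      rw [hX0, hT0]; rfl
  -- by rotation, turns are equally frequent at every position
  have hrot : ∀ i, (T i).card = (T 0).card := by
    intro i
    refine Finset.card_bij' (fun x _ j => x (j + i)) (fun x _ j => x (j - i)) ?_ ?_ ?_ ?_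
    · intro x hx
      simp only [T, X, Finset.mem_filter, Finset.mem_univ, true_and] at hx ⊢
      refine ⟨hx.1.rotate i, ?_⟩
      rw [zero_add, zero_add, zero_add, add_comm 1, add_comm 2]
      exact hx.2
    · intro x hx
      simp only [T, X, Finset.mem_filter, Finset.mem_univ, true_and] at hx ⊢
      refine ⟨by simpa only [sub_eq_add_neg] using hx.1.rotate (-i), ?_⟩
      rw [sub_self, add_sub_cancel_left, add_sub_cancel_left]
      simpa only [zero_add] using hx.2
    · intro x _; funext j; simp
    · intro x _; funext j; simp
  -- the turns of all walks are counted by position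
  have hsum : ∑ x ∈ X, L = ∑ x ∈ X, 3 * turnCount fun i => (x i).1 := by
    rw [← Finset.mul_sum]
    have : ∑ x ∈ X, turnCount (fun i => (x i).1) = ∑ i : ZMod L, (T i).card := by
      simp only [turnCount, T, Finset.card_filter]
      rw [Finset.sum_comm]
    rw [this, Finset.sum_congr rfl fun i _ => hrot i, Finset.sum_const, Finset.sum_const,
      Finset.card_univ, ZMod.card, ← hfib]
    simp only [smul_eq_mul]
    ring
  have hall := (Finset.sum_eq_sum_iff_of_le fun x hx => hle x (Finset.mem_filter.1 hx).2).1 hsum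
  exact (hall x (Finset.mem_filter.2 ⟨Finset.mem_univ _, hx⟩)).symm

/-! ### The closing equations of a word -/

theorem lev_eq_add (u : ℕ → Bool) (k : ℤ) (i : ℕ) : lev u k i = k + lev u 0 i := by
  induction i with
  | zero => simp [lev]
  | succ i ih => simp only [lev, ih, add_assoc]

theorem bot_eq_add (u : ℕ → Bool) (k : ℤ) (i : ℕ) : bot u k i = k + bot u 0 i := by
  simp only [bot, lev_eq_add u k i]
  split_ifs <;> ring

/-- The directions `u` and the signs `c` describe a closed walk of length `L` without backtracking.
The conditions do not involve the starting point: levels are counted from `0`, and `closing` lists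
the coefficient equations, one for each class of levels modulo `s`. By `wrap` the letter with
index `L` gives the same displacement as the first one. -/
structure IsClosedWord (m s : ℕ) {n : ℕ} (r : (ZMod n)ˣ) (L : ℕ) (u : ℕ → Bool)
    (c : ℕ → ZMod n) : Prop where
  sign : ∀ i, IsSign (c i)
  turn : ∀ i, u i ≠ u (i + 1) → c i = c (i + 1)
  period : u L = u 0
  closing : ∀ j : ℤ, ∑ i ∈ Finset.range L, c i *
    (if (s : ℤ) ∣ bot u 0 i - j then ((r ^ (bot u 0 i - j) : (ZMod n)ˣ) : ZMod n) else 0) = 0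
  level : ((m * s : ℕ) : ℤ) ∣ lev u 0 L
  wrap : c L * ((r ^ lev u 0 L : (ZMod n)ˣ) : ZMod n) = c 0

theorem IsClosedNB.exists_word {m s n : ℕ} {r : (ZMod n)ˣ} (h : CPMAssumption m s n r) {L : ℕ}
    {x : ZMod L → ZMod (m * s) × (Fin s → ZMod n)}
    (hx : IsClosedNB (CPMbar m s n r) L x) {k : ℤ} {v : Fin s → ZMod n} (h0 : x 0 = pt m k v) :
    ∃ (u : ℕ → Bool) (c : ℕ → ZMod n), IsClosedWord m s r L u c ∧
      (∀ i : ℕ, u i = goesUp (x i) (x (i + 1))) ∧ ∀ i : ℕ, x i = path m r u c k v i := by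
  have : NeZero s := ⟨by have := h.2.2.2.1; omega⟩
  obtain ⟨u, c, h1, h2, h3, h4, h5, h6, h7⟩ := hx.exists_data h h0
  have h8 : ((m * s : ℕ) : ℤ) ∣ lev u 0 L := by
    rw [lev_eq_add] at h6
    simpa using h6
  have hp : u L = u 0 := by rw [h3, h3]; simp
  refine ⟨u, c, ⟨h1, h2, hp, ?_, h8, ?_⟩, h3, h4⟩
  · intro j
    have := congrArg (coordAt (s := s) r (k + j)) h5
    rw [map_sum, map_zero] at this
    refine Eq.trans (Finset.sum_congr rfl fun i _ => ?_) this
    rw [map_smul, smul_eq_mul, ← coordAt_stepVec r (k + j) (bot u 0 i - j), bot_eq_add u k i,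
      show k + j + (bot u 0 i - j) = k + bot u 0 i by ring]
  · have e : bot u k L = bot u k 0 + lev u 0 L := by
      simp only [bot, hp, lev_eq_add u k L, lev]
      split_ifs <;> ring
    rw [e, stepVec_add_eq r _ _ (dvd_trans ⟨m, by push_cast; ring⟩ h8), smul_smul] at h7
    exact stepVec_smul_injective h _ h7

/-! ### Words that do not close up -/

theorem IsSign.two_mul_ne {n : ℕ} (h : 3 ≤ n) {a : ZMod n} (ha : IsSign a) : 2 * a ≠ 0 := by
  intro h0
  apply two_ne_zero_of h
  linear_combination a * h0 - 2 * ha.mul_self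

theorem IsSign.four_mul_ne {n : ℕ} (h : 3 ≤ n) (h4 : n ≠ 4) {a : ZMod n} (ha : IsSign a) :
    4 * a ≠ 0 := by
  intro h0
  apply four_ne_zero_of h h4
  linear_combination a * h0 - 4 * ha.mul_self

theorem not_mul_two_dvd_two {m : ℕ} (hm : 2 ≤ m) : ¬ (m : ℤ) * 2 ∣ 2 := by
  intro h
  have := Int.le_of_dvd (by norm_num) h
  omega

theorem eq_two_of_mul_two_dvd_four {m : ℕ} (hm : 2 ≤ m) (h : (m : ℤ) * 2 ∣ 4) : m = 2 := by
  have := Int.le_of_dvd (by norm_num) h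
  omega

/-- The directions that remain free are run through. In every case that is left by the condition on
the levels, one of the coefficient equations has one of the excluded forms. -/
theorem no_uudu_two {m n : ℕ} {r : (ZMod n)ˣ} {u : ℕ → Bool} {c : ℕ → ZMod n}
    (hn : 3 ≤ n) (hn4 : n ≠ 4)
    (hA : ∀ a b : ZMod n, IsSign a → IsSign b → 2 * a + 2 * b * (r : ZMod n) ^ 2 ≠ 0)
    (hC : ∀ a b : ZMod n, IsSign a → IsSign b → 3 * a + b * (r : ZMod n) ^ 2 ≠ 0)
    (hD : ∀ a b : ZMod n, IsSign a → IsSign b → 2 * a + 4 * b * (r : ZMod n) ^ 2 ≠ 0)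
    (hw : IsClosedWord m 2 r 8 u c) (hl : (4 : ℤ) ∣ lev u 0 8)
    (h0 : u 0 = true) (h1 : u 1 = true) (h2 : u 2 = false) (h3 : u 3 = true) :
    False := by
  have e0 := hw.closing 0
  have e1 := hw.closing 1
  have f1 := hw.closing (-1)
  have e3 := hw.wrap
  have h8 := hw.period
  rw [h0] at h8
  have t0 := hw.turn 0
  have t1 := hw.turn 1
  have t2 := hw.turn 2
  have t3 := hw.turn 3
  have t4 := hw.turn 4
  have t5 := hw.turn 5
  have t6 := hw.turn 6
  have t7 := hw.turn 7
  cases h4 : u 4 <;> cases h5 : u 5 <;> cases h6 : u 6 <;> cases h7 : u 7 <;>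
    norm_num [lev, h0, h1, h2, h3, h4, h5, h6, h7, h8] at hl <;>
    norm_num [Finset.sum_range_succ, bot, lev, h0, h1, h2, h3, h4, h5, h6, h7, h8]
      at e0 e1 f1 e3 t0 t1 t2 t3 t4 t5 t6 t7
  · exact hD _ _ (hw.sign 6) (hw.sign 1) (by grind)
  · exact (hw.sign 1).four_mul_ne hn hn4 (by grind)
  · exact (hw.sign 0).two_mul_ne hn (by grind)
  · exact hA _ _ (hw.sign 0) (hw.sign 6) (by grind)
  · exact hA _ _ (hw.sign 0) (hw.sign 4) (by grind)
  · exact hC _ _ (hw.sign 1) (hw.sign 7) (by grind)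
  · exact hA _ _ (hw.sign 0) (hw.sign 4) (by grind)
  · exact hC _ _ (hw.sign 1) (hw.sign 5) (by grind)

/-- The condition `c 3 = c 0` says that the displacements of the outer steps agree. Without it, a
closed word is obtained from a commutator of two displacements. -/
theorem no_uudd_two {m n : ℕ} {r : (ZMod n)ˣ} {u : ℕ → Bool} {c : ℕ → ZMod n}
    (hn : 3 ≤ n) (hn4 : n ≠ 4)
    (hA : ∀ a b : ZMod n, IsSign a → IsSign b → 2 * a + 2 * b * (r : ZMod n) ^ 2 ≠ 0)
    (hC : ∀ a b : ZMod n, IsSign a → IsSign b → 3 * a + b * (r : ZMod n) ^ 2 ≠ 0)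
    (hC' : ∀ a b : ZMod n, IsSign a → IsSign b → a + 3 * b * (r : ZMod n) ^ 2 ≠ 0)
    (hw : IsClosedWord m 2 r 8 u c) (hl : (4 : ℤ) ∣ lev u 0 8)
    (h0 : u 0 = true) (h1 : u 1 = true) (h2 : u 2 = false) (h3 : u 3 = false) (h03 : c 3 = c 0) :
    False := by
  have e0 := hw.closing 0
  have e1 := hw.closing 1
  have f0 := hw.closing (-2)
  have e3 := hw.wrap
  have h8 := hw.period
  rw [h0] at h8
  have t0 := hw.turn 0
  have t1 := hw.turn 1
  have t2 := hw.turn 2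
  have t3 := hw.turn 3
  have t4 := hw.turn 4
  have t5 := hw.turn 5
  have t6 := hw.turn 6
  have t7 := hw.turn 7
  cases h4 : u 4 <;> cases h5 : u 5 <;> cases h6 : u 6 <;> cases h7 : u 7 <;>
    norm_num [lev, h0, h1, h2, h3, h4, h5, h6, h7, h8] at hl <;>
    norm_num [Finset.sum_range_succ, bot, lev, h0, h1, h2, h3, h4, h5, h6, h7, h8]
      at e0 e1 f0 e3 t0 t1 t2 t3 t4 t5 t6 t7
  · have hr : (r : ZMod n) ^ 2 * ((r⁻¹ : (ZMod n)ˣ) : ZMod n) ^ 2 = 1 := by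
      rw [← mul_pow, Units.mul_inv, one_pow]
    exact hC' _ _ (hw.sign 5) (hw.sign 0) (by
      linear_combination f0 - (r : ZMod n) ^ 2 * h03 - ((r⁻¹ : (ZMod n)ˣ) : ZMod n) ^ 2 * t7 +
        c 8 * ((r⁻¹ : (ZMod n)ˣ) : ZMod n) ^ 2 * hr - (r : ZMod n) ^ 2 * e3)
  · exact hA _ _ (hw.sign 5) (hw.sign 0) (by grind)
  · exact (hw.sign 0).two_mul_ne hn (by grind)
  · exact (hw.sign 0).four_mul_ne hn hn4 (by grind)
  · exact (hw.sign 0).four_mul_ne hn hn4 (by grind)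
  · exact (hw.sign 1).two_mul_ne hn (by grind)
  · exact (hw.sign 0).four_mul_ne hn hn4 (by grind)
  · exact hC _ _ (hw.sign 0) (hw.sign 6) (by grind)

theorem no_uduu_two {m n : ℕ} {r : (ZMod n)ˣ} {u : ℕ → Bool} {c : ℕ → ZMod n}
    (hn : 3 ≤ n) (hn4 : n ≠ 4)
    (hA : ∀ a b : ZMod n, IsSign a → IsSign b → 2 * a + 2 * b * (r : ZMod n) ^ 2 ≠ 0)
    (hD' : ∀ a b : ZMod n, IsSign a → IsSign b → 4 * a + 2 * b * (r : ZMod n) ^ 2 ≠ 0)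
    (hw : IsClosedWord m 2 r 8 u c) (hl : (8 : ℤ) ∣ lev u 0 8)
    (h0 : u 0 = true) (h1 : u 1 = false) (h2 : u 2 = true) (h3 : u 3 = true) :
    False := by
  have e0 := hw.closing 0
  have e1 := hw.closing 1
  have f1 := hw.closing (-1)
  have e3 := hw.wrap
  have h8 := hw.period
  rw [h0] at h8
  have t0 := hw.turn 0
  have t1 := hw.turn 1
  have t2 := hw.turn 2
  have t3 := hw.turn 3
  have t4 := hw.turn 4
  have t5 := hw.turn 5
  have t6 := hw.turn 6
  have t7 := hw.turn 7
  cases h4 : u 4 <;> cases h5 : u 5 <;> cases h6 : u 6 <;> cases h7 : u 7 <;>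
    norm_num [lev, h0, h1, h2, h3, h4, h5, h6, h7, h8] at hl <;>
    norm_num [Finset.sum_range_succ, bot, lev, h0, h1, h2, h3, h4, h5, h6, h7, h8]
      at e0 e1 f1 e3 t0 t1 t2 t3 t4 t5 t6 t7
  · exact hA _ _ (hw.sign 6) (hw.sign 3) (by grind)
  · exact (hw.sign 3).two_mul_ne hn (by grind)
  · exact (hw.sign 3).four_mul_ne hn hn4 (by grind)
  · exact hD' _ _ (hw.sign 0) (hw.sign 4) (by grind)

theorem no_uudu_three {m n : ℕ} {r : (ZMod n)ˣ} {u : ℕ → Bool} {c : ℕ → ZMod n}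
    (hn : 3 ≤ n) (hn4 : n ≠ 4)
    (hw : IsClosedWord m 3 r 8 u c) (hl : (3 : ℤ) ∣ lev u 0 8)
    (h0 : u 0 = true) (h1 : u 1 = true) (h2 : u 2 = false) (h3 : u 3 = true) :
    False := by
  have e0 := hw.closing 0
  have e1 := hw.closing 1
  have e2 := hw.closing 2
  have e3 := hw.wrap
  have h8 := hw.period
  rw [h0] at h8
  have t0 := hw.turn 0
  have t1 := hw.turn 1
  have t2 := hw.turn 2
  have t3 := hw.turn 3
  have t4 := hw.turn 4
  have t5 := hw.turn 5
  have t6 := hw.turn 6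
  have t7 := hw.turn 7
  cases h4 : u 4 <;> cases h5 : u 5 <;> cases h6 : u 6 <;> cases h7 : u 7 <;>
    norm_num [lev, h0, h1, h2, h3, h4, h5, h6, h7, h8] at hl <;>
    norm_num [Finset.sum_range_succ, bot, lev, h0, h1, h2, h3, h4, h5, h6, h7, h8]
      at e0 e1 e2 e3 t0 t1 t2 t3 t4 t5 t6 t7
  · exact (hw.sign 1).four_mul_ne hn hn4 (by grind)
  · exact (hw.sign 1).four_mul_ne hn hn4 (by grind)
  · exact (hw.sign 0).two_mul_ne hn (by grind)
  · exact (hw.sign 4).two_mul_ne hn (by grind)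
  · -- `c 0 + c 5 q = 0` and `3 c 1 + c 6 q = 0` give `3 = ± 1`
    have h9 : (3 : ZMod n) * c 1 = c 6 * (c 0 * c 5) := by
      have h10 := (hw.sign 5).mul_self
      linear_combination e1 + t1 + t1 + t2 - c 6 * c 5 * e0 + c 6 * (r : ZMod n) ^ 3 * h10
    rcases hw.sign 1 with k1 | k1 <;> rcases (hw.sign 6).mul ((hw.sign 0).mul (hw.sign 5)) with
      k2 | k2 <;> rw [k1, k2] at h9
    · exact two_ne_zero_of hn (by linear_combination h9)
    · exact four_ne_zero_of hn hn4 (by linear_combination h9)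
    · exact four_ne_zero_of hn hn4 (by linear_combination -h9)
    · exact two_ne_zero_of hn (by linear_combination -h9)

theorem no_uudd_three {m n : ℕ} {r : (ZMod n)ˣ} {u : ℕ → Bool} {c : ℕ → ZMod n}
    (hn : 3 ≤ n) (hn4 : n ≠ 4)
    (hw : IsClosedWord m 3 r 8 u c) (hl : (3 : ℤ) ∣ lev u 0 8)
    (h0 : u 0 = true) (h1 : u 1 = true) (h2 : u 2 = false) (h3 : u 3 = false) (h03 : c 3 = c 0) :
    False := by
  have e0 := hw.closing 0
  have e1 := hw.closing 1
  have e3 := hw.wrap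
  have h8 := hw.period
  rw [h0] at h8
  have t0 := hw.turn 0
  have t1 := hw.turn 1
  have t2 := hw.turn 2
  have t3 := hw.turn 3
  have t4 := hw.turn 4
  have t5 := hw.turn 5
  have t6 := hw.turn 6
  have t7 := hw.turn 7
  cases h4 : u 4 <;> cases h5 : u 5 <;> cases h6 : u 6 <;> cases h7 : u 7 <;>
    norm_num [lev, h0, h1, h2, h3, h4, h5, h6, h7, h8] at hl <;>
    norm_num [Finset.sum_range_succ, bot, lev, h0, h1, h2, h3, h4, h5, h6, h7, h8]
      at e0 e1 e3 t0 t1 t2 t3 t4 t5 t6 t7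
  · exact (hw.sign 0).two_mul_ne hn (by grind)
  · exact (hw.sign 0).two_mul_ne hn (by grind)
  · exact (hw.sign 0).four_mul_ne hn hn4 (by grind)
  · exact (hw.sign 0).four_mul_ne hn hn4 (by grind)
  · exact (hw.sign 1).two_mul_ne hn (by grind)
  · exact (hw.sign 0).four_mul_ne hn hn4 (by grind)

theorem no_uudu_four {m n : ℕ} {r : (ZMod n)ˣ} {u : ℕ → Bool} {c : ℕ → ZMod n}
    (hn : 3 ≤ n) (hn4 : n ≠ 4)
    (hw : IsClosedWord m 4 r 8 u c) (hl : (4 : ℤ) ∣ lev u 0 8)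
    (h0 : u 0 = true) (h1 : u 1 = true) (h2 : u 2 = false) (h3 : u 3 = true) :
    False := by
  have e0 := hw.closing 0
  have e1 := hw.closing 1
  have e2 := hw.closing 2
  have e3 := hw.wrap
  have h8 := hw.period
  rw [h0] at h8
  have t0 := hw.turn 0
  have t1 := hw.turn 1
  have t2 := hw.turn 2
  have t3 := hw.turn 3
  have t4 := hw.turn 4
  have t5 := hw.turn 5
  have t6 := hw.turn 6
  have t7 := hw.turn 7
  cases h4 : u 4 <;> cases h5 : u 5 <;> cases h6 : u 6 <;> cases h7 : u 7 <;>
    norm_num [lev, h0, h1, h2, h3, h4, h5, h6, h7, h8] at hl <;>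
    norm_num [Finset.sum_range_succ, bot, lev, h0, h1, h2, h3, h4, h5, h6, h7, h8]
      at e0 e1 e2 e3 t0 t1 t2 t3 t4 t5 t6 t7
  · exact (hw.sign 1).four_mul_ne hn hn4 (by grind)
  · exact (hw.sign 1).four_mul_ne hn hn4 (by grind)
  · exact (hw.sign 0).two_mul_ne hn (by grind)
  · exact (hw.sign 0).two_mul_ne hn (by grind)
  · exact (hw.sign 4).two_mul_ne hn (by grind)
  · exact (hw.sign 0).two_mul_ne hn (by grind)
  · exact (hw.sign 0).two_mul_ne hn (by grind)
  · exact (hw.sign 4).two_mul_ne hn (by grind)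

theorem no_uudd_four {m n : ℕ} {r : (ZMod n)ˣ} {u : ℕ → Bool} {c : ℕ → ZMod n}
    (hn : 3 ≤ n) (hn4 : n ≠ 4)
    (hw : IsClosedWord m 4 r 8 u c) (hl : (4 : ℤ) ∣ lev u 0 8)
    (h0 : u 0 = true) (h1 : u 1 = true) (h2 : u 2 = false) (h3 : u 3 = false) (h03 : c 3 = c 0) :
    False := by
  have e0 := hw.closing 0
  have e1 := hw.closing 1
  have e2 := hw.closing 2
  have f1 := hw.closing (-1)
  have e3 := hw.wrap
  have h8 := hw.period
  rw [h0] at h8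
  have t0 := hw.turn 0
  have t1 := hw.turn 1
  have t2 := hw.turn 2
  have t3 := hw.turn 3
  have t4 := hw.turn 4
  have t5 := hw.turn 5
  have t6 := hw.turn 6
  have t7 := hw.turn 7
  cases h4 : u 4 <;> cases h5 : u 5 <;> cases h6 : u 6 <;> cases h7 : u 7 <;>
    norm_num [lev, h0, h1, h2, h3, h4, h5, h6, h7, h8] at hl <;>
    norm_num [Finset.sum_range_succ, bot, lev, h0, h1, h2, h3, h4, h5, h6, h7, h8]
      at e0 e1 e2 f1 e3 t0 t1 t2 t3 t4 t5 t6 t7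
  · exact (hw.sign 4).two_mul_ne hn (by grind)
  · exact (hw.sign 0).two_mul_ne hn (by grind)
  · exact (hw.sign 0).two_mul_ne hn (by grind)
  · exact (hw.sign 0).four_mul_ne hn hn4 (by grind)
  · exact (hw.sign 0).four_mul_ne hn hn4 (by grind)
  · exact (hw.sign 1).two_mul_ne hn (by grind)
  · exact (hw.sign 0).four_mul_ne hn hn4 (by grind)
  · exact (hw.sign 6).two_mul_ne hn (by grind)

theorem no_uudu_two_six {m n : ℕ} {r : (ZMod n)ˣ} {u : ℕ → Bool} {c : ℕ → ZMod n}
    (hn : 3 ≤ n) (hn4 : n ≠ 4) (hm : 2 ≤ m)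
    (hB : m = 2 → ∀ a b : ZMod n, IsSign a → IsSign b → a + b * (r : ZMod n) ^ 2 ≠ 0)
    (hw : IsClosedWord m 2 r 6 u c)
    (h0 : u 0 = true) (h1 : u 1 = true) (h2 : u 2 = false) (h3 : u 3 = true) :
    False := by
  have e0 := hw.closing 0
  have e1 := hw.closing 1
  have e3 := hw.wrap
  have hl := hw.level
  have h6 := hw.period
  rw [h0] at h6
  have t0 := hw.turn 0
  have t1 := hw.turn 1
  have t2 := hw.turn 2
  have t3 := hw.turn 3
  have t4 := hw.turn 4
  have t5 := hw.turn 5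
  cases h4 : u 4 <;> cases h5 : u 5 <;>
    norm_num [lev, h0, h1, h2, h3, h4, h5, h6] at hl <;>
    norm_num [Finset.sum_range_succ, bot, lev, h0, h1, h2, h3, h4, h5, h6]
      at e0 e1 e3 t0 t1 t2 t3 t4 t5
  · exact (hw.sign 1).four_mul_ne hn hn4 (by grind)
  · exact absurd hl (not_mul_two_dvd_two hm)
  · exact absurd hl (not_mul_two_dvd_two hm)
  · exact hB (eq_two_of_mul_two_dvd_four hm hl) _ _ (hw.sign 0) (hw.sign 4) e0

theorem no_uduu_two_six {m n : ℕ} {r : (ZMod n)ˣ} {u : ℕ → Bool} {c : ℕ → ZMod n}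
    (hn : 3 ≤ n) (hm : 2 ≤ m)
    (hB : m = 2 → ∀ a b : ZMod n, IsSign a → IsSign b → a + b * (r : ZMod n) ^ 2 ≠ 0)
    (hw : IsClosedWord m 2 r 6 u c)
    (h0 : u 0 = true) (h1 : u 1 = false) (h2 : u 2 = true) (h3 : u 3 = true) :
    False := by
  have e0 := hw.closing 0
  have e1 := hw.closing 1
  have e3 := hw.wrap
  have hl := hw.level
  have h6 := hw.period
  rw [h0] at h6
  have t0 := hw.turn 0
  have t1 := hw.turn 1
  have t2 := hw.turn 2
  have t3 := hw.turn 3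
  have t4 := hw.turn 4
  have t5 := hw.turn 5
  cases h4 : u 4 <;> cases h5 : u 5 <;>
    norm_num [lev, h0, h1, h2, h3, h4, h5, h6] at hl <;>
    norm_num [Finset.sum_range_succ, bot, lev, h0, h1, h2, h3, h4, h5, h6]
      at e0 e1 e3 t0 t1 t2 t3 t4 t5
  · exact (hw.sign 3).two_mul_ne hn (by grind)
  · exact absurd hl (not_mul_two_dvd_two hm)
  · exact absurd hl (not_mul_two_dvd_two hm)
  · exact hB (eq_two_of_mul_two_dvd_four hm hl) _ _ (hw.sign 3) (hw.sign 5) e1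

/-! ### Unimodal closed walks of length eight -/

theorem goesUp_symm {m s n : ℕ} {r : (ZMod n)ˣ} (h : CPMAssumption m s n r)
    {x y : ZMod (m * s) × (Fin s → ZMod n)} (hxy : (CPMbar m s n r).Adj x y) :
    goesUp y x = !goesUp x y := by
  rcases (adj_iff h _ _).1 hxy with ⟨k, v, c, -, rfl, rfl⟩ | ⟨k, v, c, -, rfl, rfl⟩
  · rw [goesUp_up]
    have := goesUp_down h (k + 1) (v + c • stepVec r k) v
    rwa [add_sub_cancel_right] at this
  · rw [goesUp_up]
    have := goesUp_down h (k + 1) (v + c • stepVec r k) v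
    rw [add_sub_cancel_right] at this
    rw [this]; rfl

/-- A cyclic sequence of directions of length `8` with at most two changes is a rotation of
`u ^ t d ^ (8 - t)` with `t ≥ 4`, or becomes one by reversal, which exchanges `u` and `d`. -/
theorem unimodal_of_few_turns_eight : ∀ δ : ZMod 8 → Bool,
    3 * (Finset.univ.filter fun i : ZMod 8 => δ i ≠ δ (i + 1)).card < 8 →
      (∃ a : ZMod 8, ∃ t : Fin 5, ∀ j : Fin 8,
        δ ((j.val : ZMod 8) + a) = decide (j.val < t.val + 4)) ∨
      (∃ a : ZMod 8, ∃ t : Fin 5, ∀ j : Fin 8,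
        (!δ (-((j.val : ZMod 8) + a) - 1)) = decide (j.val < t.val + 4)) := by
  decide +kernel

theorem turnCount_eq {m s n L : ℕ} [NeZero L] (x : ZMod L → ZMod (m * s) × (Fin s → ZMod n)) :
    turnCount x = (Finset.univ.filter fun i : ZMod L =>
      (fun i => goesUp (x i) (x (i + 1))) i ≠ (fun i => goesUp (x i) (x (i + 1))) (i + 1)).card := by
  classical
  rw [turnCount]
  congr 1
  ext i
  rw [Finset.mem_filter, Finset.mem_filter, show i + 2 = i + 1 + 1 by ring]
  rfl

theorem goesUp_reverse {m s n L : ℕ} {r : (ZMod n)ˣ} (h : CPMAssumption m s n r)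
    {x : ZMod L → ZMod (m * s) × (Fin s → ZMod n)} (hx : IsClosedNB (CPMbar m s n r) L x)
    (i : ZMod L) : goesUp (x (-i)) (x (-(i + 1))) = !goesUp (x (-i - 1)) (x (-i - 1 + 1)) := by
  have := goesUp_symm h (hx (-i - 1)).1
  rw [← this, sub_add_cancel, show -(i + 1) = -i - 1 by ring]

/-- Up to rotation and reversal, a closed walk of length `8` with at most two turns goes up
`t ≥ 4` times and then down `8 - t` times. -/
theorem exists_unimodal_word {m s n : ℕ} {r : (ZMod n)ˣ} (h : CPMAssumption m s n r)
    {x : ZMod 8 → ZMod (m * s) × (Fin s → ZMod n)} (hx : IsClosedNB (CPMbar m s n r) 8 x)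
    (ht : 3 * turnCount x < 8) :
    ∃ (u : ℕ → Bool) (c : ℕ → ZMod n) (t : ℕ), IsClosedWord m s r 8 u c ∧ 4 ≤ t ∧ t ≤ 8 ∧
      ∀ j < 8, u j = decide (j < t) := by
  have key : ∀ y : ZMod 8 → ZMod (m * s) × (Fin s → ZMod n), IsClosedNB (CPMbar m s n r) 8 y →
      ∀ (a : ZMod 8) (t : Fin 5), (∀ j : Fin 8, goesUp (y ((j.val : ZMod 8) + a))
        (y ((j.val : ZMod 8) + a + 1)) = decide (j.val < t.val + 4)) →
      ∃ (u : ℕ → Bool) (c : ℕ → ZMod n) (t : ℕ), IsClosedWord m s r 8 u c ∧ 4 ≤ t ∧ t ≤ 8 ∧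
        ∀ j < 8, u j = decide (j < t) := by
    intro y hy a t hj
    obtain ⟨u, c, hw, hu, -⟩ := (hy.rotate a).exists_word h (pt_val_cast h _).symm
    refine ⟨u, c, t.val + 4, hw, by omega, by omega, fun j hj' => ?_⟩
    rw [hu j, add_right_comm]
    exact hj ⟨j, hj'⟩
  rw [turnCount_eq] at ht
  rcases unimodal_of_few_turns_eight _ ht with ⟨a, t, hj⟩ | ⟨a, t, hj⟩
  · exact key x hx a t hj
  · refine key _ hx.reverse a t fun j => ?_
    rw [← hj j]
    exact goesUp_reverse h hx _

theorem two_mul_eq_of {n : ℕ} {a b q : ZMod n} (ha : IsSign a) (hb : IsSign b)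
    (h : 2 * a + 2 * b * q = 0) : 2 * q = 2 ∨ 2 * q = -2 := by
  rcases ha with rfl | rfl <;> rcases hb with rfl | rfl
  · right; linear_combination h
  · left; linear_combination -h
  · left; linear_combination h
  · right; linear_combination -h

theorem isSign_of_add_mul {n : ℕ} {a b q : ZMod n} (ha : IsSign a) (hb : IsSign b)
    (h : a + b * q = 0) : IsSign q := by
  have : q = -(a * b) := by linear_combination b * h - q * hb.mul_self
  rw [this]; exact (ha.mul hb).neg

theorem two_mul_eq_of_isSign {n : ℕ} {q : ZMod n} (h : IsSign q) : 2 * q = 2 ∨ 2 * q = -2 := by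
  rcases h with rfl | rfl
  · left; ring
  · right; ring

/-- The coefficient equations of the closed words `u ^ 7 d` for `s = 2` and `m = 3` are consistent
with `q ^ 3 = ± 1` only if `2 q = ± 2`. -/
theorem two_mul_eq_of_three {n : ℕ} (hn : 3 ≤ n) (hn4 : n ≠ 4) {q : ZMod n} (hq : IsUnit q)
    (hq3 : IsSign (q ^ 3)) {a b d e : ZMod n} (ha : IsSign a) (hb : IsSign b) (hd : IsSign d)
    (he : IsSign e) (h1 : 1 + a * q + b * q ^ 2 = 0) (h2 : 3 + d * q + e * q ^ 2 = 0) :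
    2 * q = 2 ∨ 2 * q = -2 := by
  have h2' := two_ne_zero_of hn
  have h4' := four_ne_zero_of hn hn4
  -- replacing `q` by `a q`, the case `a = 1` suffices
  obtain ⟨Q, hQ, hQq⟩ : ∃ Q, Q = a * q ∧ q = a * Q :=
    ⟨_, rfl, by linear_combination -q * ha.mul_self⟩
  have hQ2 : q ^ 2 = Q ^ 2 := by rw [hQ]; linear_combination -q ^ 2 * ha.mul_self
  have hQ3 : IsSign (Q ^ 3) := by
    have : Q ^ 3 = a * q ^ 3 := by rw [hQ]; linear_combination a * q ^ 3 * ha.mul_self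
    rw [this]; exact ha.mul hq3
  have hQu : IsUnit Q := hQ ▸ (isUnit_of_isSign ha).mul hq
  rw [← hQ, hQ2] at h1
  rw [hQq, ← mul_assoc, mul_pow] at h2
  have h3 : 3 + d * a * Q + e * Q ^ 2 = 0 := by
    linear_combination h2 - e * Q ^ 2 * ha.mul_self
  have main : 2 * Q = 2 ∨ 2 * Q = -2 := by
    rcases hb with rfl | rfl
    · rcases hd.mul ha with k | k <;> rcases he with rfl | rfl <;> rw [k] at h3
      · exact absurd (show (2 : ZMod n) = 0 by linear_combination h3 - h1) h2'
      · -- here `4 + 2 Q = 0` and `1 + Q + Q ^ 2 = 0`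
        left
        linear_combination Q * (h3 + h1) - 2 * h1
      · left; linear_combination -h3 + h1
      · exact absurd (show (4 : ZMod n) = 0 by linear_combination h3 + h1) h4'
    · have h5 : Q ^ 3 = 1 + 2 * Q := by linear_combination -(Q + 1) * h1
      rcases hQ3 with k | k
      · have : (2 : ZMod n) * Q = 0 := by linear_combination k - h5
        exact absurd ((hQu.mul_left_eq_zero).1 this) h2'
      · right; linear_combination k - h5
  rcases ha with rfl | rfl
  · rw [hQ, one_mul] at main; exact main
  · rcases main with k | k
    · right; rw [hQ] at k; linear_combination -k
    · left; rw [hQ] at k; linear_combination -k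

/-- The coefficient equation of the closed words `u ^ 8` for `s = 2` and `m = 4` factorizes, unless the
last sign differs from the product of the two before; then `q ^ 4 = ± 1` gives `2 q = ± 2`. -/
theorem factor_of_four {n : ℕ} (hn : 3 ≤ n) {q : ZMod n} (hq : IsUnit q)
    (hq4 : IsSign (q ^ 4)) {a b d : ZMod n} (ha : IsSign a) (hb : IsSign b) (hd : IsSign d)
    (h1 : 1 + a * q + b * q ^ 2 + d * q ^ 3 = 0) :
    (2 * q = 2 ∨ 2 * q = -2) ∨
      ∃ a b : ZMod n, IsSign a ∧ IsSign b ∧ (1 + a * q) * (1 + b * q ^ 2) = 0 := by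
  have h2' := two_ne_zero_of hn
  by_cases hdab : d = a * b
  · right
    exact ⟨a, b, ha, hb, by rw [hdab] at h1; linear_combination h1⟩
  · left
    have hd' : d = -(a * b) := by
      rcases ha with rfl | rfl <;> rcases hb with rfl | rfl <;> rcases hd with rfl | rfl <;>
        simp_all
    subst hd'
    obtain ⟨Q, hQ⟩ : ∃ Q, Q = a * q := ⟨_, rfl⟩
    have hQ2 : Q ^ 2 = q ^ 2 := by rw [hQ]; linear_combination q ^ 2 * ha.mul_self
    have hQ3 : Q ^ 3 = a * q ^ 3 := by rw [hQ]; linear_combination a * q ^ 3 * ha.mul_self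
    have hQ4 : IsSign (Q ^ 4) := by
      have : Q ^ 4 = q ^ 4 := by linear_combination (Q ^ 2 + q ^ 2) * hQ2
      rwa [this]
    have hQu : IsUnit Q := hQ ▸ (isUnit_of_isSign ha).mul hq
    have h3 : 1 + Q + b * Q ^ 2 - b * Q ^ 3 = 0 := by
      rw [hQ2, hQ3, hQ]; linear_combination h1
    have main : 2 * Q = 2 ∨ 2 * Q = -2 := by
      rcases hb with rfl | rfl
      · have h5 : Q ^ 4 = 1 + 2 * Q + 2 * Q ^ 2 := by linear_combination -(Q + 1) * h3
        rcases hQ4 with k | k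
        · have : 2 * (1 + Q) * Q = 0 := by linear_combination k - h5
          right; linear_combination (hQu.mul_left_eq_zero).1 this
        · have : (2 : ZMod n) * Q ^ 3 = 0 := by linear_combination k - h5 - 2 * h3
          exact absurd (((hQu.pow 3).mul_left_eq_zero).1 this) h2'
      · have h5 : Q ^ 4 = -2 * Q - 1 := by linear_combination (Q + 1) * h3
        rcases hQ4 with k | k
        · right; linear_combination h5 - k
        · have : (2 : ZMod n) * Q = 0 := by linear_combination h5 - k
          exact absurd ((hQu.mul_left_eq_zero).1 this) h2'
    rcases ha with rfl | rfl
    · rw [hQ, one_mul] at main; exact main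
    · rcases main with k | k
      · right; rw [hQ] at k; linear_combination -k
      · left; rw [hQ] at k; linear_combination -k

/-- The parameters for which some word `u ^ t d ^ (8 - t)` with `t ≥ 4` closes up. The cases
`t = 5, …, 8` bound `m * s` by `2 t - 8`. -/
theorem cases_of_unimodal {m s n : ℕ} {r : (ZMod n)ˣ} (h : CPMAssumption m s n r)
    {u : ℕ → Bool} {c : ℕ → ZMod n} (hw : IsClosedWord m s r 8 u c) {t : ℕ} (ht4 : 4 ≤ t)
    (ht8 : t ≤ 8) (hu : ∀ j < 8, u j = decide (j < t)) :
    (s = 2 ∧ (2 * (r : ZMod n) ^ s = 2 ∨ 2 * (r : ZMod n) ^ s = -2)) ∨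
    (s = 3 ∧ (2 * (r : ZMod n) ^ s = 2 ∨ 2 * (r : ZMod n) ^ s = -2)) ∨
    (s = 4 ∧ (m = 1 ∨ m = 2) ∧ IsSign ((r : ZMod n) ^ s)) ∨
    (s = 2 ∧ m = 2) ∨
    (s = 2 ∧ m = 4 ∧ ∃ a b : ZMod n, IsSign a ∧ IsSign b ∧
      (1 + a * (r : ZMod n) ^ s) * (1 + b * ((r : ZMod n) ^ s) ^ 2) = 0) := by
  have hn := h.2.1
  have hn4 := h.2.2.1
  have hs2 := h.2.2.2.1
  have hms := h.2.2.2.2.1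
  have hru : ∀ j : ℕ, IsUnit ((r : ZMod n) ^ j) := fun j => r.isUnit.pow j
  have hsign : IsSign ((r : ZMod n) ^ (m * s)) := by
    have := isSign_zpow_of_dvd h (t := ((m * s : ℕ) : ℤ)) (dvd_refl _)
    rwa [zpow_natCast, Units.val_pow_eq_pow_val] at this
  have two_smul_ne : ∀ a : ZMod n, IsSign a → 2 * a ≠ 0 := fun a ha => ha.two_mul_ne hn
  have h0 : u 0 = true := by rw [hu 0 (by norm_num)]; simp; omega
  have h1 : u 1 = true := by rw [hu 1 (by norm_num)]; simp; omega
  have h2 : u 2 = true := by rw [hu 2 (by norm_num)]; simp; omega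
  have h3 : u 3 = true := by rw [hu 3 (by norm_num)]; simp; omega
  have h8 := hw.period
  rw [h0] at h8
  have h4 := hu 4 (by norm_num)
  have h5 := hu 5 (by norm_num)
  have h6 := hu 6 (by norm_num)
  have h7 := hu 7 (by norm_num)
  have hl := hw.level
  have e3 := hw.wrap
  have t3 := hw.turn 3
  have t6 := hw.turn 6
  have t7 := hw.turn 7
  interval_cases t
  · norm_num at h4 h5 h6 h7
    norm_num [lev, h0, h1, h2, h3, h4, h5, h6, h7, h8] at e3 t3 t7
    rcases (show s = 2 ∨ s = 3 ∨ 4 ≤ s by omega) with rfl | rfl | hs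
    · left
      refine ⟨rfl, ?_⟩
      have e1 := hw.closing 1
      norm_num [Finset.sum_range_succ, bot, lev, h0, h1, h2, h3, h4, h5, h6, h7] at e1
      rw [← t3] at e1
      rcases hw.sign 1 with k1 | k1 <;> rcases hw.sign 6 with k2 | k2
      · exact two_mul_eq_of IsSign.one (hw.sign 3) (by linear_combination e1 - k1 - k2)
      · have : 2 * c 3 * (r : ZMod n) ^ 2 = 0 := by linear_combination e1 - k1 - k2
        exact absurd (((hru 2).mul_left_eq_zero).1 this) (two_smul_ne _ (hw.sign 3))
      · have : 2 * c 3 * (r : ZMod n) ^ 2 = 0 := by linear_combination e1 - k1 - k2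
        exact absurd (((hru 2).mul_left_eq_zero).1 this) (two_smul_ne _ (hw.sign 3))
      · exact two_mul_eq_of IsSign.neg_one (hw.sign 3) (by linear_combination e1 - k1 - k2)
    · right; left
      refine ⟨rfl, ?_⟩
      have e0 := hw.closing 0
      norm_num [Finset.sum_range_succ, bot, lev, h0, h1, h2, h3, h4, h5, h6, h7] at e0
      rw [← t3, t7, e3] at e0
      exact two_mul_eq_of (hw.sign 0) (hw.sign 3) (by linear_combination e0)
    · exfalso
      have n1 : ¬ (s : ℤ) ∣ 1 := fun k => by have := Int.le_of_dvd (by norm_num) k; omega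
      have n2 : ¬ (s : ℤ) ∣ 2 := fun k => by have := Int.le_of_dvd (by norm_num) k; omega
      have n3 : ¬ (s : ℤ) ∣ 3 := fun k => by have := Int.le_of_dvd (by norm_num) k; omega
      have e := hw.closing 3
      norm_num [Finset.sum_range_succ, bot, lev, h0, h1, h2, h3, h4, h5, h6, h7, n1, n2, n3] at e
      rw [← t3] at e
      exact two_smul_ne _ (hw.sign 3) (by linear_combination e)
  · exfalso
    norm_num at h4 h5 h6 h7
    norm_num [lev, h0, h1, h2, h3, h4, h5, h6, h7] at hl
    have : ((m * s : ℕ) : ℤ) ∣ 2 := by push_cast; exact hl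
    have := Int.le_of_dvd (by norm_num) this
    omega
  · norm_num at h4 h5 h6 h7
    norm_num [lev, h0, h1, h2, h3, h4, h5, h6, h7] at hl
    have hl4 : ((m * s : ℕ) : ℤ) ∣ ((4 : ℕ) : ℤ) := by push_cast; exact hl
    rw [Int.natCast_dvd_natCast] at hl4
    have : m * s ≤ 4 := Nat.le_of_dvd (by norm_num) hl4
    have hs4 : s ∣ 4 := dvd_trans (Dvd.intro_left m rfl) hl4
    have : s ≤ 4 := Nat.le_of_dvd (by norm_num) hs4
    have : m ≤ 2 := by nlinarith
    have : m ≠ 0 := by rintro rfl; omega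
    interval_cases s <;> interval_cases m <;> simp_all
  · norm_num at h4 h5 h6 h7
    norm_num [lev, h0, h1, h2, h3, h4, h5, h6, h7] at hl
    norm_num [lev, h0, h1, h2, h3, h4, h5, h6, h7, h8] at e3 t6 t7
    have hl6 : ((m * s : ℕ) : ℤ) ∣ ((6 : ℕ) : ℤ) := by push_cast; exact hl
    rw [Int.natCast_dvd_natCast] at hl6
    have hms6 : m * s ≤ 6 := Nat.le_of_dvd (by norm_num) hl6
    have hs6 : s ∣ 6 := dvd_trans (Dvd.intro_left m rfl) hl6
    have : s ≤ 6 := Nat.le_of_dvd (by norm_num) hs6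
    have : m ≤ 3 := by nlinarith
    have : m ≠ 0 := by rintro rfl; omega
    have hs' : s = 2 ∨ s = 3 ∨ s = 6 := by
      interval_cases s <;> simp_all
    rcases hs' with rfl | rfl | rfl
    · have hm3 : m = 3 := by interval_cases m <;> omega
      subst hm3
      left
      refine ⟨rfl, ?_⟩
      have e0 := hw.closing 0
      have e1 := hw.closing 1
      norm_num [Finset.sum_range_succ, bot, lev, h0, h1, h2, h3, h4, h5, h6, h7] at e0 e1
      have s3 := (hw.sign 1).mul_self
      have s0 := (hw.sign 0).mul_self
      refine two_mul_eq_of_three hn hn4 (hru 2) (by rw [← pow_mul]; exact hsign)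
        ((hw.sign 1).mul (hw.sign 3)) ((hw.sign 1).mul (hw.sign 5))
        ((hw.sign 0).mul (hw.sign 2)) ((hw.sign 0).mul (hw.sign 4)) ?_ ?_
      · linear_combination c 1 * e1 - s3
      · linear_combination c 0 * e0 - 3 * s0 - c 0 * (r : ZMod n) ^ 6 * t6 -
          2 * c 0 * (r : ZMod n) ^ 6 * t7 - 2 * c 0 * e3
    · right; left
      refine ⟨rfl, two_mul_eq_of_isSign ?_⟩
      have hm2 : m = 1 ∨ m = 2 := by omega
      rcases hm2 with rfl | rfl
      · exact hsign
      · have e1 := hw.closing 1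
        norm_num [Finset.sum_range_succ, bot, lev, h0, h1, h2, h3, h4, h5, h6, h7] at e1
        exact isSign_of_add_mul (hw.sign 1) (hw.sign 4) e1
    · exfalso
      have e1 := hw.closing 1
      norm_num [Finset.sum_range_succ, bot, lev, h0, h1, h2, h3, h4, h5, h6, h7] at e1
      exact two_smul_ne _ (hw.sign 1) (by rw [e1, mul_zero])
  · norm_num at h4 h5 h6 h7
    norm_num [lev, h0, h1, h2, h3, h4, h5, h6, h7] at hl
    have hl8 : ((m * s : ℕ) : ℤ) ∣ ((8 : ℕ) : ℤ) := by push_cast; exact hl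
    rw [Int.natCast_dvd_natCast] at hl8
    have hms8 : m * s ≤ 8 := Nat.le_of_dvd (by norm_num) hl8
    have hs8 : s ∣ 8 := dvd_trans (Dvd.intro_left m rfl) hl8
    have : s ≤ 8 := Nat.le_of_dvd (by norm_num) hs8
    have : m ≤ 4 := by nlinarith
    have : m ≠ 0 := by rintro rfl; omega
    have hs' : s = 2 ∨ s = 4 ∨ s = 8 := by
      interval_cases s <;> simp_all
    rcases hs' with rfl | rfl | rfl
    · have hm3 : m = 2 ∨ m = 4 := by interval_cases m <;> omega
      rcases hm3 with rfl | rfl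
      · right; right; right; left; exact ⟨rfl, rfl⟩
      · have e0 := hw.closing 0
        norm_num [Finset.sum_range_succ, bot, lev, h0, h1, h2, h3, h4, h5, h6, h7] at e0
        have s0 := (hw.sign 0).mul_self
        rcases factor_of_four hn (hru 2) (by rw [← pow_mul]; exact hsign)
          ((hw.sign 0).mul (hw.sign 2)) ((hw.sign 0).mul (hw.sign 4))
          ((hw.sign 0).mul (hw.sign 6)) (by linear_combination c 0 * e0 - s0) with k | k
        · left; exact ⟨rfl, k⟩
        · right; right; right; right; exact ⟨rfl, rfl, k⟩
    · right; right; left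
      have hm2 : m = 1 ∨ m = 2 := by omega
      refine ⟨rfl, hm2, ?_⟩
      rcases hm2 with rfl | rfl
      · exact hsign
      · have e0 := hw.closing 0
        norm_num [Finset.sum_range_succ, bot, lev, h0, h1, h2, h3, h4, h5, h6, h7] at e0
        exact isSign_of_add_mul (hw.sign 0) (hw.sign 4) e0
    · exfalso
      have e1 := hw.closing 0
      norm_num [Finset.sum_range_succ, bot, lev, h0, h1, h2, h3, h4, h5, h6, h7] at e1
      exact two_smul_ne _ (hw.sign 0) (by rw [e1, mul_zero])

/-! ### Octagons through a 3-arc -/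

theorem origin_mem {m s n : ℕ} {r : (ZMod n)ˣ} :
    pt m 0 (0 : Fin s → ZMod n) ∈ ((CPMbar m s n r).connectedComponentMk (0, 0)).supp := by
  rw [SimpleGraph.ConnectedComponent.mem_supp_iff]
  simp [pt]

theorem isSign_getD {n : ℕ} (l : List (ZMod n)) (hl : ∀ a ∈ l, IsSign a) (i : ℕ) :
    IsSign (l.getD i 1) := by
  rw [List.getD_eq_getElem?_getD]
  rcases h : l[i]? with _ | a
  · exact IsSign.one
  · exact hl a (List.mem_of_getElem? h)

/-- The closed walk that changes the coefficients of two displacement vectors by `2`, one after the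
other, and undoes both changes in the same order. It exists for all parameters. -/
theorem exists_commutator_walk {m s n : ℕ} {r : (ZMod n)ˣ} (h : CPMAssumption m s n r) :
    ∃ x : ZMod 8 → (CPMbar m s n r).connectedComponentMk (0, 0),
      IsClosedNB (CPM m s n r) 8 x := by
  obtain ⟨x, hx, -⟩ := exists_closedNB_of_word h (L := 8) (by norm_num)
    (fun i => [true, false, false, true, true, false, false, true].getD i true)
    (fun i => [(1 : ZMod n), 1, 1, 1, -1, -1, -1, -1].getD i 1) 0 0 origin_mem
    (fun i _ => isSign_getD _ (by simp [IsSign]) i)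
    (by intro i hi; interval_cases i <;> simp)
    (by simp [Finset.sum_range_succ, bot, lev]; abel)
    (by simp [lev]) (by simp) (by simp [bot, lev])
  exact ⟨x, hx⟩

/-- In a 2-arc-transitive graph some closed walk of length `8` has at most two turns, since otherwise
the average number of turns would exceed `8 / 3`. -/
theorem cases_of_twoArcTransitive {m s n : ℕ} {r : (ZMod n)ˣ} (h : CPMAssumption m s n r)
    (hT : IsTwoArcTransitive (CPM m s n r)) :
    (s = 2 ∧ (2 * (r : ZMod n) ^ s = 2 ∨ 2 * (r : ZMod n) ^ s = -2)) ∨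
    (s = 3 ∧ (2 * (r : ZMod n) ^ s = 2 ∨ 2 * (r : ZMod n) ^ s = -2)) ∨
    (s = 4 ∧ (m = 1 ∨ m = 2) ∧ IsSign ((r : ZMod n) ^ s)) ∨
    (s = 2 ∧ m = 2) ∨
    (s = 2 ∧ m = 4 ∧ ∃ a b : ZMod n, IsSign a ∧ IsSign b ∧
      (1 + a * (r : ZMod n) ^ s) * (1 + b * ((r : ZMod n) ^ s) ^ 2) = 0) := by
  by_contra hcon
  have hfew : ∀ x : ZMod 8 → (CPMbar m s n r).connectedComponentMk (0, 0),
      IsClosedNB (CPM m s n r) 8 x → 8 ≤ 3 * turnCount fun i => (x i).1 := by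
    intro x hx
    by_contra hlt
    obtain ⟨u, c, t, hw, ht4, ht8, hu⟩ := exists_unimodal_word h hx.val (not_le.1 hlt)
    exact hcon (cases_of_unimodal h hw ht4 ht8 hu)
  obtain ⟨x, hx⟩ := exists_commutator_walk h
  have := three_mul_turnCount_eq h hT hfew x hx
  omega

/-- The 4-arc `(z, a, b, c, y)` lies on a closed walk of length `8` without backtracking. -/
def OnOctagon {V : Type*} (G : SimpleGraph V) (z a b c y : V) : Prop :=
  ∃ x : ZMod 8 → V, IsClosedNB G 8 x ∧ x (-1) = z ∧ x 0 = a ∧ x 1 = b ∧ x 2 = c ∧ x 3 = y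

/-- If no closed word contains `uudu`, or `uudd` with equal outer displacements, then the 4-arcs on
closed walks of length `8` around a given peak `(a, b, c)` are determined by their last vertex. -/
theorem predecessor_unique_of_peak {m s n : ℕ} {r : (ZMod n)ˣ} (h : CPMAssumption m s n r)
    (h1 : ∀ u c, IsClosedWord m s r 8 u c → u 0 = true → u 1 = true → u 2 = false →
      u 3 = true → False)
    (h2 : ∀ u c, IsClosedWord m s r 8 u c → u 0 = true → u 1 = true → u 2 = false →
      u 3 = false → c 3 = c 0 → False)
    {z z' a b c y : ZMod (m * s) × (Fin s → ZMod n)} (hab : goesUp a b = true)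
    (hbc : goesUp b c = false) (hz : OnOctagon (CPMbar m s n r) z a b c y)
    (hz' : OnOctagon (CPMbar m s n r) z' a b c y) : z = z' := by
  have key : ∀ z, OnOctagon (CPMbar m s n r) z a b c y →
      z = if goesUp c y then (a.1 + 1, a.2 + a.2 - b.2) else (a.1 - 1, a.2 + y.2 - c.2) := by
    clear hz hz' z z'
    rintro z ⟨x, hx, rfl, rfl, rfl, rfl, rfl⟩
    have hr := hx.rotate (-1)
    obtain ⟨u, c, hw, hu, hp⟩ := hr.exists_word h (pt_val_cast h _).symm
    have u0 := hu 0
    have u1 := hu 1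
    have u2 := hu 2
    have u3 := hu 3
    have p0 := hp 0
    have p1 := hp 1
    have p2 := hp 2
    have p3 := hp 3
    have p4 := hp 4
    norm_num at u0 u1 u2 u3 p0 p1 p2 p3 p4
    rw [hab] at u1
    rw [hbc] at u2
    rw [← u3]
    generalize ((x (-1)).1.val : ℤ) = k at p0 p1 p2 p3 p4
    generalize (x (-1)).2 = v at p0 p1 p2 p3 p4
    cases k0 : u 0 <;> cases k3 : u 3
    · -- the reversed walk contains `uudu`
      exfalso
      have hrev := hx.reverse.rotate (-3)
      obtain ⟨u', c', hw', hu', -⟩ := hrev.exists_word h (pt_val_cast h _).symm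
      have v0 := hu' 0
      have v1 := hu' 1
      have v2 := hu' 2
      have v3 := hu' 3
      norm_num at v0 v1 v2 v3
      have s0 := goesUp_symm h (hx (-1)).1
      have s1 := goesUp_symm h (hx 0).1
      have s2 := goesUp_symm h (hx 1).1
      have s3 := goesUp_symm h (hx 2).1
      norm_num at s0 s1 s2 s3
      rw [hab] at s1
      rw [hbc] at s2
      rw [← u0, k0] at s0
      rw [← u3, k3] at s3
      exact h1 u' c' hw' (v0.trans s3) (v1.trans s2) (v2.trans s1) (v3.trans s0)
    · have ht := hw.turn 0 (by simp [k0, u1])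
      rw [p0, p1, p2]
      ext1
      · simp [path, pt, lev, k0]
      · simp [path, pt, pos, Finset.sum_range_succ, bot, lev, k0, u1, ← ht, sub_eq_add_neg]
        abel
    · rw [p0, p1, p3, p4]
      have hc : c 3 = -c 0 := by
        have hne : c 3 ≠ c 0 := fun e => h2 u c hw k0 u1 u2 k3 e
        rcases hw.sign 0 with e | e <;> rcases hw.sign 3 with e' | e' <;> rw [e, e'] at hne ⊢
        · exact absurd rfl hne
        · exact (neg_neg _).symm
        · exact absurd rfl hne
      ext1
      · simp [path, pt, lev, k0]
      · simp [path, pt, pos, Finset.sum_range_succ, bot, lev, k0, u1, u2, k3, hc,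
          sub_eq_add_neg]
        abel
    · exact (h1 u c hw k0 u1 u2 k3).elim
  rw [key z hz, key z' hz']

/-- If the 4-arcs on closed walks of length `8` around a peak are determined by their last vertex, then
the same holds around all 2-arcs of a 2-arc-transitive graph. -/
theorem false_of_two_predecessors {m s n : ℕ} {r : (ZMod n)ˣ} (h : CPMAssumption m s n r)
    (hT : IsTwoArcTransitive (CPM m s n r))
    (h1 : ∀ u c, IsClosedWord m s r 8 u c → u 0 = true → u 1 = true → u 2 = false →
      u 3 = true → False)
    (h2 : ∀ u c, IsClosedWord m s r 8 u c → u 0 = true → u 1 = true → u 2 = false →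
      u 3 = false → c 3 = c 0 → False)
    {z z' a b c y : (CPMbar m s n r).connectedComponentMk (0, 0)}
    (hz : OnOctagon (CPM m s n r) z a b c y) (hz' : OnOctagon (CPM m s n r) z' a b c y)
    (hne : z ≠ z') : False := by
  have harc : IsTwoArc (CPM m s n r) a b c := by
    obtain ⟨x, hx, -, rfl, rfl, rfl, -⟩ := hz
    have e0 := hx 0
    have e1 := hx 1
    norm_num at e0 e1
    exact ⟨e0.1, e1.1, e0.2⟩
  have hA := adj_up h 0 (0 : Fin s → ZMod n) IsSign.one
  have hB := adj_down h (0 + 1) ((0 : Fin s → ZMod n) + (1 : ZMod n) • stepVec r 0) IsSign.one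
  have hp1 := mem_component_of_adj origin_mem hA
  have hp2 := mem_component_of_adj hp1 hB
  have hpeak : IsTwoArc (CPM m s n r) ⟨_, origin_mem⟩ ⟨_, hp1⟩ ⟨_, hp2⟩ := by
    refine ⟨hA, hB, fun e => ?_⟩
    have e1 := congrArg (fun x => (Subtype.val x).2) e
    have e2 : (0 : ZMod n) • (stepVec r 0 : Fin s → ZMod n) = (2 : ZMod n) • stepVec r 0 := by
      simpa [pt, two_smul] using e1
    exact two_ne_zero_of h.2.1 (stepVec_smul_injective h 0 e2).symm
  obtain ⟨φ, ha, hb, hc⟩ := hT _ _ _ _ _ _ harc hpeak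
  have hmap : ∀ z, OnOctagon (CPM m s n r) z a b c y →
      OnOctagon (CPMbar m s n r) (φ z).1 (φ a).1 (φ b).1 (φ c).1 (φ y).1 := by
    rintro z ⟨x, hx, rfl, rfl, rfl, rfl, rfl⟩
    exact ⟨_, (hx.map φ).val, rfl, rfl, rfl, rfl, rfl⟩
  refine hne (φ.injective (Subtype.ext (predecessor_unique_of_peak h h1 h2 ?_ ?_
    (hmap z hz) (hmap z' hz'))))
  · rw [ha, hb]; exact goesUp_up _ _ _
  · rw [hb, hc]; exact goesUp_down h _ _ _

/-- Two closed words that agree in the first three letters and differ in the vertex before the start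
violate the uniqueness of predecessors. -/
theorem false_of_two_words {m s n : ℕ} {r : (ZMod n)ˣ} (h : CPMAssumption m s n r)
    (hT : IsTwoArcTransitive (CPM m s n r))
    (h1 : ∀ u c, IsClosedWord m s r 8 u c → u 0 = true → u 1 = true → u 2 = false →
      u 3 = true → False)
    (h2 : ∀ u c, IsClosedWord m s r 8 u c → u 0 = true → u 1 = true → u 2 = false →
      u 3 = false → c 3 = c 0 → False)
    {x x' : ZMod 8 → (CPMbar m s n r).connectedComponentMk (0, 0)}
    (hx : IsClosedNB (CPM m s n r) 8 x) (hx' : IsClosedNB (CPM m s n r) 8 x')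
    {u u' : ℕ → Bool} {c c' : ℕ → ZMod n}
    (hp : ∀ j : ℕ, j < 8 → (x (j : ZMod 8)).1 = path m r u c 0 0 j)
    (hp' : ∀ j : ℕ, j < 8 → (x' (j : ZMod 8)).1 = path m r u' c' 0 0 j)
    (hagree : ∀ j < 3, u j = u' j ∧ c j = c' j)
    (hne : path m r u c 0 (0 : Fin s → ZMod n) 7 ≠ path m r u' c' 0 0 7) : False := by
  have hu := fun j hj => (hagree j hj).1
  have hc := fun j hj => (hagree j hj).2
  have heq : ∀ j : ℕ, j < 4 → x (j : ZMod 8) = x' (j : ZMod 8) := by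
    intro j hj
    apply Subtype.ext
    rw [hp j (by omega), hp' j (by omega)]
    interval_cases j <;>
      simp [path, pos, lev, bot, Finset.sum_range_succ, hu 0, hu 1, hu 2, hc 0, hc 1, hc 2]
  refine false_of_two_predecessors h hT h1 h2 (z := x (-1)) (z' := x' (-1)) (a := x 0) (b := x 1)
    (c := x 2) (y := x 3) ⟨x, hx, rfl, rfl, rfl, rfl, rfl⟩ ⟨x', hx', rfl, ?_, ?_, ?_, ?_⟩ ?_
  · simpa using (heq 0 (by norm_num)).symm
  · simpa using (heq 1 (by norm_num)).symm
  · simpa using (heq 2 (by norm_num)).symm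
  · simpa using (heq 3 (by norm_num)).symm
  · intro e
    apply hne
    rw [← hp 7 (by norm_num), ← hp' 7 (by norm_num)]
    exact congrArg Subtype.val e

/-- For `s = 3` the words `u ^ 4 d ^ 4` and `u ^ 3 d ^ 4 u` can be closed so that they start with the
same 3-arc. -/
theorem not_twoArcTransitive_of_three {m n : ℕ} {r : (ZMod n)ˣ} (h : CPMAssumption m 3 n r)
    (hq : 2 * (r : ZMod n) ^ 3 = 2 ∨ 2 * (r : ZMod n) ^ 3 = -2) :
    ¬ IsTwoArcTransitive (CPM m 3 n r) := by
  intro hT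
  obtain ⟨κ, hκ, hqκ⟩ : ∃ κ : ZMod n, IsSign κ ∧ 2 * (r : ZMod n) ^ 3 = 2 * κ := by
    rcases hq with e | e
    · exact ⟨1, IsSign.one, by rw [e]; ring⟩
    · exact ⟨-1, IsSign.neg_one, by rw [e]; ring⟩
  have h3 : ∀ w : ℤ, ((m * 3 : ℕ) : ℤ) ∣ w → (3 : ℤ) ∣ w := fun w hw =>
    dvd_trans ⟨m, by push_cast; ring⟩ hw
  have hE3 : (stepVec r 3 : Fin 3 → ZMod n) = (r : ZMod n) ^ 3 • stepVec r 0 := by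
    have := stepVec_add_eq (s := 3) r 0 3 (by norm_num)
    simpa using this
  have hE2 : (stepVec r 2 : Fin 3 → ZMod n) = (r : ZMod n) ^ 3 • stepVec r (-1) := by
    have := stepVec_add_eq (s := 3) r (-1) 3 (by norm_num)
    norm_num at this
    exact this
  have hz : (2 : ZMod n) + -κ * (r : ZMod n) ^ 3 + -κ * (r : ZMod n) ^ 3 = 0 := by
    linear_combination -κ * hqκ - 2 * hκ.mul_self
  have hz' : (r : ZMod n) ^ 3 + (r : ZMod n) ^ 3 + -κ + -κ = 0 := by
    linear_combination hqκ
  obtain ⟨x, hx, hp⟩ := exists_closedNB_of_word h (L := 8) (by norm_num)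
    (fun i => [true, true, true, true, false, false, false, false].getD i true)
    (fun i => [(1 : ZMod n), 1, 1, -κ, -κ, -1, -1, 1].getD i 1) 0 0 origin_mem
    (fun i _ => isSign_getD _ (by simp [hκ.neg, IsSign.one, IsSign.neg_one]) i)
    (by intro i hi; interval_cases i <;> simp)
    (by
      simp only [Finset.sum_range_succ, bot, lev, List.getD_cons_zero, List.getD_cons_succ]
      norm_num [hE3, smul_smul]
      have e : ∀ a b d : Fin 3 → ZMod n, a + b + d + -((κ * (r : ZMod n) ^ 3) • a) +
          -((κ * (r : ZMod n) ^ 3) • a) + -d + -b + a =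
          ((2 : ZMod n) + -κ * (r : ZMod n) ^ 3 + -κ * (r : ZMod n) ^ 3) • a := by
        intro a b d; module
      rw [e, hz, zero_smul])
    (by simp [lev]) (by simp) (by simp [bot, lev])
  obtain ⟨x', hx', hp'⟩ := exists_closedNB_of_word h (L := 8) (by norm_num)
    (fun i => [true, true, true, false, false, false, false, true].getD i true)
    (fun i => [(1 : ZMod n), 1, 1, 1, -1, -1, -κ, -κ].getD i 1) 0 0 origin_mem
    (fun i _ => isSign_getD _ (by simp [hκ.neg, IsSign.one, IsSign.neg_one]) i)
    (by intro i hi; interval_cases i <;> simp)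
    (by
      simp only [Finset.sum_range_succ, bot, lev, List.getD_cons_zero, List.getD_cons_succ]
      norm_num [hE2]
      have e : ∀ a b d : Fin 3 → ZMod n, a + b + (r : ZMod n) ^ 3 • d + (r : ZMod n) ^ 3 • d +
          -b + -a + -(κ • d) + -(κ • d) =
          ((r : ZMod n) ^ 3 + (r : ZMod n) ^ 3 + -κ + -κ) • d := by
        intro a b d; module
      rw [e, hz', zero_smul])
    (by simp [lev]) (by simp) (by simp [bot, lev])
  refine false_of_two_words h hT
    (fun u c hw => no_uudu_three h.2.1 h.2.2.1 hw (h3 _ hw.level))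
    (fun u c hw => no_uudd_three h.2.1 h.2.2.1 hw (h3 _ hw.level)) hx hx' hp hp'
    (by intro j hj; interval_cases j <;> simp) ?_
  intro e
  have e1 := congrArg Prod.fst e
  have := small_cast_ne_zero h (j := 2) (by norm_num) (by norm_num)
  apply this
  simp [path, pt, lev] at e1
  push_cast
  linear_combination e1

/-- If the words `u ^ 8` with signs `1, 1, 1, e, b, b, b, b e` close up for both choices of `e`, they
start with the same 3-arc, and it has two predecessors. -/
theorem false_of_octagons_around {m s n : ℕ} {r : (ZMod n)ˣ} (h : CPMAssumption m s n r)
    (hT : IsTwoArcTransitive (CPM m s n r))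
    (h1 : ∀ u c, IsClosedWord m s r 8 u c → u 0 = true → u 1 = true → u 2 = false →
      u 3 = true → False)
    (h2 : ∀ u c, IsClosedWord m s r 8 u c → u 0 = true → u 1 = true → u 2 = false →
      u 3 = false → c 3 = c 0 → False)
    (h8 : m * s ∣ 8) {b : ZMod n} (hb : IsSign b)
    (hclose : ∀ e : ZMod n, IsSign e → (stepVec r 0 : Fin s → ZMod n) + stepVec r 1 +
      stepVec r 2 + e • stepVec r 3 + b • stepVec r 4 + b • stepVec r 5 + b • stepVec r 6 +
      (b * e) • stepVec r 7 = 0) : False := by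
  obtain ⟨τ, hτ, hE⟩ : ∃ τ : ZMod n, IsSign τ ∧
      (stepVec r 8 : Fin s → ZMod n) = τ • stepVec r 0 := by
    refine stepVec_congr h ?_
    rw [ZMod.intCast_eq_intCast_iff_dvd_sub]
    rw [sub_zero]
    exact_mod_cast h8
  have hlev : ((m * s : ℕ) : ℤ) ∣ 8 := by exact_mod_cast h8
  have key : ∀ e : ZMod n, IsSign e →
      ∃ x : ZMod 8 → (CPMbar m s n r).connectedComponentMk (0, 0), IsClosedNB (CPM m s n r) 8 x ∧
        ∀ j : ℕ, j < 8 → (x (j : ZMod 8)).1 = path m r (fun _ => true)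
          (fun i => [1, 1, 1, e, b, b, b, b * e, τ].getD i 1) 0 0 j := by
    intro e he
    refine exists_closedNB_of_word h (L := 8) (by norm_num) _ _ 0 0 origin_mem
      (fun i _ => isSign_getD _ (by simp [hb, he, hb.mul he, hτ, IsSign.one]) i)
      (by intro i hi; simp) ?_ (by simpa [lev] using hlev) rfl ?_
    · simp only [Finset.sum_range_succ, bot, lev, List.getD_cons_zero, List.getD_cons_succ]
      norm_num
      exact hclose e he
    · simp only [bot, lev, List.getD_cons_zero, List.getD_cons_succ]
      norm_num
      rw [hE, smul_smul, hτ.mul_self, one_smul]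
  obtain ⟨x, hx, hp⟩ := key 1 IsSign.one
  obtain ⟨x', hx', hp'⟩ := key (-1) IsSign.neg_one
  refine false_of_two_words h hT h1 h2 hx hx' hp hp'
    (by intro j hj; interval_cases j <;> simp) ?_
  intro e
  have e1 := congrArg Prod.snd e
  simp only [path, pt, pos, Finset.sum_range_succ, bot, lev, List.getD_cons_zero,
    List.getD_cons_succ] at e1
  norm_num at e1
  have e2 : (1 : ZMod n) • (stepVec r 3 : Fin s → ZMod n) = (-1 : ZMod n) • stepVec r 3 := by
    simpa using e1
  have e3 := stepVec_smul_injective h 3 e2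
  exact two_ne_zero_of h.2.1 (by linear_combination e3)

/-- For `s = 4` and `r ^ 4 = ± 1` the straight words `u ^ 8` close up for two choices of the signs. -/
theorem not_twoArcTransitive_of_four {m n : ℕ} {r : (ZMod n)ˣ} (h : CPMAssumption m 4 n r)
    (hm : m = 1 ∨ m = 2) (hq : IsSign ((r : ZMod n) ^ 4)) :
    ¬ IsTwoArcTransitive (CPM m 4 n r) := by
  intro hT
  have h4 : ∀ w : ℤ, ((m * 4 : ℕ) : ℤ) ∣ w → (4 : ℤ) ∣ w := fun w hw =>
    dvd_trans ⟨m, by push_cast; ring⟩ hw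
  have hE : ∀ j : ℤ, (stepVec r (j + 4) : Fin 4 → ZMod n) = (r : ZMod n) ^ 4 • stepVec r j := by
    intro j
    have := stepVec_add_eq (s := 4) r j 4 (by norm_num)
    simpa using this
  refine false_of_octagons_around h hT
    (fun u c hw => no_uudu_four h.2.1 h.2.2.1 hw (h4 _ hw.level))
    (fun u c hw => no_uudd_four h.2.1 h.2.2.1 hw (h4 _ hw.level))
    (by rcases hm with rfl | rfl <;> norm_num) hq.neg ?_
  intro e _
  have e4 := hE 0
  have e5 := hE 1
  have e6 := hE 2
  have e7 := hE 3
  norm_num at e4 e5 e6 e7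
  rw [e4, e5, e6, e7]
  simp only [smul_smul, neg_mul, hq.mul_self, mul_right_comm _ e, one_mul]
  module

/-! ### Arithmetic of squares modulo small numbers -/

/-- An equation `a r ^ 2 = b` in `ZMod n` persists modulo the divisors of `n`. -/
theorem exists_sq_eq_of_dvd {n p : ℕ} (hp : p ∣ n) (r : (ZMod n)ˣ) (a b : ℤ)
    (hab : (a : ZMod n) * (r : ZMod n) ^ 2 = b) :
    ∃ x y : ZMod p, x * y = 1 ∧ (a : ZMod p) * x ^ 2 = b := by
  refine ⟨ZMod.castHom hp (ZMod p) r, ZMod.castHom hp (ZMod p) (r⁻¹ : (ZMod n)ˣ), ?_, ?_⟩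
  · rw [← map_mul, Units.mul_inv, map_one]
  · have := congrArg (ZMod.castHom hp (ZMod p)) hab
    rw [map_mul, map_pow, map_intCast, map_intCast] at this
    exact this

theorem dvd_of_natCast_eq_zero {n k : ℕ} (h : ((k : ℕ) : ZMod n) = 0) : n ∣ k :=
  (ZMod.natCast_eq_zero_iff k n).1 h

/-- If `r ^ 2 = ± 3` and `80 = 0`, reduction modulo `5` or `8` gives a contradiction, since `± 3` is
not a square there. -/
theorem sq_ne_three {n : ℕ} (hn : 3 ≤ n) (hn4 : n ≠ 4) (r : (ZMod n)ˣ) (h80 : (80 : ZMod n) = 0)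
    {a b : ZMod n} (ha : IsSign a) (hb : IsSign b) : 3 * a + b * (r : ZMod n) ^ 2 ≠ 0 := by
  intro h0
  have hd : n ∣ 80 := dvd_of_natCast_eq_zero (by exact_mod_cast h80)
  have h1 : ((1 : ℤ) : ZMod n) * (r : ZMod n) ^ 2 = ((3 : ℤ) : ZMod n) ∨
      ((1 : ℤ) : ZMod n) * (r : ZMod n) ^ 2 = ((-3 : ℤ) : ZMod n) := by
    push_cast
    rcases ha with rfl | rfl <;> rcases hb with rfl | rfl
    · right; linear_combination h0
    · left; linear_combination -h0
    · left; linear_combination h0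
    · right; linear_combination -h0
  have h58 : 5 ∣ n ∨ 8 ∣ n := by
    have : n ≤ 80 := Nat.le_of_dvd (by norm_num) hd
    interval_cases n <;> omega
  rcases h58 with h5 | h8
  · rcases h1 with h1 | h1 <;> obtain ⟨x, y, -, hx⟩ := exists_sq_eq_of_dvd h5 r _ _ h1 <;>
      revert x <;> decide
  · rcases h1 with h1 | h1 <;> obtain ⟨x, y, -, hx⟩ := exists_sq_eq_of_dvd h8 r _ _ h1 <;>
      revert x <;> decide

/-- The analogue of `sq_ne_three` for the inverse of `r ^ 2`. -/
theorem three_mul_sq_ne_one {n : ℕ} (hn : 3 ≤ n) (hn4 : n ≠ 4) (r : (ZMod n)ˣ)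
    (h80 : (80 : ZMod n) = 0) {a b : ZMod n} (ha : IsSign a) (hb : IsSign b) :
    a + 3 * b * (r : ZMod n) ^ 2 ≠ 0 := by
  intro h0
  have hd : n ∣ 80 := dvd_of_natCast_eq_zero (by exact_mod_cast h80)
  have h1 : ((3 : ℤ) : ZMod n) * (r : ZMod n) ^ 2 = ((1 : ℤ) : ZMod n) ∨
      ((3 : ℤ) : ZMod n) * (r : ZMod n) ^ 2 = ((-1 : ℤ) : ZMod n) := by
    push_cast
    rcases ha with rfl | rfl <;> rcases hb with rfl | rfl
    · right; linear_combination h0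
    · left; linear_combination -h0
    · left; linear_combination h0
    · right; linear_combination -h0
  have h58 : 5 ∣ n ∨ 8 ∣ n := by
    have : n ≤ 80 := Nat.le_of_dvd (by norm_num) hd
    interval_cases n <;> omega
  rcases h58 with h5 | h8
  · rcases h1 with h1 | h1 <;> obtain ⟨x, y, -, hx⟩ := exists_sq_eq_of_dvd h5 r _ _ h1 <;>
      revert x <;> decide
  · rcases h1 with h1 | h1 <;> obtain ⟨x, y, -, hx⟩ := exists_sq_eq_of_dvd h8 r _ _ h1 <;>
      revert x <;> decide

/-- The moduli `5` and `4` are excluded by the squares of the units there; modulo a divisor of `6` the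
claim is linear. -/
theorem two_mul_sq_eq_of {n : ℕ} (hn : 3 ≤ n) (r : (ZMod n)ˣ) (h120 : (120 : ZMod n) = 0)
    (h : (4 * (r : ZMod n) ^ 2 = 2 ∨ 4 * (r : ZMod n) ^ 2 = -2) ∨
      (2 * (r : ZMod n) ^ 2 = 4 ∨ 2 * (r : ZMod n) ^ 2 = -4)) :
    2 * (r : ZMod n) ^ 2 = 2 ∨ 2 * (r : ZMod n) ^ 2 = -2 := by
  have hd : n ∣ 120 := dvd_of_natCast_eq_zero (by exact_mod_cast h120)
  have h56 : 5 ∣ n ∨ 4 ∣ n ∨ n ∣ 6 := by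
    have : n ≤ 120 := Nat.le_of_dvd (by norm_num) hd
    interval_cases n <;> omega
  have h' : (((4 : ℤ) : ZMod n) * (r : ZMod n) ^ 2 = ((2 : ℤ) : ZMod n) ∨
      ((4 : ℤ) : ZMod n) * (r : ZMod n) ^ 2 = ((-2 : ℤ) : ZMod n)) ∨
      (((2 : ℤ) : ZMod n) * (r : ZMod n) ^ 2 = ((4 : ℤ) : ZMod n) ∨
      ((2 : ℤ) : ZMod n) * (r : ZMod n) ^ 2 = ((-4 : ℤ) : ZMod n)) := by
    push_cast; exact h
  rcases h56 with h5 | h4 | h6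
  · exfalso
    rcases h' with (h1 | h1) | (h1 | h1) <;>
      obtain ⟨x, y, -, hx⟩ := exists_sq_eq_of_dvd h5 r _ _ h1 <;> revert x <;> decide
  · exfalso
    rcases h' with (h1 | h1) | (h1 | h1) <;>
      obtain ⟨x, y, hxy, hx⟩ := exists_sq_eq_of_dvd h4 r _ _ h1 <;> revert x y <;> decide
  · have h60 : (6 : ZMod n) = 0 := by
      have := (ZMod.natCast_eq_zero_iff 6 n).2 h6
      exact_mod_cast this
    rcases h with (h1 | h1) | (h1 | h1)
    · right; linear_combination -h1 + (r : ZMod n) ^ 2 * h60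
    · left; linear_combination -h1 + (r : ZMod n) ^ 2 * h60
    · right; linear_combination h1 + h60
    · left; linear_combination h1 - h60

/-! ### The exceptional parameters with `s = 2` and `m ∈ {2, 4}` -/

theorem stepVec_two_add {n : ℕ} (r : (ZMod n)ˣ) (j : ℤ) :
    (stepVec r (j + 2) : Fin 2 → ZMod n) = (r : ZMod n) ^ 2 • stepVec r j := by
  have := stepVec_add_eq (s := 2) r j 2 (by norm_num)
  simpa using this

theorem four_mul_eq_of {n : ℕ} {a b q : ZMod n} (ha : IsSign a) (hb : IsSign b)
    (h : 2 * a + 4 * b * q = 0) : 4 * q = 2 ∨ 4 * q = -2 := by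
  rcases ha with rfl | rfl <;> rcases hb with rfl | rfl
  · right; linear_combination h
  · left; linear_combination -h
  · left; linear_combination h
  · right; linear_combination -h

theorem two_mul_eq_four_of {n : ℕ} {a b q : ZMod n} (ha : IsSign a) (hb : IsSign b)
    (h : 4 * a + 2 * b * q = 0) : 2 * q = 4 ∨ 2 * q = -4 := by
  rcases ha with rfl | rfl <;> rcases hb with rfl | rfl
  · right; linear_combination h
  · left; linear_combination -h
  · left; linear_combination h
  · right; linear_combination -h

theorem eq_three_of {n : ℕ} {a b q : ZMod n} (ha : IsSign a) (hb : IsSign b)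
    (h : 3 * a + b * q = 0) : q = 3 ∨ q = -3 := by
  rcases ha with rfl | rfl <;> rcases hb with rfl | rfl
  · right; linear_combination h
  · left; linear_combination -h
  · left; linear_combination h
  · right; linear_combination -h

theorem three_mul_eq_of {n : ℕ} {a b q : ZMod n} (ha : IsSign a) (hb : IsSign b)
    (h : a + 3 * b * q = 0) : 3 * q = 1 ∨ 3 * q = -1 := by
  rcases ha with rfl | rfl <;> rcases hb with rfl | rfl
  · right; linear_combination h
  · left; linear_combination -h
  · left; linear_combination h
  · right; linear_combination -h

/-- For `s = 2`, if both factors `1 ± r ^ 2` are annihilated by `1 + b r ^ 4`, then the straight words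
`u ^ 8` close up for two choices of the signs. -/
theorem not_twoArcTransitive_of_two {m n : ℕ} {r : (ZMod n)ˣ} (h : CPMAssumption m 2 n r)
    (hm : m = 2 ∨ m = 4)
    (hq : ¬ (2 * (r : ZMod n) ^ 2 = 2 ∨ 2 * (r : ZMod n) ^ 2 = -2))
    (hq2 : 2 * ((r : ZMod n) ^ 2) ^ 2 = 2 ∨ 2 * ((r : ZMod n) ^ 2) ^ 2 = -2) {b : ZMod n}
    (hb : IsSign b)
    (hb1 : (1 + b * ((r : ZMod n) ^ 2) ^ 2) * (1 + (r : ZMod n) ^ 2) = 0)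
    (hb2 : (1 + b * ((r : ZMod n) ^ 2) ^ 2) * (1 - (r : ZMod n) ^ 2) = 0) :
    ¬ IsTwoArcTransitive (CPM m 2 n r) := by
  intro hT
  have hn := h.2.1
  have hn4 := h.2.2.1
  set q := (r : ZMod n) ^ 2 with hqdef
  have h4 : ∀ w : ℤ, ((m * 2 : ℕ) : ℤ) ∣ w → (4 : ℤ) ∣ w := by
    rcases hm with rfl | rfl
    · exact fun w hw => hw
    · exact fun w hw => dvd_trans (by norm_num) hw
  have hA : ∀ a b : ZMod n, IsSign a → IsSign b → 2 * a + 2 * b * q ≠ 0 :=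
    fun a b ha hb e => hq (two_mul_eq_of ha hb e)
  have hC : ∀ a b : ZMod n, IsSign a → IsSign b → 3 * a + b * q ≠ 0 := by
    intro a b ha hb e
    refine sq_ne_three hn hn4 r ?_ ha hb e
    rcases eq_three_of ha hb e with k | k <;> rcases hq2 with k' | k' <;> rw [k] at k'
    · linear_combination 5 * k'
    · linear_combination 4 * k'
    · linear_combination 5 * k'
    · linear_combination 4 * k'
  have hC' : ∀ a b : ZMod n, IsSign a → IsSign b → a + 3 * b * q ≠ 0 := by
    intro a b ha hb e
    refine three_mul_sq_ne_one hn hn4 r ?_ ha hb e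
    have k1 : 9 * q ^ 2 = 1 := by
      rcases three_mul_eq_of ha hb e with k | k
      · linear_combination (3 * q + 1) * k
      · linear_combination (3 * q - 1) * k
    rcases hq2 with k' | k'
    · linear_combination 10 * k1 - 45 * k'
    · linear_combination 36 * k' - 8 * k1
  have hD : ∀ a b : ZMod n, IsSign a → IsSign b → 2 * a + 4 * b * q ≠ 0 := by
    intro a b ha hb e
    have k0 := four_mul_eq_of ha hb e
    refine hq (two_mul_sq_eq_of hn r ?_ (Or.inl k0))
    have k1 : 16 * q ^ 2 = 4 := by
      rcases k0 with k | k
      · linear_combination (4 * q + 2) * k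
      · linear_combination (4 * q - 2) * k
    rcases hq2 with k' | k'
    · linear_combination 10 * k1 - 80 * k'
    · linear_combination -6 * k1 + 48 * k'
  refine false_of_octagons_around h hT
    (fun u c hw => no_uudu_two hn hn4 hA hC hD hw (h4 _ hw.level))
    (fun u c hw => no_uudd_two hn hn4 hA hC hC' hw (h4 _ hw.level))
    (by rcases hm with rfl | rfl <;> norm_num) hb ?_
  intro e he
  have e2 := stepVec_two_add r 0
  have e3 := stepVec_two_add r 1
  have e4 := stepVec_two_add r 2
  have e5 := stepVec_two_add r 3
  have e6 := stepVec_two_add r 4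
  have e7 := stepVec_two_add r 5
  norm_num at e2 e3 e4 e5 e6 e7
  rw [e7, e6, e5, e4, e3, e2, ← hqdef]
  have e1 : (1 + b * q ^ 2) * (1 + e * q) = 0 := by
    rcases he with rfl | rfl
    · rw [one_mul]; exact hb1
    · rw [neg_one_mul, ← sub_eq_add_neg]; exact hb2
  have : ∀ x y : Fin 2 → ZMod n, x + y + q • x + e • q • y + b • q • q • x + b • q • q • y +
      b • q • q • q • x + (b * e) • q • q • q • y =
      ((1 + b * q ^ 2) * (1 + q)) • x + ((1 + b * q ^ 2) * (1 + e * q)) • y := by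
    intro x y; module
  rw [this, hb1, e1, zero_smul, zero_smul, add_zero]

/-! ### Alternating 3-arcs -/

/-- An alternating 3-arc lies on no closed walk of length `L`, if closed words of length `L` contain
neither `uudu` nor `uduu`. A cyclic sequence of directions that starts `udu` or `dud` is alternating
or contains one of these patterns, up to exchanging `u` and `d` (this is `hdec`); and an alternating
walk does not close up, because its `L` displacements are equal and `L ≠ 0` in `ZMod n`. -/
theorem alternating_not_onClosed {m s n : ℕ} {r : (ZMod n)ˣ} (h : CPMAssumption m s n r) {L : ℕ}
    [NeZero L] (hL : (L : ZMod n) ≠ 0)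
    (hdec : ∀ δ : ZMod L → Bool, δ 0 ≠ δ 1 → δ 1 ≠ δ 2 → (∀ i, δ i ≠ δ (i + 1)) ∨
      ∃ a b : Bool, b = !a ∧ ∃ i, δ i = a ∧ δ (i + 3) = a ∧
        (δ (i + 1) = a ∧ δ (i + 2) = b ∨ δ (i + 1) = b ∧ δ (i + 2) = a))
    (h1 : ∀ u c, IsClosedWord m s r L u c → u 0 = true → u 1 = true → u 2 = false →
      u 3 = true → False)
    (h2 : ∀ u c, IsClosedWord m s r L u c → u 0 = true → u 1 = false → u 2 = true →
      u 3 = true → False)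
    {a b c d : ZMod (m * s) × (Fin s → ZMod n)} (hab : goesUp a b ≠ goesUp b c)
    (hbc : goesUp b c ≠ goesUp c d) : ¬ OnClosed (CPMbar m s n r) L a b c d := by
  rintro ⟨x, hx, rfl, rfl, rfl, rfl⟩
  have key : ∀ y : ZMod L → ZMod (m * s) × (Fin s → ZMod n), IsClosedNB (CPMbar m s n r) L y →
      ∀ i : ZMod L, goesUp (y i) (y (i + 1)) = true → goesUp (y (i + 3)) (y (i + 3 + 1)) = true →
      ((goesUp (y (i + 1)) (y (i + 1 + 1)) = true ∧ goesUp (y (i + 2)) (y (i + 2 + 1)) = false) ∨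
      (goesUp (y (i + 1)) (y (i + 1 + 1)) = false ∧ goesUp (y (i + 2)) (y (i + 2 + 1)) = true)) →
      False := by
    intro y hy i k0 k3 k12
    obtain ⟨u, c, hw, hu, -⟩ := (hy.rotate i).exists_word h (pt_val_cast h _).symm
    have u0 := hu 0
    have u1 := hu 1
    have u2 := hu 2
    have u3 := hu 3
    simp only [Nat.cast_zero, Nat.cast_one, Nat.cast_ofNat, zero_add, add_comm _ i, add_zero] at u0 u1 u2 u3
    rw [k0] at u0
    simp only [← add_assoc] at u1 u2 u3
    rw [k3] at u3
    rcases k12 with ⟨k1, k2⟩ | ⟨k1, k2⟩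
    · exact h1 u c hw u0 (u1.trans k1) (u2.trans k2) u3
    · exact h2 u c hw u0 (u1.trans k1) (u2.trans k2) u3
  rcases hdec (fun i => goesUp (x i) (x (i + 1)))
    (by norm_num; simpa using hab) (by norm_num; simpa using hbc) with halt |
      ⟨a, b, hb, i, k0, k3, k12⟩
  · obtain ⟨u, c, hw, hu, -⟩ := hx.exists_word h (pt_val_cast h _).symm
    have hu' : ∀ i, u i ≠ u (i + 1) := by
      intro i
      rw [hu, hu]
      have := halt i
      push_cast
      exact this
    have hbot : ∀ i, bot u 0 i = bot u 0 0 ∧ c i = c 0 := by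
      intro i
      induction i with
      | zero => exact ⟨rfl, rfl⟩
      | succ i ih =>
        exact ⟨(bot_succ_of_turn (hu' i)).trans ih.1, (hw.turn i (hu' i)).symm.trans ih.2⟩
    have hcl := hw.closing (bot u 0 0)
    rw [Finset.sum_congr rfl (g := fun _ => c 0) (fun i _ => by
      rw [(hbot i).1, (hbot i).2, sub_self]; simp)] at hcl
    rw [Finset.sum_const, Finset.card_range, nsmul_eq_mul] at hcl
    exact hL (((isUnit_of_isSign (hw.sign 0)).mul_left_eq_zero).1 hcl)
  · cases a
    · -- the reversed walk has the same pattern with up and down exchanged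
      subst hb
      have hrev : ∀ j : ZMod L, ∀ e : Bool, goesUp (x j) (x (j + 1)) = e →
          goesUp (x (-(-(j + 1)))) (x (-(-(j + 1) + 1))) = !e := by
        intro j e he
        rw [goesUp_reverse h hx, ← he]
        congr 3 <;> ring
      refine key _ hx.reverse (-(i + 4)) ?_ ?_ ?_
      · have := hrev (i + 3) _ k3
        rwa [show i + 3 + 1 = i + 4 by ring] at this
      · have := hrev i _ k0
        rwa [show -(i + 1) = -(i + 4) + 3 by ring] at this
      · rcases k12 with ⟨k1, k2⟩ | ⟨k1, k2⟩
        · right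
          have e1 := hrev (i + 2) _ k2
          have e2 := hrev (i + 1) _ k1
          rw [show -(i + 2 + 1) = -(i + 4) + 1 by ring] at e1
          rw [show -(i + 1 + 1) = -(i + 4) + 2 by ring] at e2
          exact ⟨e1, e2⟩
        · left
          have e1 := hrev (i + 2) _ k2
          have e2 := hrev (i + 1) _ k1
          rw [show -(i + 2 + 1) = -(i + 4) + 1 by ring] at e1
          rw [show -(i + 1 + 1) = -(i + 4) + 2 by ring] at e2
          exact ⟨e1, e2⟩
    · subst hb
      exact key x hx i k0 k3 k12

theorem alternating_or_pattern_eight : ∀ δ : ZMod 8 → Bool, δ 0 ≠ δ 1 → δ 1 ≠ δ 2 →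
    (∀ i, δ i ≠ δ (i + 1)) ∨ ∃ a b : Bool, b = !a ∧ ∃ i, δ i = a ∧ δ (i + 3) = a ∧
        (δ (i + 1) = a ∧ δ (i + 2) = b ∨ δ (i + 1) = b ∧ δ (i + 2) = a) := by
  decide +kernel

theorem alternating_or_pattern_six : ∀ δ : ZMod 6 → Bool, δ 0 ≠ δ 1 → δ 1 ≠ δ 2 →
    (∀ i, δ i ≠ δ (i + 1)) ∨ ∃ a b : Bool, b = !a ∧ ∃ i, δ i = a ∧ δ (i + 3) = a ∧
        (δ (i + 1) = a ∧ δ (i + 2) = b ∨ δ (i + 1) = b ∧ δ (i + 2) = a) := by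
  decide +kernel

/-! ### Straight lines -/

/-- Every 3-arc with directions `u₀, u₁, u₂` and signs `c₀, c₁, c₂` lies on a closed walk of length
`L` without backtracking. -/
def ArcCloses (m : ℕ) {s n : ℕ} (r : (ZMod n)ˣ) (L : ℕ) (u₀ u₁ u₂ : Bool) (c₀ c₁ c₂ : ZMod n) :
    Prop :=
  ∀ (k : ℤ) (v : Fin s → ZMod n),
    pt m k v ∈ ((CPMbar m s n r).connectedComponentMk (0, 0)).supp →
    ∃ x : ZMod L → (CPMbar m s n r).connectedComponentMk (0, 0), IsClosedNB (CPM m s n r) L x ∧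
      ∀ (u : ℕ → Bool) (c : ℕ → ZMod n), u 0 = u₀ → u 1 = u₁ → u 2 = u₂ → c 0 = c₀ → c 1 = c₁ →
        c 2 = c₂ → ∀ j : ℕ, j < 4 → (x (j : ZMod L)).1 = path m r u c k v j

theorem arcCloses_of_word {m s n : ℕ} {r : (ZMod n)ˣ} (h : CPMAssumption m s n r) {L : ℕ}
    (hL : 4 ≤ L) (u : ℕ → Bool) (c : ℕ → ZMod n)
    (hc : ∀ i ≤ L, IsSign (c i)) (ht : ∀ i < L, u i ≠ u (i + 1) → c i = c (i + 1))
    (hs : ∀ k, ∑ j ∈ Finset.range L, c j • (stepVec r (bot u k j) : Fin s → ZMod n) = 0)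
    (hl : ((m * s : ℕ) : ℤ) ∣ lev u 0 L) (hu : u L = u 0)
    (hw : ∀ k, c L • (stepVec r (bot u k L) : Fin s → ZMod n) = c 0 • stepVec r (bot u k 0)) :
    ArcCloses (s := s) m r L (u 0) (u 1) (u 2) (c 0) (c 1) (c 2) := by
  intro k v hmem
  obtain ⟨x, hx, hp⟩ := exists_closedNB_of_word h (by omega) u c k v hmem hc ht (hs k)
    (by rw [lev_eq_add, add_sub_cancel_left]; exact hl) hu (hw k)
  refine ⟨x, hx, fun u' c' u0 u1 u2 c0 c1 c2 j hj => ?_⟩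
  rw [hp j (by omega)]
  interval_cases j <;>
    simp [path, pos, lev, bot, Finset.sum_range_succ, u0, u1, u2, c0, c1, c2]

theorem lev_shift (u : ℕ → Bool) (k : ℤ) (i j : ℕ) :
    lev u k (i + j) = lev (fun t => u (i + t)) (lev u k i) j := by
  induction j with
  | zero => rfl
  | succ j ih => rw [← add_assoc, lev, ih, lev]

theorem path_shift {m s n : ℕ} (r : (ZMod n)ˣ) (u : ℕ → Bool) (c : ℕ → ZMod n) (k : ℤ)
    (v : Fin s → ZMod n) (i j : ℕ) : path m r u c k v (i + j) =
      path m r (fun t => u (i + t)) (fun t => c (i + t)) (lev u k i) (pos r u c k v i) j := by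
  rw [path, path, lev_shift]
  congr 1
  simp only [pos, Finset.sum_range_add, bot, lev_shift u k i, add_assoc]

theorem ArcCloses.onClosed {m s n : ℕ} {r : (ZMod n)ˣ} {L : ℕ}
    {f : ℕ → (CPMbar m s n r).connectedComponentMk (0, 0)} {u : ℕ → Bool} {c : ℕ → ZMod n} {k : ℤ}
    {v : Fin s → ZMod n} (hf : ∀ i, (f i).1 = path m r u c k v i) {i : ℕ}
    (hA : ArcCloses (s := s) m r L (u i) (u (i + 1)) (u (i + 2)) (c i) (c (i + 1)) (c (i + 2))) :
    OnClosed (CPM m s n r) L (f i) (f (i + 1)) (f (i + 2)) (f (i + 3)) := by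
  have hmem : pt m (lev u k i) (pos r u c k v i) ∈
      ((CPMbar m s n r).connectedComponentMk (0, 0)).supp := by
    have := (f i).2
    rwa [hf] at this
  obtain ⟨x, hx, hp⟩ := hA _ _ hmem
  have hp := hp (fun t => u (i + t)) (fun t => c (i + t)) rfl rfl rfl rfl rfl rfl
  have e : ∀ j : ℕ, j < 4 → x (j : ZMod L) = f (i + j) := fun j hj =>
    Subtype.ext (by rw [hp j hj, hf, path_shift])
  refine ⟨x, hx, ?_, ?_, ?_, ?_⟩
  · simpa using e 0 (by norm_num)
  · simpa using e 1 (by norm_num)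
  · simpa using e 2 (by norm_num)
  · simpa using e 3 (by norm_num)

/-- The walk that alternates between the levels `0` and `1`, with all displacements equal. -/
def zigzag (m : ℕ) {s n : ℕ} (r : (ZMod n)ˣ) (i : ℕ) : ZMod (m * s) × (Fin s → ZMod n) :=
  pt m ((i % 2 : ℕ) : ℤ) ((i : ZMod n) • stepVec r 0)

theorem zigzag_succ {m s n : ℕ} {r : (ZMod n)ˣ} (h : CPMAssumption m s n r) (i : ℕ) :
    (CPMbar m s n r).Adj (zigzag m r i) (zigzag m r (i + 1)) ∧
      goesUp (zigzag (s := s) m r i) (zigzag m r (i + 1)) = decide (i % 2 = 0) := by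
  have e : (((i + 1 : ℕ) : ZMod n) • stepVec r 0 : Fin s → ZMod n) =
      (i : ZMod n) • stepVec r 0 + (1 : ZMod n) • stepVec r 0 := by
    push_cast; module
  rcases Nat.mod_two_eq_zero_or_one i with h0 | h0
  · have h1 : (i + 1) % 2 = 1 := by omega
    simp only [zigzag, h0, h1, e]
    exact ⟨adj_up h 0 _ IsSign.one, goesUp_up 0 _ _⟩
  · have h1 : (i + 1) % 2 = 0 := by omega
    simp only [zigzag, h0, h1, e]
    exact ⟨adj_down h 1 _ IsSign.one, goesUp_down h 1 _ _⟩

/-- The period of the zigzag is the least common multiple of `2` and `n`. -/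
theorem zigzag_eq_iff {m s n : ℕ} {r : (ZMod n)ˣ} (h : CPMAssumption m s n r) (i N : ℕ) :
    zigzag (s := s) m r (i + N) = zigzag m r i ↔ 2 ∣ N ∧ n ∣ N := by
  have hne := small_cast_ne_zero h (j := 1) (by norm_num) (by norm_num)
  have h1 : (((i + N) % 2 : ℕ) : ℤ) = ((i % 2 : ℕ) : ℤ) ∨
      (((i + N) % 2 : ℕ) : ℤ) = ((i % 2 : ℕ) : ℤ) + 1 ∨
      ((i % 2 : ℕ) : ℤ) = (((i + N) % 2 : ℕ) : ℤ) + 1 := by omega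
  constructor
  · intro e
    have e1 : ((((i + N) % 2 : ℕ) : ℤ) : ZMod (m * s)) = (((i % 2 : ℕ) : ℤ) : ZMod (m * s)) :=
      congrArg Prod.fst e
    have e2 := stepVec_smul_injective h 0 (congrArg Prod.snd e)
    have hn : n ∣ N := by
      rw [← ZMod.natCast_eq_zero_iff]
      push_cast at e2
      linear_combination e2
    refine ⟨?_, hn⟩
    rcases h1 with h1 | h1 | h1
    · omega
    · rw [h1] at e1
      push_cast at e1 hne
      exact absurd (by linear_combination e1) hne
    · rw [h1] at e1
      push_cast at e1 hne
      exact absurd (by linear_combination -e1) hne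
  · rintro ⟨h2, hn⟩
    have e1 : (i + N) % 2 = i % 2 := by omega
    have e2 : ((N : ℕ) : ZMod n) = 0 := (ZMod.natCast_eq_zero_iff _ _).2 hn
    simp only [zigzag, e1, Nat.cast_add, e2, add_zero]

theorem exists_zigzag {m s n : ℕ} {r : (ZMod n)ˣ} (h : CPMAssumption m s n r) :
    ∃ z : ℕ → (CPMbar m s n r).connectedComponentMk (0, 0), ∀ i, (z i).1 = zigzag m r i := by
  have : ∀ i, zigzag m r i ∈ ((CPMbar m s n r).connectedComponentMk (0, 0)).supp := by
    intro i
    induction i with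
    | zero => simpa [zigzag] using origin_mem (m := m) (r := r)
    | succ i ih => exact mem_component_of_adj ih (zigzag_succ h i).1
  exact ⟨fun i => ⟨_, this i⟩, fun i => rfl⟩

theorem zigzag_walk {m s n : ℕ} {r : (ZMod n)ˣ} (h : CPMAssumption m s n r)
    {z : ℕ → (CPMbar m s n r).connectedComponentMk (0, 0)} (hz : ∀ i, (z i).1 = zigzag m r i) :
    (∀ i, (CPM m s n r).Adj (z i) (z (i + 1))) ∧ ∀ i, z i ≠ z (i + 2) := by
  refine ⟨fun i => ?_, fun i e => ?_⟩
  · rw [CPM_adj, hz, hz]; exact (zigzag_succ h i).1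
  · have e1 := congrArg Subtype.val e
    rw [hz, hz] at e1
    have := Nat.le_of_dvd (by norm_num) ((zigzag_eq_iff h i 2).1 e1.symm).2
    have := h.2.1
    omega

theorem zigzag_twoArc {m s n : ℕ} {r : (ZMod n)ˣ} (h : CPMAssumption m s n r)
    {z : ℕ → (CPMbar m s n r).connectedComponentMk (0, 0)} (hz : ∀ i, (z i).1 = zigzag m r i)
    (i : ℕ) : IsTwoArc (CPM m s n r) (z i) (z (i + 1)) (z (i + 2)) :=
  ⟨(zigzag_walk h hz).1 i, (zigzag_walk h hz).1 (i + 1), (zigzag_walk h hz).2 i⟩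

theorem zigzag_not_onClosed {m s n : ℕ} {r : (ZMod n)ˣ} (h : CPMAssumption m s n r) {L : ℕ}
    (hL : ∀ a b c d : ZMod (m * s) × (Fin s → ZMod n), goesUp a b ≠ goesUp b c →
      goesUp b c ≠ goesUp c d → ¬ OnClosed (CPMbar m s n r) L a b c d)
    {z : ℕ → (CPMbar m s n r).connectedComponentMk (0, 0)} (hz : ∀ i, (z i).1 = zigzag m r i)
    (i : ℕ) : ¬ OnClosed (CPM m s n r) L (z i) (z (i + 1)) (z (i + 2)) (z (i + 3)) := by
  rintro ⟨x, hx, e0, e1, e2, e3⟩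
  refine hL (z i).1 (z (i + 1)).1 (z (i + 2)).1 (z (i + 3)).1 ?_ ?_
    ⟨_, hx.val, by rw [e0], by rw [e1], by rw [e2], by rw [e3]⟩
  · rw [hz, hz, hz, (zigzag_succ h i).2, (zigzag_succ h (i + 1)).2]
    rcases Nat.mod_two_eq_zero_or_one i with h0 | h0
    · simp [h0, show (i + 1) % 2 = 1 by omega]
    · simp [h0, show (i + 1) % 2 = 0 by omega]
  · rw [hz, hz, hz, (zigzag_succ h (i + 1)).2, (zigzag_succ h (i + 2)).2]
    rcases Nat.mod_two_eq_zero_or_one i with h0 | h0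
    · simp [h0, show (i + 1) % 2 = 1 by omega]
    · simp [h0, show (i + 1) % 2 = 0 by omega]

/-- If the walk `f` has no 3-arc on a closed walk of length `L`, starts with two steps up, and
3-arcs `uud` and `uuu` with third sign `-λ` times the first one are always on such closed walks,
then `f` goes straight up, and its signs satisfy `c (i + 2) = λ c i`. -/
theorem straight_of_not_onClosed {m n : ℕ} {r : (ZMod n)ˣ} (h : CPMAssumption m 2 n r) {L : ℕ}
    {lam : ZMod n} (hlam : IsSign lam)
    (hA : ∀ α β : ZMod n, IsSign α → IsSign β →
      ArcCloses (s := 2) m r L true true false α β β)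
    (hB : ∀ α β : ZMod n, IsSign α → IsSign β →
      ArcCloses (s := 2) m r L true true true α β (-lam * α))
    {f : ℕ → (CPMbar m 2 n r).connectedComponentMk (0, 0)}
    (hadj : ∀ i, (CPM m 2 n r).Adj (f i) (f (i + 1))) (hnb : ∀ i, f i ≠ f (i + 2))
    (hno : ∀ i, ¬ OnClosed (CPM m 2 n r) L (f i) (f (i + 1)) (f (i + 2)) (f (i + 3)))
    (h0 : goesUp (f 0).1 (f 1).1 = true) (h1 : goesUp (f 1).1 (f 2).1 = true) {M : ℕ}
    (hM : f (2 * M) = f 0) : ∑ j ∈ Finset.range M, (lam * (r : ZMod n) ^ 2) ^ j = 0 := by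
  obtain ⟨u, c, hc, ht, hp, hu⟩ := exists_eq_path h (f := fun i => (f i).1)
    (fun i => CPM_adj.1 (hadj i)) (fun i e => hnb i (Subtype.ext e)) (pt_val_cast h _).symm
  have hup : ∀ i, u i = true ∧ u (i + 1) = true ∧ u (i + 2) = true := by
    have hstep : ∀ i, u i = true → u (i + 1) = true → u (i + 2) = true := by
      intro i e0 e1
      by_contra e2
      rw [Bool.not_eq_true] at e2
      refine hno i (ArcCloses.onClosed hp ?_)
      rw [e0, e1, e2, ← ht (i + 1) (by rw [e1, e2]; decide)]
      exact hA _ _ (hc i) (hc (i + 1))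
    intro i
    induction i with
    | zero => exact ⟨(hu 0).trans h0, (hu 1).trans h1, hstep 0 ((hu 0).trans h0) ((hu 1).trans h1)⟩
    | succ i ih => exact ⟨ih.2.1, ih.2.2, hstep (i + 1) ih.2.1 ih.2.2⟩
  have hcs : ∀ i, c (i + 2) = lam * c i := by
    intro i
    have hne : c (i + 2) ≠ -lam * c i := by
      intro e
      refine hno i (ArcCloses.onClosed hp ?_)
      rw [(hup i).1, (hup i).2.1, (hup i).2.2, e]
      exact hB _ _ (hc i) (hc (i + 1))
    rcases hc (i + 2) with e | e <;> rcases hlam.mul (hc i) with e' | e'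
    · rw [e, e']
    · exact absurd (by rw [neg_mul, e', e, neg_neg]) hne
    · exact absurd (by rw [neg_mul, e', e]) hne
    · rw [e, e']
  set k := ((f 0).1.1.val : ℤ)
  set v := (f 0).1.2
  have hlev : ∀ i, lev u k i = k + i := by
    intro i
    induction i with
    | zero => simp [lev]
    | succ i ih => simp [lev, ih, (hup i).1, add_assoc]
  have hE : ∀ j : ℕ, ∀ a : ℤ, (stepVec r (a + 2 * j) : Fin 2 → ZMod n) =
      ((r : ZMod n) ^ 2) ^ j • stepVec r a := by
    intro j a
    have := stepVec_add_eq (s := 2) r a (2 * j) ⟨j, by push_cast; ring⟩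
    rw [this]
    congr 1
    rw [zpow_mul]
    norm_cast
  have hc2 : ∀ j : ℕ, c (2 * j) = lam ^ j * c 0 ∧ c (2 * j + 1) = lam ^ j * c 1 := by
    intro j
    induction j with
    | zero => simp
    | succ j ih =>
      refine ⟨?_, ?_⟩
      · rw [show 2 * (j + 1) = 2 * j + 2 by ring, hcs, ih.1]; ring
      · rw [show 2 * (j + 1) + 1 = 2 * j + 1 + 2 by ring, hcs, ih.2]; ring
  have hpos : ∀ j : ℕ, pos r u c k v (2 * j) =
      v + (∑ i ∈ Finset.range j, (lam * (r : ZMod n) ^ 2) ^ i) •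
        (c 0 • stepVec r k + c 1 • stepVec r (k + 1)) := by
    intro j
    induction j with
    | zero => simp [pos]
    | succ j ih =>
      have e : pos r u c k v (2 * (j + 1)) = pos r u c k v (2 * j) +
          (c (2 * j) • stepVec r (k + 2 * j) + c (2 * j + 1) • stepVec r (k + 1 + 2 * j)) := by
        have b0 : bot u k (2 * j) = k + 2 * j := by simp [bot, (hup _).1, hlev]
        have b1 : bot u k (2 * j + 1) = k + 1 + 2 * j := by
          simp [bot, (hup (2 * j)).2.1, hlev]; ring
        rw [show 2 * (j + 1) = 2 * j + 1 + 1 by ring]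
        simp only [pos, Finset.sum_range_succ, b0, b1]
        abel
      rw [e, ih, hE, hE, (hc2 j).1, (hc2 j).2, Finset.sum_range_succ, mul_pow]
      module
  have e : (f (2 * M)).1 = (f 0).1 := congrArg Subtype.val hM
  have e2 : pos r u c k v (2 * M) = v := by
    have := congrArg Prod.snd ((hp (2 * M)).symm.trans e)
    exact this
  rw [hpos, add_eq_left] at e2
  have e3 := congrArg (coordAt (s := 2) r k) e2
  have e4 := coordAt_stepVec (s := 2) r k 1
  norm_num at e4
  rw [map_smul, map_add, map_smul, map_smul, coordAt_stepVec_self, e4, map_zero] at e3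
  simp only [smul_eq_mul, mul_one, mul_zero, add_zero] at e3
  exact ((isUnit_of_isSign (hc 0)).mul_left_eq_zero).1 e3

/-- An automorphism that maps the peak at the start of the zigzag to two steps up maps the whole zigzag
to a straight line. Its period gives the equation for `r ^ 2`. -/
theorem geom_sum_eq_zero_of_twoArcTransitive {m n : ℕ} {r : (ZMod n)ˣ}
    (h : CPMAssumption m 2 n r) (hT : IsTwoArcTransitive (CPM m 2 n r)) {L : ℕ}
    (hL : ∀ a b c d : ZMod (m * 2) × (Fin 2 → ZMod n), goesUp a b ≠ goesUp b c →
      goesUp b c ≠ goesUp c d → ¬ OnClosed (CPMbar m 2 n r) L a b c d)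
    {lam : ZMod n} (hlam : IsSign lam)
    (hA : ∀ α β : ZMod n, IsSign α → IsSign β →
      ArcCloses (s := 2) m r L true true false α β β)
    (hB : ∀ α β : ZMod n, IsSign α → IsSign β →
      ArcCloses (s := 2) m r L true true true α β (-lam * α)) {M : ℕ} (hM : n ∣ 2 * M) :
    ∑ j ∈ Finset.range M, (lam * (r : ZMod n) ^ 2) ^ j = 0 := by
  obtain ⟨z, hz⟩ := exists_zigzag h
  have a1 := adj_up h 0 (0 : Fin 2 → ZMod n) IsSign.one
  have a2 := adj_up h (0 + 1) ((0 : Fin 2 → ZMod n) + (1 : ZMod n) • stepVec r 0) IsSign.one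
  have m1 := mem_component_of_adj origin_mem a1
  have m2 := mem_component_of_adj m1 a2
  have hup : IsTwoArc (CPM m 2 n r) ⟨_, origin_mem⟩ ⟨_, m1⟩ ⟨_, m2⟩ := by
    refine ⟨a1, a2, fun e => ?_⟩
    have := pt_level_ne h (0 + 1) ((0 : Fin 2 → ZMod n) + (1 : ZMod n) • stepVec r 0 +
      (1 : ZMod n) • stepVec r (0 + 1)) 0
    rw [add_sub_cancel_right] at this
    exact this (congrArg Subtype.val e).symm
  obtain ⟨φ, e0, e1, e2⟩ := hT _ _ _ _ _ _ (zigzag_twoArc h hz 0) hup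
  refine straight_of_not_onClosed h hlam hA hB (f := fun i => φ (z i))
    (fun i => φ.map_adj_iff.2 ((zigzag_walk h hz).1 i))
    (fun i e => (zigzag_walk h hz).2 i (φ.injective e))
    (fun i e => zigzag_not_onClosed h hL hz i ((onClosed_map_iff φ).1 e)) ?_ ?_ ?_
  · rw [e0, e1]; exact goesUp_up _ _ _
  · rw [e1, e2]; exact goesUp_up _ _ _
  · congr 1
    apply Subtype.ext
    rw [hz, hz]
    have := (zigzag_eq_iff (s := 2) h 0 (2 * M)).2 ⟨dvd_mul_right _ _, hM⟩
    rwa [zero_add] at this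

/-! ### The case `s = 2`, `m = 4` -/

/-- In this case `1 - x + x ^ 2 - x ^ 3 = 0` for `x = ± r ^ 2`, and the lengths of the straight
lines force `8 ∣ n` and then `4 ∣ 1 + r ^ 4`. -/
theorem not_twoArcTransitive_of_two_four {n : ℕ} {r : (ZMod n)ˣ} (h : CPMAssumption 4 2 n r)
    (hq : ¬ (2 * (r : ZMod n) ^ 2 = 2 ∨ 2 * (r : ZMod n) ^ 2 = -2)) {a : ZMod n}
    (ha : IsSign a) (hab : (1 + a * (r : ZMod n) ^ 2) * (1 + ((r : ZMod n) ^ 2) ^ 2) = 0) :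
    ¬ IsTwoArcTransitive (CPM 4 2 n r) := by
  intro hT
  have hn := h.2.1
  have hn4 := h.2.2.1
  have haa := ha.mul_self
  have hq8 : (8 : ZMod n) ≠ 0 := by
    intro h8
    have hd : n ∣ 8 := dvd_of_natCast_eq_zero (by exact_mod_cast h8)
    have : n = 8 := by
      have := Nat.le_of_dvd (by norm_num) hd
      interval_cases n <;> omega
    subst this
    -- squares of units are `1` modulo `8`
    have : ∀ r : (ZMod 8)ˣ, 2 * (r : ZMod 8) ^ 2 = 2 := by decide
    exact hq (Or.inl (this r))
  set q := (r : ZMod n) ^ 2 with hqdef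
  have hq4 : q ^ 4 = 1 := by
    linear_combination (-(1 - a * q)) * hab + (-q ^ 2 - q ^ 4) * haa
  have hA : ∀ a b : ZMod n, IsSign a → IsSign b → 2 * a + 2 * b * q ≠ 0 :=
    fun a b ha hb e => hq (two_mul_eq_of ha hb e)
  have hC : ∀ a b : ZMod n, IsSign a → IsSign b → 3 * a + b * q ≠ 0 := by
    intro a b ha hb e
    refine sq_ne_three hn hn4 r ?_ ha hb e
    rcases eq_three_of ha hb e with k | k <;> rw [k] at hq4 <;> linear_combination hq4
  have hD : ∀ a b : ZMod n, IsSign a → IsSign b → 2 * a + 4 * b * q ≠ 0 := by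
    intro a b ha hb e
    have k0 := four_mul_eq_of ha hb e
    refine hq (two_mul_sq_eq_of hn r ?_ (Or.inl k0))
    rcases k0 with k | k
    · have k1 : (16 : ZMod n) = 2 * q := by
        linear_combination -16 * hq4 + (4 * q ^ 3 + 2 * q ^ 2 + q) * k
      linear_combination 4 * (2 * k1 + k)
    · have k1 : (16 : ZMod n) = -2 * q := by
        linear_combination -16 * hq4 + (4 * q ^ 3 - 2 * q ^ 2 + q) * k
      linear_combination 4 * (2 * k1 - k)
  have hD' : ∀ a b : ZMod n, IsSign a → IsSign b → 4 * a + 2 * b * q ≠ 0 := by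
    intro a b ha hb e
    have k0 := two_mul_eq_four_of ha hb e
    refine hq (two_mul_sq_eq_of hn r ?_ (Or.inr k0))
    rcases k0 with k | k
    · linear_combination -4 * ((q ^ 3 + 2 * q ^ 2 + 4 * q + 8) * k - 2 * hq4)
    · linear_combination -4 * ((q ^ 3 - 2 * q ^ 2 + 4 * q - 8) * k - 2 * hq4)
  have hlev4 : ∀ w : ℤ, ((4 * 2 : ℕ) : ℤ) ∣ w → (4 : ℤ) ∣ w := fun w hw =>
    dvd_trans (by norm_num) hw
  have hL : ∀ a b c d : ZMod (4 * 2) × (Fin 2 → ZMod n), goesUp a b ≠ goesUp b c →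
      goesUp b c ≠ goesUp c d → ¬ OnClosed (CPMbar 4 2 n r) 8 a b c d :=
    fun a b c d hab hbc => alternating_not_onClosed h (by exact_mod_cast hq8)
      alternating_or_pattern_eight
      (fun u c hw => no_uudu_two hn hn4 hA hC hD hw (hlev4 _ hw.level))
      (fun u c hw => no_uduu_two hn hn4 hA hD' hw hw.level) hab hbc
  have hsum := fun M hM => geom_sum_eq_zero_of_twoArcTransitive h hT hL (lam := -a) ha.neg
    (fun α β hα hβ => arcCloses_of_word h (by norm_num)
      (fun i => [true, true, false, false, true, true, false, false, true].getD i true)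
      (fun i => [α, β, β, -α, -α, -β, -β, α, α].getD i 1)
      (fun i _ => isSign_getD _ (by simp [hα, hβ, hα.neg, hβ.neg]) i)
      (by intro i hi; interval_cases i <;> simp)
      (by intro k; simp [Finset.sum_range_succ, bot, lev]; abel)
      (by simp [lev]) (by simp) (by intro k; simp [bot, lev]))
    (fun α β hα hβ => by
      rw [neg_neg]
      refine arcCloses_of_word h (by norm_num) (fun _ => true)
        (fun i => [α, β, a * α, a * β, α, β, a * α, a * β, α].getD i 1)
        (fun i _ => isSign_getD _ (by simp [hα, hβ, ha.mul hα, ha.mul hβ]) i)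
        (by intro i hi; simp) ?_ (by simp [lev]) rfl ?_
      · intro k
        have e2 := stepVec_two_add r k
        have e3 := stepVec_two_add r (k + 1)
        have e4 := stepVec_two_add r (k + 2)
        have e5 := stepVec_two_add r (k + 3)
        have e6 := stepVec_two_add r (k + 4)
        have e7 := stepVec_two_add r (k + 5)
        simp only [add_assoc] at e3 e4 e5 e6 e7
        norm_num at e3 e4 e5 e6 e7
        simp only [Finset.sum_range_succ, bot, lev, List.getD_cons_zero, List.getD_cons_succ,
          if_true, add_assoc, Finset.sum_range_zero]
        norm_num
        rw [e7, e6, e5, e4, e3, e2, ← hqdef]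
        have : ∀ x y : Fin 2 → ZMod n, α • x + (β • y + ((a * α) • q • x + ((a * β) • q • y +
            (α • q • q • x + (β • q • q • y + ((a * α) • q • q • q • x +
            (a * β) • q • q • q • y)))))) =
            ((1 + a * q) * (1 + q ^ 2)) • (α • x + β • y) := by
          intro x y; module
        rw [this, hab, zero_smul]
      · intro k
        have e8 := stepVec_add_eq (s := 2) r k 8 (by norm_num)
        have er : ((r ^ (8 : ℤ) : (ZMod n)ˣ) : ZMod n) = 1 := by
          have : (r : ZMod n) ^ 8 = 1 := by rw [← hq4, hqdef]; ring
          exact_mod_cast this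
        rw [er, one_smul] at e8
        simp only [bot, lev, List.getD_cons_zero, List.getD_cons_succ, if_true, add_assoc]
        norm_num
        rw [e8]) (M := M) hM
  set x := -a * q with hx
  have hx2 : x ^ 2 = q ^ 2 := by rw [hx]; linear_combination q ^ 2 * haa
  have hx3 : (1 - x) * (1 + x ^ 2) = 0 := by rw [hx2, hx]; linear_combination hab
  have hx4 : x ^ 4 = 1 := by linear_combination (x ^ 2 + q ^ 2) * hx2 + hq4
  have hxne : 2 * x ≠ 2 := by
    intro e
    rcases ha with rfl | rfl
    · exact hq (Or.inr (by rw [hx] at e; linear_combination -e))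
    · exact hq (Or.inl (by rw [hx] at e; linear_combination e))
  have hx2ne : x ^ 2 ≠ 1 := fun e => hxne (by linear_combination -hx3 + (1 - x) * e)
  -- a vanishing geometric sum gives `x ^ M = 1`, where `x` has order `4`
  have hpow : ∀ M, n ∣ 2 * M → 4 ∣ M := by
    intro M hM
    have e : x ^ M = 1 := by
      have := mul_neg_geom_sum x M
      rw [hsum M hM, mul_zero] at this
      linear_combination this
    have e1 : x ^ (M % 4) = 1 := by
      rw [← Nat.div_add_mod M 4, pow_add, pow_mul, hx4, one_pow, one_mul] at e
      exact e
    have : M % 4 < 4 := Nat.mod_lt _ (by norm_num)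
    have hx1 : x ≠ 1 := fun e => hx2ne (by rw [e, one_pow])
    have : M % 4 = 0 := by
      interval_cases hr : M % 4
      · rfl
      · exact absurd (by simpa using e1) hx1
      · exact absurd e1 hx2ne
      · exact absurd (by linear_combination hx4 - x * e1) hx1
    omega
  obtain ⟨k, hk⟩ : 8 ∣ n := by
    have h1 := hpow n (dvd_mul_left _ _)
    have h2 := hpow (n / 2) ⟨1, by omega⟩
    omega
  have hgeo : ∀ k : ℕ, ∑ j ∈ Finset.range (4 * k), x ^ j = k * (1 + x + x ^ 2 + x ^ 3) := by
    intro k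
    induction k with
    | zero => simp
    | succ k ih =>
      rw [show 4 * (k + 1) = 4 * k + 1 + 1 + 1 + 1 by ring]
      simp only [Finset.sum_range_succ, ih, pow_succ, pow_mul, hx4, one_pow]
      push_cast
      ring
  -- the sum over one period of the zigzag, which has `4 k` terms, consists of `k` full periods of `x`
  have h0 := hsum (4 * k) ⟨1, by omega⟩
  rw [hgeo] at h0
  have hk0 : (2 * k : ZMod n) * (1 + (r : ZMod n) ^ 4) = 0 := by
    have : (r : ZMod n) ^ 4 = x ^ 2 := by rw [hx2, hqdef]; ring
    rw [this]
    linear_combination h0 + k * hx3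
  have : NeZero n := ⟨by omega⟩
  obtain ⟨t, ht⟩ : ∃ t : ℕ, (t : ZMod n) = r := ⟨_, ZMod.natCast_zmod_val (r : ZMod n)⟩
  have hdvd : n ∣ 2 * k * (1 + t ^ 4) := by
    rw [← ZMod.natCast_eq_zero_iff]
    push_cast
    rw [ht]
    exact hk0
  rw [hk, show 8 * k = 2 * k * 4 by ring] at hdvd
  -- fourth powers are `0` or `1` modulo `4`
  have h4 := Nat.dvd_of_mul_dvd_mul_left (by omega) hdvd
  have h4' := (ZMod.natCast_eq_zero_iff (1 + t ^ 4) 4).2 h4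
  push_cast at h4'
  generalize (t : ZMod 4) = y at h4'
  revert y
  decide

/-- Among the parameters in `cases_of_twoArcTransitive` only those with `s = 2` and `2 r ^ 2 = ± 2`
survive. -/
theorem two_mul_sq_of_twoArcTransitive {m s n : ℕ} {r : (ZMod n)ˣ} (h : CPMAssumption m s n r)
    (hT : IsTwoArcTransitive (CPM m s n r)) :
    s = 2 ∧ (2 * (r : ZMod n) ^ 2 = 2 ∨ 2 * (r : ZMod n) ^ 2 = -2) := by
  rcases cases_of_twoArcTransitive h hT with ⟨rfl, hq⟩ | ⟨rfl, hq⟩ | ⟨rfl, hm, hq⟩ | ⟨rfl, rfl⟩ |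
    ⟨rfl, rfl, a, b, ha, hb, hab⟩
  · exact ⟨rfl, hq⟩
  · exact absurd hT (not_twoArcTransitive_of_three h hq)
  · exact absurd hT (not_twoArcTransitive_of_four h hm hq)
  · refine ⟨rfl, by_contra fun hq => ?_⟩
    have h4 : IsSign ((r : ZMod n) ^ 4) := by
      rcases h.2.2.2.2.2 with e | e
      · left; simpa using congrArg Units.val e
      · right; simpa using congrArg Units.val e
    have h1 : 1 + -((r : ZMod n) ^ 4) * ((r : ZMod n) ^ 2) ^ 2 = 0 := by
      linear_combination -h4.mul_self
    refine not_twoArcTransitive_of_two h (Or.inl rfl) hq ?_ h4.neg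
      (by rw [h1, zero_mul]) (by rw [h1, zero_mul]) hT
    rcases h4 with e | e
    · left; linear_combination 2 * e
    · right; linear_combination 2 * e
  · refine ⟨rfl, by_contra fun hq => ?_⟩
    rcases hb with rfl | rfl
    · exact not_twoArcTransitive_of_two_four h hq ha (by rw [← hab]; ring) hT
    · have hab' : (1 + a * (r : ZMod n) ^ 2) * (1 - ((r : ZMod n) ^ 2) ^ 2) = 0 := by
        rw [← hab]; ring
      have haa := ha.mul_self
      have h8 : IsSign ((r : ZMod n) ^ 8) := by
        rcases h.2.2.2.2.2 with e | e
        · left; simpa using congrArg Units.val e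
        · right; simpa using congrArg Units.val e
      have hq4 : ((r : ZMod n) ^ 2) ^ 4 = 1 := by
        rcases h8 with e | e
        · rw [← e]; ring
        · exfalso
          have e1 : 2 * (1 + a * (r : ZMod n) ^ 2) = 0 := by
            linear_combination (1 + ((r : ZMod n) ^ 2) ^ 2) * hab' +
              (1 + a * (r : ZMod n) ^ 2) * e
          rcases ha with rfl | rfl
          · exact hq (Or.inr (by linear_combination e1))
          · exact hq (Or.inl (by linear_combination -e1))
      have hq2 : 2 * ((r : ZMod n) ^ 2) ^ 2 = 2 := by
        linear_combination (a * (r : ZMod n) ^ 2 - 1) * hab' +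
          (((r : ZMod n) ^ 2) ^ 4 - ((r : ZMod n) ^ 2) ^ 2) * haa + hq4
      have hab2 : (1 - a * (r : ZMod n) ^ 2) * (1 - ((r : ZMod n) ^ 2) ^ 2) = 0 := by
        linear_combination hab' + a * (r : ZMod n) ^ 2 * hq2
      refine not_twoArcTransitive_of_two h (Or.inr rfl) hq (Or.inl hq2) IsSign.neg_one ?_ ?_ hT
      · rcases ha with rfl | rfl
        · linear_combination hab'
        · linear_combination hab2
      · rcases ha with rfl | rfl
        · linear_combination hab2
        · linear_combination hab'

/-! ### Parameters with `2 r ^ 2 = ± 2` -/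

/-- If `r ^ 2 = ± 1` and `m = 2`, then two steps up extend to a closed walk `u ^ 4`. However, a peak
lies on no closed walk of length `4` without backtracking. -/
theorem not_isSign_of_twoArcTransitive {n : ℕ} {r : (ZMod n)ˣ} (h : CPMAssumption 2 2 n r)
    (hT : IsTwoArcTransitive (CPM 2 2 n r)) : ¬ IsSign ((r : ZMod n) ^ 2) := by
  intro hq
  have hE : ∀ k : ℤ, (stepVec r (k + 4) : Fin 2 → ZMod n) = stepVec r k := by
    intro k
    have e1 := stepVec_two_add r k
    have e2 := stepVec_two_add r (k + 2)
    rw [add_assoc, e1, smul_smul, hq.mul_self, one_smul] at e2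
    exact e2
  obtain ⟨x, hx, hp⟩ := arcCloses_of_word h (L := 4) (by norm_num) (fun _ => true)
    (fun i => [1, 1, -(r : ZMod n) ^ 2, -(r : ZMod n) ^ 2, 1].getD i 1)
    (fun i _ => isSign_getD _ (by simp [hq.neg, IsSign.one]) i)
    (by intro i hi; simp)
    (by
      intro k
      have e2 := stepVec_two_add r k
      have e3 := stepVec_two_add r (k + 1)
      simp only [add_assoc] at e3
      norm_num at e3
      simp only [Finset.sum_range_succ, bot, lev, List.getD_cons_zero, List.getD_cons_succ,
          if_true, add_assoc, Finset.sum_range_zero]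
      norm_num
      rw [e3, e2, smul_smul, smul_smul, hq.mul_self]
      module)
    (by simp [lev]) rfl
    (by
      intro k
      simp only [bot, lev, List.getD_cons_zero, List.getD_cons_succ, if_true, add_assoc]
      norm_num
      exact hE k) 0 0 origin_mem
  obtain ⟨z, hz⟩ := exists_zigzag h
  have a0 := hx 0
  have a1 := hx 1
  norm_num at a0 a1
  obtain ⟨φ, e0, e1, e2⟩ := hT _ _ _ _ _ _ (⟨a0.1, a1.1, a0.2⟩ : IsTwoArc _ _ _ _)
    (zigzag_twoArc h hz 0)
  have hy := (hx.map φ).val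
  obtain ⟨u, c, hw, hu, -⟩ := hy.exists_word h (pt_val_cast h _).symm
  have u0 := hu 0
  have u1 := hu 1
  norm_num at u0 u1
  rw [e0, e1, hz, hz, (zigzag_succ h _).2] at u0
  rw [e1, e2, hz, hz, (zigzag_succ h _).2] at u1
  norm_num at u0 u1
  have hl := hw.level
  have t0 := hw.turn 0
  have t1 := hw.turn 1
  have t2 := hw.turn 2
  have hcl := hw.closing 0
  have hs := isUnit_of_isSign (hw.sign 0)
  cases u2 : u 2 <;> cases u3 : u 3
  · simp [lev, u0, u1, u2, u3] at hl
  · simp [lev, bot, u0, u1, u2, u3, Finset.sum_range_succ] at t0 hcl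
    rw [← t0] at hcl
    refine two_ne_zero_of h.2.1 (hs.mul_left_eq_zero.1 ?_)
    linear_combination hcl
  · simp [lev, bot, u0, u1, u2, u3, Finset.sum_range_succ] at t0 t1 t2 hcl
    rw [← t2, ← t1, ← t0] at hcl
    refine four_ne_zero_of h.2.1 h.2.2.1 (hs.mul_left_eq_zero.1 ?_)
    linear_combination hcl
  · simp [lev, u0, u1, u2, u3] at hl

/-- The zigzag closes up after `N` steps, if `N` is a multiple of `2` and of `n`. -/
theorem zigzag_closed {m s n : ℕ} {r : (ZMod n)ˣ} (h : CPMAssumption m s n r) {N : ℕ} [NeZero N]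
    (h2 : 2 ∣ N) (hn : n ∣ N) {z : ℕ → (CPMbar m s n r).connectedComponentMk (0, 0)}
    (hz : ∀ i, (z i).1 = zigzag m r i) :
    IsClosedNB (CPM m s n r) N (fun i : ZMod N => z i.val) ∧
      turnCount (fun i : ZMod N => (z i.val).1) = N := by
  have hmod : ∀ j : ℕ, z ((j : ZMod N).val) = z j := by
    intro j
    apply Subtype.ext
    rw [hz, hz, ZMod.val_natCast]
    have := (zigzag_eq_iff h (j % N) (N * (j / N))).2
      ⟨Dvd.dvd.mul_right h2 _, Dvd.dvd.mul_right hn _⟩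
    rw [Nat.mod_add_div] at this
    exact this.symm
  have hs : ∀ i : ZMod N, ∀ j : ℕ, z ((i + j).val) = z (i.val + j) := by
    intro i j
    have := hmod (i.val + j)
    rwa [Nat.cast_add, ZMod.natCast_zmod_val] at this
  have hs1 : ∀ i : ZMod N, z ((i + 1).val) = z (i.val + 1) := fun i => by
    simpa using hs i 1
  have hs2 : ∀ i : ZMod N, z ((i + 2).val) = z (i.val + 2) := fun i => by
    simpa using hs i 2
  constructor
  · intro i
    simp only [hs1, hs2]
    exact ⟨(zigzag_walk h hz).1 _, (zigzag_walk h hz).2 _⟩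
  · rw [turnCount_eq, Finset.filter_true_of_mem, Finset.card_univ, ZMod.card]
    intro i _
    simp only [add_assoc, one_add_one_eq_two, hs1, hs2]
    rw [hz, hz, hz, (zigzag_succ h _).2, (zigzag_succ h _).2]
    rcases Nat.mod_two_eq_zero_or_one i.val with h0 | h0
    · simp [h0, show (i.val + 1) % 2 = 1 by omega]
    · simp [h0, show (i.val + 1) % 2 = 0 by omega]

theorem const_of_few_turns_six : ∀ δ : ZMod 6 → Bool,
    3 * (Finset.univ.filter fun i => δ i ≠ δ (i + 1)).card < 6 → ∀ i, δ i = δ 0 := by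
  decide +kernel

/-- For `n = 6` every closed walk of length `6` without backtracking has at least two turns, so that by
averaging it has exactly two; but the zigzag is such a walk with six turns. -/
theorem not_twoArcTransitive_of_six {m : ℕ} {r : (ZMod 6)ˣ} (h : CPMAssumption m 2 6 r) :
    ¬ IsTwoArcTransitive (CPM m 2 6 r) := by
  intro hT
  obtain ⟨z, hz⟩ := exists_zigzag h
  obtain ⟨hcl, hcount⟩ := zigzag_closed h (N := 6) (by norm_num) dvd_rfl hz
  have hr : r ^ 2 = 1 := by
    have : ∀ r : (ZMod 6)ˣ, r ^ 2 = 1 := by decide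
    exact this r
  have hzpow : ∀ j : ℤ, r ^ (2 * j) = 1 := by
    intro j
    rw [zpow_mul]
    have : r ^ (2 : ℤ) = 1 := by exact_mod_cast hr
    rw [this, one_zpow]
  have hsigns : ∀ a b c : ZMod 6, IsSign a → IsSign b → IsSign c → a + b + c ≠ 0 := by
    unfold IsSign; decide
  have hle : ∀ x : ZMod 6 → (CPMbar m 2 6 r).connectedComponentMk (0, 0),
      IsClosedNB (CPM m 2 6 r) 6 x → 6 ≤ 3 * turnCount fun i => (x i).1 := by
    intro x hx
    by_contra hlt
    rw [turnCount_eq, not_le] at hlt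
    have hconst := const_of_few_turns_six _ hlt
    obtain ⟨u, c, hw, hu, -⟩ := hx.val.exists_word h (pt_val_cast h _).symm
    have hu' : ∀ i : ℕ, u i = u 0 := fun i => by
      rw [hu, hu]
      have := hconst (i : ZMod 6)
      simp only [Nat.cast_zero] at this ⊢
      exact this
    have e := hw.closing (bot u 0 0)
    have z1 := hzpow 1
    have z2 := hzpow 2
    have z3 := hzpow (-1)
    have z4 := hzpow (-2)
    norm_num at z1 z2 z3 z4
    refine hsigns (c 0) (c 2) (c 4) (hw.sign 0) (hw.sign 2) (hw.sign 4) ?_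
    cases h0 : u 0
    · simpa [Finset.sum_range_succ, bot, lev, hu' 1, hu' 2, hu' 3, hu' 4, hu' 5, h0, z3, z4]
        using e
    · simpa [Finset.sum_range_succ, bot, lev, hu' 1, hu' 2, hu' 3, hu' 4, hu' 5, h0, z1, z2]
        using e
  have := three_mul_turnCount_eq h hT hle _ hcl
  rw [hcount] at this
  omega

theorem eq_three_or_six_of {n : ℕ} (hn : 3 ≤ n) (h6 : (6 : ZMod n) = 0) : n = 3 ∨ n = 6 := by
  have hd : n ∣ 6 := dvd_of_natCast_eq_zero (by exact_mod_cast h6)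
  have := Nat.le_of_dvd (by norm_num) hd
  interval_cases n <;> omega

theorem exists_sign_of_two_mul {n : ℕ} {q : ZMod n} (h : 2 * q = 2 ∨ 2 * q = -2) :
    ∃ κ : ZMod n, IsSign κ ∧ 2 * q = 2 * κ := by
  rcases h with e | e
  · exact ⟨1, IsSign.one, by rw [e]; ring⟩
  · exact ⟨-1, IsSign.neg_one, by rw [e]; ring⟩

/-- The hexagons `u u d d d u`. -/
theorem arcCloses_uud {m n : ℕ} {r : (ZMod n)ˣ} (h : CPMAssumption m 2 n r) {κ : ZMod n}
    (hκ : IsSign κ) (hq : 2 * (r : ZMod n) ^ 2 = 2 * κ) {α β : ZMod n} (hα : IsSign α)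
    (hβ : IsSign β) : ArcCloses (s := 2) m r 6 true true false α β β := by
  refine arcCloses_of_word h (by norm_num)
    (fun i => [true, true, false, false, false, true, true].getD i true)
    (fun i => [α, β, β, -α, -κ * β, -κ * β, α].getD i 1)
    (fun i _ => isSign_getD _ (by simp [hα, hβ, hα.neg, (hκ.mul hβ).neg]) i)
    (by intro i hi; interval_cases i <;> simp) ?_ (by simp [lev]) (by simp)
    (by intro k; simp [bot, lev])
  intro k
  have e1 := stepVec_two_add r (k - 1)
  rw [show k - 1 + 2 = k + 1 by ring] at e1
  simp [Finset.sum_range_succ, bot, lev]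
  rw [e1, ← sub_eq_add_neg k 1]
  have : ∀ x y : Fin 2 → ZMod n, α • x + β • (r : ZMod n) ^ 2 • y + β • (r : ZMod n) ^ 2 • y +
      -(α • x) + -((κ * β) • y) + -((κ * β) • y) =
      (β * (2 * (r : ZMod n) ^ 2 - 2 * κ)) • y := by
    intro x y; module
  rw [this, hq, sub_self, mul_zero, zero_smul]

/-- The hexagons `u u u d d d`. -/
theorem arcCloses_uuu {m n : ℕ} {r : (ZMod n)ˣ} (h : CPMAssumption m 2 n r) {κ : ZMod n}
    (hκ : IsSign κ) (hq : 2 * (r : ZMod n) ^ 2 = 2 * κ) {α β : ZMod n} (hα : IsSign α)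
    (hβ : IsSign β) : ArcCloses (s := 2) m r 6 true true true α β (-κ * α) := by
  refine arcCloses_of_word h (by norm_num)
    (fun i => [true, true, true, false, false, false, true].getD i true)
    (fun i => [α, β, -κ * α, -κ * α, -β, α, α].getD i 1)
    (fun i _ => isSign_getD _ (by simp [hα, hβ, hβ.neg, (hκ.mul hα).neg]) i)
    (by intro i hi; interval_cases i <;> simp) ?_ (by simp [lev]) (by simp)
    (by intro k; simp [bot, lev])
  intro k
  have e1 := stepVec_two_add r k
  simp [Finset.sum_range_succ, bot, lev, add_assoc]
  rw [show k + 3 - 1 = k + 2 by ring, show k + 2 - 1 = k + 1 by ring, e1]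
  have : ∀ x y : Fin 2 → ZMod n, α • x + (β • y + (-((κ * α) • (r : ZMod n) ^ 2 • x) +
      (-((κ * α) • (r : ZMod n) ^ 2 • x) + (-(β • y) + α • x)))) =
      (α * (2 - κ * (2 * (r : ZMod n) ^ 2))) • x := by
    intro x y; module
  have e : 2 - κ * (2 * κ) = 0 := by linear_combination -2 * hκ.mul_self
  rw [this, hq, e, mul_zero, zero_smul]

/-- The hexagons `u d d d u u`. -/
theorem arcCloses_udd {m n : ℕ} {r : (ZMod n)ˣ} (h : CPMAssumption m 2 n r) {κ : ZMod n}
    (hκ : IsSign κ) (hq : 2 * (r : ZMod n) ^ 2 = 2 * κ) {α β : ZMod n} (hα : IsSign α)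
    (hβ : IsSign β) : ArcCloses (s := 2) m r 6 true false false α α β := by
  refine arcCloses_of_word h (by norm_num)
    (fun i => [true, false, false, false, true, true, true].getD i true)
    (fun i => [α, α, β, -κ * α, -κ * α, -β, α].getD i 1)
    (fun i _ => isSign_getD _ (by simp [hα, hβ, hβ.neg, (hκ.mul hα).neg]) i)
    (by intro i hi; interval_cases i <;> simp) ?_ (by simp [lev]) (by simp)
    (by intro k; simp [bot, lev])
  intro k
  have e1 := stepVec_two_add r (k - 2)
  rw [show k - 2 + 2 = k by ring] at e1
  have e2 : k + -1 + -1 = k - 2 := by ring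
  simp [Finset.sum_range_succ, bot, lev, e2, sub_eq_add_neg]
  simp only [← sub_eq_add_neg]
  rw [show k - 2 + 1 = k - 1 by ring, e1]
  have : ∀ x y : Fin 2 → ZMod n, α • (r : ZMod n) ^ 2 • x + α • (r : ZMod n) ^ 2 • x + β • y -
      (κ * α) • x - (κ * α) • x - β • y = (α * (2 * (r : ZMod n) ^ 2 - 2 * κ)) • x := by
    intro x y; module
  rw [this, hq, sub_self, mul_zero, zero_smul]

/-- The hexagons `d u u u d d`. -/
theorem arcCloses_duu {m n : ℕ} {r : (ZMod n)ˣ} (h : CPMAssumption m 2 n r) {κ : ZMod n}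
    (hκ : IsSign κ) (hq : 2 * (r : ZMod n) ^ 2 = 2 * κ) {α β : ZMod n} (hα : IsSign α)
    (hβ : IsSign β) : ArcCloses (s := 2) m r 6 false true true α α β := by
  refine arcCloses_of_word h (by norm_num)
    (fun i => [false, true, true, true, false, false, false].getD i true)
    (fun i => [α, α, β, -κ * α, -κ * α, -β, α].getD i 1)
    (fun i _ => isSign_getD _ (by simp [hα, hβ, hβ.neg, (hκ.mul hα).neg]) i)
    (by intro i hi; interval_cases i <;> simp) ?_ (by simp [lev]) (by simp)
    (by intro k; simp [bot, lev])
  intro k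
  have e1 := stepVec_two_add r (k - 1)
  rw [show k - 1 + 2 = k + 1 by ring] at e1
  simp [Finset.sum_range_succ, bot, lev]
  rw [e1, ← sub_eq_add_neg k 1]
  have : ∀ x y : Fin 2 → ZMod n, α • x + α • x + β • y + -((κ * α) • (r : ZMod n) ^ 2 • x) +
      -((κ * α) • (r : ZMod n) ^ 2 • x) + -(β • y) =
      (α * (2 - κ * (2 * (r : ZMod n) ^ 2))) • x := by
    intro x y; module
  have e : 2 - κ * (2 * κ) = 0 := by linear_combination -2 * hκ.mul_self
  rw [this, hq, e, mul_zero, zero_smul]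

/-- The alternating hexagons, which exist for `6 = 0` only. -/
theorem arcCloses_udu {m n : ℕ} {r : (ZMod n)ˣ} (h : CPMAssumption m 2 n r)
    (h6 : (6 : ZMod n) = 0) {α : ZMod n} (hα : IsSign α) :
    ArcCloses (s := 2) m r 6 true false true α α α := by
  refine arcCloses_of_word h (by norm_num)
    (fun i => [true, false, true, false, true, false, true].getD i true) (fun _ => α)
    (fun i _ => hα) (by intro i hi _; rfl) ?_ (by simp [lev]) (by simp)
    (by intro k; simp [bot, lev])
  intro k
  simp [Finset.sum_range_succ, bot, lev]
  have : ∀ x : Fin 2 → ZMod n, α • x + α • x + α • x + α • x + α • x + α • x =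
      (6 * α) • x := by
    intro x; module
  rw [this, h6, zero_mul, zero_smul]

/-- Alternating 3-arcs lie on no hexagon, unless `6 = 0` in `ZMod n`. -/
theorem alternating_not_onClosed_six {m n : ℕ} {r : (ZMod n)ˣ} (h : CPMAssumption m 2 n r)
    (hT : IsTwoArcTransitive (CPM m 2 n r)) (h6 : (6 : ZMod n) ≠ 0)
    (a b c d : ZMod (m * 2) × (Fin 2 → ZMod n)) (hab : goesUp a b ≠ goesUp b c)
    (hbc : goesUp b c ≠ goesUp c d) : ¬ OnClosed (CPMbar m 2 n r) 6 a b c d := by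
  have hm : 2 ≤ m := by have := h.2.2.2.2.1; omega
  have hB : m = 2 → ∀ a b : ZMod n, IsSign a → IsSign b → a + b * (r : ZMod n) ^ 2 ≠ 0 := by
    rintro rfl a b ha hb e
    exact not_isSign_of_twoArcTransitive h hT (isSign_of_add_mul ha hb e)
  exact alternating_not_onClosed h (by exact_mod_cast h6) alternating_or_pattern_six
    (fun u c hw => no_uudu_two_six h.2.1 h.2.2.1 hm hB hw)
    (fun u c hw => no_uduu_two_six h.2.1 hm hB hw) hab hbc

/-- If `n` is even, a straight line as long as the zigzag closes up only for `r ^ 2 ≠ κ`, which leaves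
`r ^ 2 = κ (1 + n / 2)`; then `4 ∣ n` as `r` is a unit, and `2 ∣ m` by the assumption on
`r ^ (2 m)`. -/
theorem params_of_twoArcTransitive {m n : ℕ} {r : (ZMod n)ˣ} (h : CPMAssumption m 2 n r)
    (hT : IsTwoArcTransitive (CPM m 2 n r)) : ∃ κ : ZMod n, IsSign κ ∧
      2 * (r : ZMod n) ^ 2 = 2 * κ ∧ (n % 2 = 1 ∧ (r : ZMod n) ^ 2 = κ ∨
        4 ∣ n ∧ 2 ∣ m ∧ (r : ZMod n) ^ 2 = κ * (1 + (n / 2 : ℕ))) := by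
  have hn := h.2.1
  have hn4 := h.2.2.1
  obtain ⟨κ, hκ, hqκ⟩ := exists_sign_of_two_mul (two_mul_sq_of_twoArcTransitive h hT).2
  refine ⟨κ, hκ, hqκ, ?_⟩
  rcases Nat.even_or_odd' n with ⟨N, hN | hN⟩
  · right
    have : NeZero n := ⟨by omega⟩
    have h2N : (2 * N : ZMod n) = 0 := by
      have := ZMod.natCast_self n
      rw [hN] at this ⊢
      exact_mod_cast this
    have hN0 : (N : ZMod n) ≠ 0 := by
      rw [Ne, ZMod.natCast_eq_zero_iff]
      intro hd
      have := Nat.le_of_dvd (by omega) hd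
      omega
    have h6 : (6 : ZMod n) ≠ 0 := by
      intro h6
      rcases eq_three_or_six_of hn h6 with rfl | rfl
      · omega
      · exact not_twoArcTransitive_of_six h hT
    have hsum := geom_sum_eq_zero_of_twoArcTransitive h hT (M := N)
      (alternating_not_onClosed_six h hT h6) hκ (fun α β => arcCloses_uud h hκ hqκ)
      (fun α β => arcCloses_uuu h hκ hqκ) (by rw [hN])
    -- if `r ^ 2 = κ`, all `N` terms of the geometric sum are `1`
    have hne : (r : ZMod n) ^ 2 ≠ κ := by
      intro e
      rw [e, hκ.mul_self] at hsum
      apply hN0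
      simpa using hsum
    have hcases : ∀ x : ZMod n, 2 * x = 0 → x = 0 ∨ x = N := by
      intro x hx
      obtain ⟨t, ht, rfl⟩ : ∃ t : ℕ, t < n ∧ (t : ZMod n) = x :=
        ⟨x.val, ZMod.val_lt x, ZMod.natCast_zmod_val x⟩
      have : n ∣ 2 * t := by
        rw [← ZMod.natCast_eq_zero_iff]
        exact_mod_cast hx
      obtain ⟨w, hw⟩ := this
      have : w < 2 := by
        by_contra hw2
        have := Nat.mul_le_mul_left n (not_lt.1 hw2)
        omega
      interval_cases w
      · left
        have : t = 0 := by omega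
        rw [this, Nat.cast_zero]
      · right
        have : t = N := by omega
        rw [this]
    have hκN : κ * N = N := by
      rcases hκ with rfl | rfl
      · rw [one_mul]
      · linear_combination -h2N
    have hqN : (r : ZMod n) ^ 2 = κ * (1 + N) := by
      rcases hcases ((r : ZMod n) ^ 2 - κ) (by linear_combination hqκ) with e | e
      · exact absurd (sub_eq_zero.1 e) hne
      · linear_combination e - hκN
    have hN2 : n / 2 = N := by omega
    rw [hN2]
    have hNeven : 2 ∣ N := by
      by_contra hodd
      -- otherwise `r ^ 2` would be even
      have h2n : 2 ∣ n := ⟨N, hN⟩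
      have hu : IsUnit (ZMod.castHom h2n (ZMod 2) ((r : ZMod n) ^ 2)) :=
        ((r.isUnit).pow 2).map _
      have hN1 : ((N : ℕ) : ZMod 2) = 1 := by
        rw [ZMod.natCast_eq_one_iff_odd]
        exact Nat.not_even_iff_odd.1 (fun e => hodd e.two_dvd)
      rw [hqN, map_mul, map_add, map_one, map_natCast, hN1, CharTwo.add_self_eq_zero,
        mul_zero] at hu
      exact not_isUnit_zero hu
    refine ⟨by obtain ⟨w, hw⟩ := hNeven; exact ⟨w, by omega⟩, ?_, hqN⟩
    by_contra hmodd
    have hmo : Odd m := by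
      rw [← Nat.not_even_iff_odd]
      exact fun e => hmodd e.two_dvd
    obtain ⟨M, hM⟩ := hmo
    -- as `(1 + N) ^ 2 = 1`, odd `m` would lead to `1 + N = ± 1`
    have hNN : (N : ZMod n) * N = 0 := by
      obtain ⟨w, hw⟩ := hNeven
      have : (N : ZMod n) = 2 * w := by rw [hw]; push_cast; ring
      calc (N : ZMod n) * N = (2 * N) * w := by linear_combination (N : ZMod n) * this
        _ = 0 := by rw [h2N, zero_mul]
    have hsq : (1 + (N : ZMod n)) ^ 2 = 1 := by linear_combination hNN + h2N
    have hκ2 : κ ^ 2 = 1 := by rw [sq]; exact hκ.mul_self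
    have hqm : ((r : ZMod n) ^ 2) ^ m = κ * (1 + N) := by
      rw [hqN, hM, pow_succ, pow_mul, mul_pow, hsq, hκ2, one_mul, one_pow, one_mul]
    have hsign : IsSign (((r : ZMod n) ^ 2) ^ m) := by
      rw [← pow_mul, mul_comm]
      rcases h.2.2.2.2.2 with e | e
      · left; simpa using congrArg Units.val e
      · right; simpa using congrArg Units.val e
    rw [hqm] at hsign
    have hs := hκ.mul hsign
    rw [← mul_assoc, hκ.mul_self, one_mul] at hs
    rcases hs with e | e
    · exact hN0 (by linear_combination e)
    · have : ((N + 2 : ℕ) : ZMod n) = 0 := by push_cast; linear_combination e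
      have := Nat.le_of_dvd (by omega) ((ZMod.natCast_eq_zero_iff _ _).1 this)
      omega
  · left
    refine ⟨by omega, ?_⟩
    have h2 : ((2 : ZMod n)) * (N + 1) = 1 := by
      have := ZMod.natCast_self n
      rw [hN] at this ⊢
      push_cast at this
      linear_combination this
    linear_combination (N + 1 : ZMod n) * hqκ + (κ - (r : ZMod n) ^ 2) * h2

/-! ### Isomorphisms preserve `n` -/

theorem exists_map_twoArc_eq {V W : Type*} {G : SimpleGraph V} {H : SimpleGraph W} (ψ : G ≃g H)
    (hT : IsTwoArcTransitive H) {a b c : V} (habc : IsTwoArc G a b c) {a' b' c' : W}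
    (habc' : IsTwoArc H a' b' c') : ∃ φ : G ≃g H, φ a = a' ∧ φ b = b' ∧ φ c = c' := by
  obtain ⟨φ, h1, h2, h3⟩ := hT (ψ a) (ψ b) (ψ c) a' b' c'
    ⟨ψ.map_adj_iff.2 habc.1, ψ.map_adj_iff.2 habc.2.1, fun e => habc.2.2 (ψ.injective e)⟩ habc'
  exact ⟨ψ.trans φ, h1, h2, h3⟩

/-- If `6 = 0` in `ZMod n`, then all 3-arcs that start with a peak lie on hexagons. -/
theorem onClosed_of_six_eq_zero {m n : ℕ} {r : (ZMod n)ˣ} (h : CPMAssumption m 2 n r)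
    (hT : IsTwoArcTransitive (CPM m 2 n r)) (h6 : (6 : ZMod n) = 0)
    {z : ℕ → (CPMbar m 2 n r).connectedComponentMk (0, 0)} (hz : ∀ i, (z i).1 = zigzag m r i)
    {f : ℕ → (CPMbar m 2 n r).connectedComponentMk (0, 0)}
    (hadj : ∀ i, (CPM m 2 n r).Adj (f i) (f (i + 1))) (hnb : ∀ i, f i ≠ f (i + 2))
    (h0 : f 0 = z 0) (h1 : f 1 = z 1) (h2 : f 2 = z 2) :
    OnClosed (CPM m 2 n r) 6 (f 0) (f 1) (f 2) (f 3) := by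
  obtain ⟨κ, hκ, hq⟩ := exists_sign_of_two_mul (two_mul_sq_of_twoArcTransitive h hT).2
  obtain ⟨u, c, hc, ht, hp, hu⟩ := exists_eq_path h (f := fun i => (f i).1)
    (fun i => CPM_adj.1 (hadj i)) (fun i e => hnb i (Subtype.ext e)) (pt_val_cast h _).symm
  have u0 : u 0 = true := by rw [hu, h0, h1, hz, hz, (zigzag_succ h _).2]; rfl
  have u1 : u 1 = false := by rw [hu, h1, h2, hz, hz, (zigzag_succ h _).2]; rfl
  have c1 := ht 0 (by rw [u0, u1]; decide)
  refine ArcCloses.onClosed hp ?_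
  simp only [zero_add] at c1 ⊢
  cases u2 : u 2
  · rw [u0, u1, ← c1]
    exact arcCloses_udd h hκ hq (hc 0) (hc 2)
  · have c2 := ht 1 (by rw [u1, u2]; decide)
    rw [u0, u1, ← c2, ← c1]
    exact arcCloses_udu h h6 (hc 0)

/-- Whether all 3-arcs lie on hexagons is an isomorphism invariant; it separates the case `6 = 0`. -/
theorem six_eq_zero_of_iso {m n m' n' : ℕ} {r : (ZMod n)ˣ} {r' : (ZMod n')ˣ}
    (h : CPMAssumption m 2 n r) (h' : CPMAssumption m' 2 n' r')
    (hT : IsTwoArcTransitive (CPM m 2 n r)) (hT' : IsTwoArcTransitive (CPM m' 2 n' r'))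
    (ψ : CPM m' 2 n' r' ≃g CPM m 2 n r) (h6 : (6 : ZMod n) = 0) : (6 : ZMod n') = 0 := by
  by_contra h6'
  obtain ⟨z, hz⟩ := exists_zigzag h
  obtain ⟨z', hz'⟩ := exists_zigzag h'
  obtain ⟨φ, e0, e1, e2⟩ := exists_map_twoArc_eq ψ hT (zigzag_twoArc h' hz' 0)
    (zigzag_twoArc h hz 0)
  refine zigzag_not_onClosed h' (alternating_not_onClosed_six h' hT' h6') hz' 0
    ((onClosed_map_iff φ).1 ?_)
  exact onClosed_of_six_eq_zero h hT h6 hz (f := fun i => φ (z' i))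
    (fun i => φ.map_adj_iff.2 ((zigzag_walk h' hz').1 i))
    (fun i e => (zigzag_walk h' hz').2 i (φ.injective e)) e0 e1 e2

/-- If no 3-arc of the walk `f` lies on a hexagon, and `f` starts like the zigzag, then it is the
zigzag. -/
theorem eq_zigzag_of_not_onClosed {m n : ℕ} {r : (ZMod n)ˣ} (h : CPMAssumption m 2 n r)
    (hT : IsTwoArcTransitive (CPM m 2 n r))
    {z : ℕ → (CPMbar m 2 n r).connectedComponentMk (0, 0)} (hz : ∀ i, (z i).1 = zigzag m r i)
    {f : ℕ → (CPMbar m 2 n r).connectedComponentMk (0, 0)}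
    (hadj : ∀ i, (CPM m 2 n r).Adj (f i) (f (i + 1))) (hnb : ∀ i, f i ≠ f (i + 2))
    (hno : ∀ i, ¬ OnClosed (CPM m 2 n r) 6 (f i) (f (i + 1)) (f (i + 2)) (f (i + 3)))
    (h0 : f 0 = z 0) (h1 : f 1 = z 1) (h2 : f 2 = z 2) (i : ℕ) : f i = z i := by
  obtain ⟨κ, hκ, hq⟩ := exists_sign_of_two_mul (two_mul_sq_of_twoArcTransitive h hT).2
  obtain ⟨u, c, hc, ht, hp, hu⟩ := exists_eq_path h (f := fun i => (f i).1)
    (k := 0) (v := 0)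
    (fun i => CPM_adj.1 (hadj i)) (fun i e => hnb i (Subtype.ext e))
    (by simp only [h0, hz]; simp [zigzag])
  have u0 : u 0 = true := by rw [hu, h0, h1, hz, hz, (zigzag_succ h _).2]; rfl
  have u1 : u 1 = false := by rw [hu, h1, h2, hz, hz, (zigzag_succ h _).2]; rfl
  have halt : ∀ i, u i ≠ u (i + 1) := by
    intro i
    induction i with
    | zero => rw [u0, u1]; decide
    | succ i ih =>
      intro e
      have c1 := ht i ih
      refine hno i (ArcCloses.onClosed hp ?_)
      rw [show i + 2 = i + 1 + 1 by ring, ← e, ← c1]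
      cases k0 : u i <;> cases k1 : u (i + 1)
      · exact absurd (k0.trans k1.symm) ih
      · exact arcCloses_duu h hκ hq (hc i) (hc _)
      · exact arcCloses_udd h hκ hq (hc i) (hc _)
      · exact absurd (k0.trans k1.symm) ih
  have hall : ∀ i, u i = decide (i % 2 = 0) ∧ bot u 0 i = 0 ∧ c i = c 0 := by
    intro i
    induction i with
    | zero => exact ⟨u0, by simp [bot, u0, lev], rfl⟩
    | succ i ih =>
      refine ⟨?_, (bot_succ_of_turn (halt i)).trans ih.2.1, (ht i (halt i)).symm.trans ih.2.2⟩
      have := halt i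
      rw [ih.1] at this
      rcases Nat.mod_two_eq_zero_or_one i with e | e
      · simp [e] at this
        simp [this, show (i + 1) % 2 = 1 by omega]
      · simp [e] at this
        simp [this, show (i + 1) % 2 = 0 by omega]
  have hlev : ∀ i, lev u 0 i = ((i % 2 : ℕ) : ℤ) := by
    intro i
    obtain ⟨a, b, -⟩ := hall i
    rcases Nat.mod_two_eq_zero_or_one i with e | e
    · simpa [bot, a, e] using b
    · simp [bot, a, e] at b
      rw [e]
      push_cast
      omega
  have hpos : ∀ i : ℕ, pos r u c 0 (0 : Fin 2 → ZMod n) i = ((i : ZMod n) * c 0) • stepVec r 0 := by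
    intro i
    rw [pos, Finset.sum_congr rfl fun j _ => by rw [(hall j).2.1, (hall j).2.2],
      Finset.sum_const, Finset.card_range, zero_add, mul_smul, Nat.cast_smul_eq_nsmul]
  have hc0 : c 0 = 1 := by
    have e : (f 1).1 = path m r u c 0 0 1 := hp 1
    rw [h1, hz] at e
    have e1 := stepVec_smul_injective h 0 ((congrArg Prod.snd e).trans (hpos 1))
    simpa using e1.symm
  apply Subtype.ext
  have e : (f i).1 = path m r u c 0 0 i := hp i
  rw [e, hz, path, zigzag, hlev, hpos, hc0, mul_one]

/-- Zigzags are the walks without 3-arcs on hexagons that start with a peak, so that an isomorphism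
can be chosen to map the zigzag to the zigzag. Hence their periods agree. -/
theorem zigzag_period_of_iso {m n m' n' : ℕ} {r : (ZMod n)ˣ} {r' : (ZMod n')ˣ}
    (h : CPMAssumption m 2 n r) (h' : CPMAssumption m' 2 n' r')
    (hT : IsTwoArcTransitive (CPM m 2 n r)) (hT' : IsTwoArcTransitive (CPM m' 2 n' r'))
    (ψ : CPM m' 2 n' r' ≃g CPM m 2 n r) (h6' : (6 : ZMod n') ≠ 0) (N : ℕ) :
    2 ∣ N ∧ n' ∣ N ↔ 2 ∣ N ∧ n ∣ N := by
  obtain ⟨z, hz⟩ := exists_zigzag h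
  obtain ⟨z', hz'⟩ := exists_zigzag h'
  obtain ⟨φ, e0, e1, e2⟩ := exists_map_twoArc_eq ψ hT (zigzag_twoArc h' hz' 0)
    (zigzag_twoArc h hz 0)
  have key := eq_zigzag_of_not_onClosed h hT hz (f := fun i => φ (z' i))
    (fun i => φ.map_adj_iff.2 ((zigzag_walk h' hz').1 i))
    (fun i e => (zigzag_walk h' hz').2 i (φ.injective e))
    (fun i e => zigzag_not_onClosed h' (alternating_not_onClosed_six h' hT' h6') hz' i
      ((onClosed_map_iff φ).1 e)) e0 e1 e2
  rw [← zigzag_eq_iff (s := 2) h' 0 N, ← zigzag_eq_iff (s := 2) h 0 N, zero_add, ← hz, ← hz,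
    ← hz', ← hz', Subtype.val_inj, Subtype.val_inj, ← key, ← key]
  exact φ.injective.eq_iff.symm

/-- The period of the zigzag, the least common multiple of `2` and `n`, determines `n`, because `n` is
odd or a multiple of `4`. -/
theorem n_eq_of_iso {m n m' n' : ℕ} {r : (ZMod n)ˣ} {r' : (ZMod n')ˣ}
    (h : CPMAssumption m 2 n r) (h' : CPMAssumption m' 2 n' r')
    (hT : IsTwoArcTransitive (CPM m 2 n r)) (hT' : IsTwoArcTransitive (CPM m' 2 n' r'))
    (ψ : CPM m' 2 n' r' ≃g CPM m 2 n r) : n' = n := by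
  by_cases h6 : (6 : ZMod n) = 0
  · have h6' := six_eq_zero_of_iso h h' hT hT' ψ h6
    rcases eq_three_or_six_of h.2.1 h6 with rfl | rfl
    · rcases eq_three_or_six_of h'.2.1 h6' with rfl | rfl
      · rfl
      · exact absurd hT' (not_twoArcTransitive_of_six h')
    · exact absurd hT (not_twoArcTransitive_of_six h)
  · have h6' : (6 : ZMod n') ≠ 0 := fun e => h6 (six_eq_zero_of_iso h' h hT' hT ψ.symm e)
    have key := zigzag_period_of_iso h h' hT hT' ψ h6'
    have k1 : n' ∣ 2 * n := ((key (2 * n)).2 ⟨dvd_mul_right _ _, dvd_mul_left _ _⟩).2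
    have k2 : n ∣ 2 * n' := ((key (2 * n')).1 ⟨dvd_mul_right _ _, dvd_mul_left _ _⟩).2
    obtain ⟨_, _, _, hc⟩ := params_of_twoArcTransitive h hT
    obtain ⟨_, _, _, hc'⟩ := params_of_twoArcTransitive h' hT'
    have hodd : ∀ a b : ℕ, a % 2 = 1 → a ∣ 2 * b → a ∣ b := fun a b ha hab =>
      (Nat.Coprime.dvd_of_dvd_mul_left
        (Nat.coprime_two_right.2 (Nat.odd_iff.2 ha)) hab)
    have hno : ∀ a b : ℕ, a % 2 = 1 → 4 ∣ b → b ∣ 2 * a → False := by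
      intro a b ha hb hab
      have := dvd_trans hb hab
      omega
    rcases hc with ⟨hn, -⟩ | ⟨hn, -, -⟩ <;> rcases hc' with ⟨hn', -⟩ | ⟨hn', -, -⟩
    · exact Nat.dvd_antisymm (hodd _ _ hn' k1) (hodd _ _ hn k2)
    · exact (hno _ _ hn hn' k1).elim
    · exact (hno _ _ hn' hn k2).elim
    · have h2 : 2 ∣ n := dvd_trans (by norm_num) hn
      have h2' : 2 ∣ n' := dvd_trans (by norm_num) hn'
      exact Nat.dvd_antisymm ((key n).2 ⟨h2, dvd_rfl⟩).2 ((key n').1 ⟨h2', dvd_rfl⟩).2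

/-! ### The number of vertices -/

/-- The submodule of the vectors that are divisible by `2`. -/
def evenVec (n : ℕ) : Submodule (ZMod n) (Fin 2 → ZMod n) :=
  LinearMap.range ((2 : ZMod n) • (LinearMap.id : (Fin 2 → ZMod n) →ₗ[ZMod n] Fin 2 → ZMod n))

theorem mem_evenVec {n : ℕ} {v : Fin 2 → ZMod n} :
    v ∈ evenVec n ↔ ∃ w : Fin 2 → ZMod n, (2 : ZMod n) • w = v := Iff.rfl

/-- The number of steps with direction `e₀`, and with direction `e₁`, on the way from level `0` to
level `k`. Modulo `2` all units are `1`, and this is the only vector at level `k` in the component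
of the origin. -/
def baseVec (n : ℕ) (k : ℤ) : Fin 2 → ZMod n :=
  fun j => if j = 0 then (((k + 1) / 2 : ℤ) : ZMod n) else ((k / 2 : ℤ) : ZMod n)

/-- For even `n` units are odd, and for odd `n` every element of `ZMod n` is a multiple of `2`. -/
theorem exists_two_mul_eq_unit_sub_one {n : ℕ} [NeZero n] (u : (ZMod n)ˣ) :
    ∃ w : ZMod n, 2 * w = (u : ZMod n) - 1 := by
  have hco := ZMod.val_coe_unit_coprime u
  rcases Nat.even_or_odd' (u : ZMod n).val with ⟨t, ht | ht⟩
  · have hn : Odd n := by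
      rw [← Nat.coprime_two_left]
      exact Nat.Coprime.coprime_dvd_left ⟨t, ht⟩ hco
    obtain ⟨N, hN⟩ := hn
    have h0 := ZMod.natCast_self n
    have h2 : ((2 : ZMod n)) * (N + 1) = 1 := by
      rw [hN] at h0 ⊢
      push_cast at h0
      linear_combination h0
    exact ⟨(N + 1) * ((u : ZMod n) - 1), by linear_combination ((u : ZMod n) - 1) * h2⟩
  · refine ⟨t, ?_⟩
    have := ZMod.natCast_zmod_val (u : ZMod n)
    rw [ht] at this
    push_cast at this
    rw [← this]
    ring

/-- All displacements are the change of `baseVec`, up to vectors divisible by `2`. -/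
theorem step_mod_evenVec {n : ℕ} [NeZero n] (r : (ZMod n)ˣ) (k : ℤ) {c : ZMod n} (hc : IsSign c) :
    c • stepVec r k - (baseVec n (k + 1) - baseVec n k) ∈ evenVec n := by
  obtain ⟨w, hw⟩ := exists_two_mul_eq_unit_sub_one (r ^ k)
  obtain ⟨d, hd⟩ : ∃ d : ZMod n, 2 * d = c - 1 := by
    rcases hc with rfl | rfl
    · exact ⟨0, by ring⟩
    · exact ⟨-1, by ring⟩
  rw [mem_evenVec]
  have key : c * ((r ^ k : (ZMod n)ˣ) : ZMod n) - 1 =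
      2 * (w + d * ((r ^ k : (ZMod n)ˣ) : ZMod n)) := by
    linear_combination -hw - ((r ^ k : (ZMod n)ˣ) : ZMod n) * hd
  rcases Int.emod_two_eq_zero_or_one k with h0 | h0
  · refine ⟨fun j => if j = 0 then w + d * ((r ^ k : (ZMod n)ˣ) : ZMod n) else 0, ?_⟩
    funext j
    have e1 : (k + 1 + 1) / 2 = k / 2 + 1 := by omega
    have e2 : (k + 1) / 2 = k / 2 := by omega
    fin_cases j
    · simp [stepVec, baseVec, h0, e1, e2, ← key]
    · simp [stepVec, baseVec, h0, e2]
  · refine ⟨fun j => if j = 0 then 0 else w + d * ((r ^ k : (ZMod n)ˣ) : ZMod n), ?_⟩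
    funext j
    have e1 : (k + 1 + 1) / 2 = (k + 1) / 2 := by omega
    have e2 : (k + 1) / 2 = k / 2 + 1 := by omega
    fin_cases j
    · simp [stepVec, baseVec, h0, e1]
    · simp [stepVec, baseVec, h0, e2, ← key]

theorem exists_eq_add_stepVec {n : ℕ} (r : (ZMod n)ˣ) (k : ℤ) (w : Fin 2 → ZMod n) :
    ∃ a b : ZMod n, w = a • stepVec r k + b • stepVec r (k - 1) := by
  have hinv : ∀ (j : ℤ) (x : ZMod n),
      x * ((r ^ (-j) : (ZMod n)ˣ) : ZMod n) * ((r ^ j : (ZMod n)ˣ) : ZMod n) = x := by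
    intro j x
    rw [mul_assoc, ← Units.val_mul, ← zpow_add, neg_add_cancel, zpow_zero, Units.val_one, mul_one]
  rcases Int.emod_two_eq_zero_or_one k with h0 | h0
  · have h1 : (k - 1) % 2 = 1 := by omega
    refine ⟨w 0 * ((r ^ (-k) : (ZMod n)ˣ) : ZMod n),
      w 1 * ((r ^ (-(k - 1)) : (ZMod n)ˣ) : ZMod n), ?_⟩
    funext j
    fin_cases j
    · simp [stepVec, h0, h1]
    · simpa [stepVec, h0, h1] using (hinv (k - 1) (w 1)).symm
  · have h1 : (k - 1) % 2 = 0 := by omega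
    refine ⟨w 1 * ((r ^ (-k) : (ZMod n)ˣ) : ZMod n),
      w 0 * ((r ^ (-(k - 1)) : (ZMod n)ˣ) : ZMod n), ?_⟩
    funext j
    fin_cases j
    · simpa [stepVec, h0, h1] using (hinv (k - 1) (w 0)).symm
    · simp [stepVec, h0, h1]

/-- Two steps up and down, or down and up, add `2 stepVec r k`, or `2 stepVec r (k - 1)`; these vectors
generate `evenVec n`. -/
theorem mem_component_add_even {m n : ℕ} [NeZero n] {r : (ZMod n)ˣ} (h : CPMAssumption m 2 n r)
    {k : ℤ} {v w : Fin 2 → ZMod n} (hw : w ∈ evenVec n)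
    (hv : pt m k v ∈ ((CPMbar m 2 n r).connectedComponentMk (0, 0)).supp) :
    pt m k (v + w) ∈ ((CPMbar m 2 n r).connectedComponentMk (0, 0)).supp := by
  obtain ⟨w, rfl⟩ := mem_evenVec.1 hw
  obtain ⟨a, b, rfl⟩ := exists_eq_add_stepVec r k w
  have hup : ∀ (i : ℕ) (v : Fin 2 → ZMod n),
      pt m k v ∈ ((CPMbar m 2 n r).connectedComponentMk (0, 0)).supp →
      pt m k (v + (2 * i : ZMod n) • stepVec r k) ∈
        ((CPMbar m 2 n r).connectedComponentMk (0, 0)).supp := by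
    intro i v hv
    induction i with
    | zero => simpa using hv
    | succ i ih =>
      have h1 := mem_component_of_adj ih (adj_up h _ _ IsSign.one)
      have h2 := mem_component_of_adj h1 (adj_down h _ _ IsSign.one)
      rw [add_sub_cancel_right] at h2
      convert h2 using 2
      push_cast
      module
  have hdown : ∀ (i : ℕ) (v : Fin 2 → ZMod n),
      pt m k v ∈ ((CPMbar m 2 n r).connectedComponentMk (0, 0)).supp →
      pt m k (v + (2 * i : ZMod n) • stepVec r (k - 1)) ∈
        ((CPMbar m 2 n r).connectedComponentMk (0, 0)).supp := by
    intro i v hv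
    induction i with
    | zero => simpa using hv
    | succ i ih =>
      have h1 := mem_component_of_adj ih (adj_down h _ _ IsSign.one)
      have h2 := mem_component_of_adj h1 (adj_up h _ _ IsSign.one)
      rw [sub_add_cancel] at h2
      convert h2 using 2
      push_cast
      module
  have := hdown b.val _ (hup a.val v hv)
  rw [ZMod.natCast_zmod_val, ZMod.natCast_zmod_val] at this
  convert this using 2
  module

/-- The component of the origin. The hypothesis `hpar` says that the class of `baseVec n k` modulo
`evenVec n` depends only on `k` modulo `m * 2`. -/
theorem mem_component_iff {m n : ℕ} {r : (ZMod n)ˣ} (h : CPMAssumption m 2 n r)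
    (hpar : n % 2 = 1 ∨ 2 ∣ m) (x : ZMod (m * 2) × (Fin 2 → ZMod n)) :
    x ∈ ((CPMbar m 2 n r).connectedComponentMk (0, 0)).supp ↔
      x.2 - baseVec n x.1.val ∈ evenVec n := by
  have : NeZero n := ⟨by have := h.2.1; omega⟩
  have hperiod : ∀ k t : ℤ, baseVec n (k + (m * 2 : ℕ) * t) - baseVec n k ∈ evenVec n := by
    intro k t
    obtain ⟨w, hw⟩ : ∃ w : ZMod n, 2 * w = m * t := by
      rcases hpar with hn | ⟨M, hM⟩
      · obtain ⟨N, hN⟩ := Nat.odd_iff.2 hn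
        have h0 := ZMod.natCast_self n
        have h2 : ((2 : ZMod n)) * (N + 1) = 1 := by
          rw [hN] at h0 ⊢
          push_cast at h0
          linear_combination h0
        exact ⟨(N + 1) * (m * t), by linear_combination (m * t : ZMod n) * h2⟩
      · exact ⟨M * t, by rw [hM]; push_cast; ring⟩
    rw [mem_evenVec]
    refine ⟨fun _ => w, ?_⟩
    have e1 : (k + (m * 2 : ℕ) * t + 1) / 2 = (k + 1) / 2 + m * t := by
      rw [show k + (m * 2 : ℕ) * t + 1 = k + 1 + (m * t) * 2 by push_cast; ring,
        Int.add_mul_ediv_right _ _ (by norm_num)]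
    have e2 : (k + (m * 2 : ℕ) * t) / 2 = k / 2 + m * t := by
      rw [show k + (m * 2 : ℕ) * t = k + (m * t) * 2 by push_cast; ring,
        Int.add_mul_ediv_right _ _ (by norm_num)]
    push_cast at e1 e2
    funext j
    fin_cases j
    · simp [baseVec, e1, hw]
    · simp [baseVec, e2, hw]
  have hpt : ∀ (k : ℤ) (v : Fin 2 → ZMod n),
      (pt m k v).2 - baseVec n (pt m k v : ZMod (m * 2) × (Fin 2 → ZMod n)).1.val ∈ evenVec n ↔
        v - baseVec n k ∈ evenVec n := by
    intro k v
    have : NeZero (m * 2) := ⟨by have := h.2.2.2.2.1; omega⟩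
    have hv : (((k : ZMod (m * 2)).val : ℕ) : ℤ) = k + (m * 2 : ℕ) * (-(k / (m * 2 : ℕ))) := by
      rw [ZMod.val_intCast]
      have := Int.emod_add_mul_ediv k (m * 2 : ℕ)
      linear_combination this
    simp only [pt, hv]
    have e : v - baseVec n k = v - baseVec n (k + (m * 2 : ℕ) * (-(k / (m * 2 : ℕ)))) +
        (baseVec n (k + (m * 2 : ℕ) * (-(k / (m * 2 : ℕ)))) - baseVec n k) := by abel
    rw [e, Submodule.add_mem_iff_left _ (hperiod _ _)]
  have hinv : ∀ x y, (CPMbar m 2 n r).Adj x y →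
      (x.2 - baseVec n x.1.val ∈ evenVec n ↔ y.2 - baseVec n y.1.val ∈ evenVec n) := by
    have key : ∀ (k : ℤ) (v : Fin 2 → ZMod n) (c : ZMod n), IsSign c →
        (v - baseVec n k ∈ evenVec n ↔
          v + c • stepVec r k - baseVec n (k + 1) ∈ evenVec n) := by
      intro k v c hc
      rw [← Submodule.add_mem_iff_left _ (step_mod_evenVec r k hc)]
      apply iff_of_eq
      congr 1
      abel
    intro x y hxy
    rcases (adj_iff h x y).1 hxy with ⟨k, v, c, hc, rfl, rfl⟩ | ⟨k, v, c, hc, rfl, rfl⟩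
    · rw [hpt, hpt]; exact key k v c hc
    · rw [hpt, hpt]; exact (key k v c hc).symm
  have hreach : ∀ x y, (CPMbar m 2 n r).Reachable x y →
      (x.2 - baseVec n x.1.val ∈ evenVec n ↔ y.2 - baseVec n y.1.val ∈ evenVec n) := by
    rintro x y ⟨p⟩
    induction p with
    | nil => rfl
    | cons hxy _ ih => exact (hinv _ _ hxy).trans ih
  have hforward : ∀ x ∈ ((CPMbar m 2 n r).connectedComponentMk (0, 0)).supp,
      x.2 - baseVec n x.1.val ∈ evenVec n := by
    intro x hx
    rw [SimpleGraph.ConnectedComponent.mem_supp_iff, SimpleGraph.ConnectedComponent.eq] at hx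
    rw [hreach _ _ hx]
    have e : baseVec n 0 = 0 := by funext j; simp [baseVec]
    simp [e]
  refine ⟨hforward x, fun hx => ?_⟩
  have hlev : ∀ k : ℕ, ∃ v : Fin 2 → ZMod n,
      pt m k v ∈ ((CPMbar m 2 n r).connectedComponentMk (0, 0)).supp := by
    intro k
    induction k with
    | zero => exact ⟨0, origin_mem⟩
    | succ k ih =>
      obtain ⟨v, hv⟩ := ih
      exact ⟨_, mem_component_of_adj hv (adj_up h _ _ IsSign.one)⟩
  obtain ⟨v, hv⟩ := hlev x.1.val
  have hv' := (hpt _ _).1 (hforward _ hv)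
  have := mem_component_add_even h (Submodule.sub_mem _ hx hv') hv
  rw [show v + (x.2 - baseVec n x.1.val - (v - baseVec n x.1.val)) = x.2 by abel,
    pt_val_cast h] at this
  exact this

theorem card_component {m n : ℕ} {r : (ZMod n)ˣ} (h : CPMAssumption m 2 n r)
    (hpar : n % 2 = 1 ∨ 2 ∣ m) :
    Nat.card ((CPMbar m 2 n r).connectedComponentMk (0, 0)) = m * 2 * Nat.card (evenVec n) := by
  let e : (CPMbar m 2 n r).connectedComponentMk (0, 0) ≃ ZMod (m * 2) × evenVec n :=
    { toFun := fun x => (x.1.1, ⟨_, (mem_component_iff h hpar x.1).1 x.2⟩)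
      invFun := fun y => ⟨(y.1, y.2.1 + baseVec n y.1.val), (mem_component_iff h hpar _).2
        (by rw [add_sub_cancel_right]; exact y.2.2)⟩
      left_inv := fun x => by simp
      right_inv := fun y => by simp }
  rw [Nat.card_congr e, Nat.card_prod, Nat.card_zmod]

/-- For fixed `n` the number of vertices is proportional to `m`. -/
theorem m_eq_of_iso {m m' n : ℕ} {r r' : (ZMod n)ˣ}
    (h : CPMAssumption m 2 n r) (h' : CPMAssumption m' 2 n r')
    (hT : IsTwoArcTransitive (CPM m 2 n r)) (hT' : IsTwoArcTransitive (CPM m' 2 n r'))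
    (ψ : CPM m' 2 n r' ≃g CPM m 2 n r) : m' = m := by
  have : NeZero n := ⟨by have := h.2.1; omega⟩
  obtain ⟨_, _, _, hc⟩ := params_of_twoArcTransitive h hT
  obtain ⟨_, _, _, hc'⟩ := params_of_twoArcTransitive h' hT'
  have e := Nat.card_congr ψ.toEquiv
  rw [card_component h' (hc'.imp (fun x => x.1) (fun x => x.2.1)),
    card_component h (hc.imp (fun x => x.1) (fun x => x.2.1))] at e
  have hpos : 0 < Nat.card (evenVec n) := Nat.card_pos
  have := Nat.eq_of_mul_eq_mul_right hpos e
  omega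

/-! ### Equivalent parameters -/

/-- Rescaling the second coordinate by `r' / r` maps `r ^ k e_ℓ` to `± r' ^ k e_ℓ`. -/
theorem nonempty_iso_of_sq {m n : ℕ} {r r' : (ZMod n)ˣ} (h : CPMAssumption m 2 n r)
    (h' : CPMAssumption m 2 n r') (hrr : (r' * r⁻¹) ^ 2 = 1 ∨ (r' * r⁻¹) ^ 2 = -1) :
    Nonempty (CPM m 2 n r' ≃g CPM m 2 n r) := by
  set t := r' * r⁻¹ with ht
  have hr' : r' = t * r := by rw [ht, inv_mul_cancel_right]
  let D : (Fin 2 → ZMod n) ≃+ (Fin 2 → ZMod n) :=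
    { toFun := fun v j => if j = 0 then v 0 else (t : ZMod n) * v 1
      invFun := fun v j => if j = 0 then v 0 else ((t⁻¹ : (ZMod n)ˣ) : ZMod n) * v 1
      left_inv := fun v => by funext j; fin_cases j <;> simp
      right_inv := fun v => by funext j; fin_cases j <;> simp
      map_add' := fun v w => by funext j; fin_cases j <;> simp [mul_add] }
  have hsq : ∀ j : ℤ, IsSign (((t ^ 2) ^ j : (ZMod n)ˣ) : ZMod n) := by
    intro j
    rcases hrr with e | e
    · rw [e, one_zpow]; exact Or.inl rfl
    · rw [e]
      rcases Int.even_or_odd j with hj | hj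
      · rw [hj.neg_one_zpow]; exact Or.inl rfl
      · rw [hj.neg_one_zpow]; exact Or.inr (by simp)
  have hD : ∀ k : ℤ, ∃ τ : ZMod n, IsSign τ ∧
      ∀ c : ZMod n, D (c • stepVec r k) = (c * τ) • stepVec r' k := by
    intro k
    refine ⟨_, hsq (-(k / 2)), fun c => ?_⟩
    generalize hσ : (t ^ 2) ^ (-(k / 2)) = σ
    rcases Int.emod_two_eq_zero_or_one k with h0 | h0
    · have e : σ * r' ^ k = r ^ k := by
        rw [← hσ, hr', mul_zpow, ← mul_assoc, ← zpow_natCast t 2, ← zpow_mul, ← zpow_add,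
          show ((2 : ℕ) : ℤ) * -(k / 2) + k = 0 by push_cast; omega, zpow_zero, one_mul]
      have e' := congrArg Units.val e
      rw [Units.val_mul] at e'
      funext j
      fin_cases j
      · simp [D, stepVec, h0, mul_assoc, ← e']
      · simp [D, stepVec, h0]
    · have e : σ * r' ^ k = t * r ^ k := by
        rw [← hσ, hr', mul_zpow, ← mul_assoc, ← zpow_natCast t 2, ← zpow_mul, ← zpow_add,
          show ((2 : ℕ) : ℤ) * -(k / 2) + k = 1 by push_cast; omega, zpow_one]
      have e' := congrArg Units.val e
      rw [Units.val_mul, Units.val_mul] at e'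
      funext j
      fin_cases j
      · simp [D, stepVec, h0]
      · simp [D, stepVec, h0, mul_assoc, e', mul_left_comm]
  have hadj : ∀ x y, (CPMbar m 2 n r).Adj x y ↔
      (CPMbar m 2 n r').Adj (x.1, D x.2) (y.1, D y.2) := by
    have key : ∀ x y : ZMod (m * 2) × (Fin 2 → ZMod n),
        (∃ (k : ℤ) (v : Fin 2 → ZMod n) (c : ZMod n), IsSign c ∧ x = pt m k v ∧
          y = pt m (k + 1) (v + c • stepVec r k)) ↔
        (∃ (k : ℤ) (v : Fin 2 → ZMod n) (c : ZMod n), IsSign c ∧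
          ((x.1, D x.2) : ZMod (m * 2) × (Fin 2 → ZMod n)) = pt m k v ∧
          ((y.1, D y.2) : ZMod (m * 2) × (Fin 2 → ZMod n)) =
            pt m (k + 1) (v + c • stepVec r' k)) := by
      intro x y
      constructor
      · rintro ⟨k, v, c, hc, rfl, rfl⟩
        obtain ⟨τ, hτ, hD⟩ := hD k
        refine ⟨k, D v, c * τ, hc.mul hτ, rfl, ?_⟩
        rw [← hD, ← map_add]
        rfl
      · rintro ⟨k, v, c, hc, hx, hy⟩
        obtain ⟨τ, hτ, hD⟩ := hD k
        have x1 : x.1 = (k : ZMod (m * 2)) := congrArg Prod.fst hx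
        have x2 : D x.2 = v := congrArg Prod.snd hx
        have y1 : y.1 = ((k + 1 : ℤ) : ZMod (m * 2)) := congrArg Prod.fst hy
        have y2 : D y.2 = v + c • stepVec r' k := congrArg Prod.snd hy
        refine ⟨k, x.2, c * τ, hc.mul hτ, Prod.ext x1 rfl, Prod.ext y1 (D.injective ?_)⟩
        change D y.2 = D (x.2 + (c * τ) • stepVec r k)
        rw [y2, map_add, hD, x2, mul_assoc, hτ.mul_self, mul_one]
    intro x y
    rw [adj_iff h, adj_iff h', key, key]
  let Φ : CPMbar m 2 n r ≃g CPMbar m 2 n r' :=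
    { toEquiv := Equiv.prodCongr (Equiv.refl _) D.toEquiv
      map_rel_iff' := fun {x y} => (hadj x y).symm }
  have h00 : Φ (0, 0) = (0, 0) := Prod.ext rfl (map_zero D)
  have hmem : ∀ x, x ∈ ((CPMbar m 2 n r).connectedComponentMk (0, 0)).supp ↔
      Φ x ∈ ((CPMbar m 2 n r').connectedComponentMk (0, 0)).supp := by
    intro x
    rw [SimpleGraph.ConnectedComponent.mem_supp_iff, SimpleGraph.ConnectedComponent.mem_supp_iff,
      SimpleGraph.ConnectedComponent.eq, SimpleGraph.ConnectedComponent.eq]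
    have := SimpleGraph.Iso.reachable_iff (φ := Φ) (u := x) (v := (0, 0))
    rw [h00] at this
    exact this.symm
  let Ψ : CPM m 2 n r ≃g CPM m 2 n r' :=
    { toEquiv := Equiv.subtypeEquiv Φ.toEquiv hmem
      map_rel_iff' := fun {x y} => by
        rw [CPM_adj, CPM_adj]
        exact Φ.map_adj_iff }
  exact ⟨Ψ.symm⟩

/-- With `n` fixed, the admissible values of `r ^ 2` differ by a sign. -/
theorem sq_eq_of_twoArcTransitive {m m' n : ℕ} {r r' : (ZMod n)ˣ}
    (h : CPMAssumption m 2 n r) (h' : CPMAssumption m' 2 n r')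
    (hT : IsTwoArcTransitive (CPM m 2 n r)) (hT' : IsTwoArcTransitive (CPM m' 2 n r')) :
    (r' * r⁻¹) ^ 2 = 1 ∨ (r' * r⁻¹) ^ 2 = -1 := by
  obtain ⟨κ, hκ, -, hc⟩ := params_of_twoArcTransitive h hT
  obtain ⟨κ', hκ', -, hc'⟩ := params_of_twoArcTransitive h' hT'
  have key : (r' : ZMod n) ^ 2 = κ' * κ * (r : ZMod n) ^ 2 := by
    rcases hc with ⟨hn, e⟩ | ⟨hn, -, e⟩ <;> rcases hc' with ⟨hn', e'⟩ | ⟨hn', -, e'⟩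
    · rw [e, e', mul_assoc, hκ.mul_self, mul_one]
    · omega
    · omega
    · rw [e, e', ← mul_assoc, mul_assoc κ', hκ.mul_self, mul_one]
  have hrr : r' ^ 2 = r ^ 2 ∨ r' ^ 2 = -r ^ 2 := by
    rcases hκ'.mul hκ with e | e <;> rw [e] at key
    · left; ext; simpa using key
    · right; ext; simpa using key
  rw [mul_pow, inv_pow]
  rcases hrr with e | e
  · left; rw [e, mul_inv_cancel]
  · right; rw [e, neg_mul, mul_inv_cancel]

theorem mainTheorem6 (m s n m' s' n' : ℕ) (r : (ZMod n)ˣ) (r' : (ZMod n')ˣ)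
    (h : CPMAssumption m s n r) (h' : CPMAssumption m' s' n' r')
    (hT : IsTwoArcTransitive (CPM m s n r)) (hT' : IsTwoArcTransitive (CPM m' s' n' r')) :
    Nonempty (CPM m' s' n' r' ≃g CPM m s n r) ↔
      m' = m ∧ s' = s ∧ s = 2 ∧
        ∃ hn : n' = n,
          (Units.mapEquiv (ZMod.ringEquivCongr hn).toMulEquiv r' * r⁻¹) ^ 2 = 1 ∨
          (Units.mapEquiv (ZMod.ringEquivCongr hn).toMulEquiv r' * r⁻¹) ^ 2 = -1 := by
  obtain ⟨rfl, -⟩ := two_mul_sq_of_twoArcTransitive h hT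
  obtain ⟨rfl, -⟩ := two_mul_sq_of_twoArcTransitive h' hT'
  have hcongr : ∀ u : (ZMod n)ˣ,
      Units.mapEquiv (ZMod.ringEquivCongr (rfl : n = n)).toMulEquiv u = u := by
    intro u
    ext
    simp
  constructor
  · rintro ⟨ψ⟩
    obtain rfl := n_eq_of_iso h h' hT hT' ψ
    refine ⟨m_eq_of_iso h h' hT hT' ψ, rfl, rfl, rfl, ?_⟩
    rw [hcongr]
    exact sq_eq_of_twoArcTransitive h h' hT hT'
  · rintro ⟨rfl, -, -, rfl, hrr⟩
    rw [hcongr] at hrr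
    exact nonempty_iso_of_sq h h' hrr
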